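/- Let $\Gamma$ be the 3-star with ray lengths $k,l,m\ge 1$: a tree with a central vertex $d$ and three rays $d-a_1-\dots-a_k$, $d-b_1-\dots-b_l$, $d-c_1-\dots-c_m$. Let $\Delta_\Gamma$ be its adjacency matrix, and let $\xi$ be its Perron--Frobenius eigenvector, i.e. its strictly positive eigenvector, normalized by $\xi(d)=1$, with eigenvalue $\lambda$. Put $\alpha_1=\xi(a_1)$, $\alpha_2=\xi(b_1)$, $\alpha_3=\xi(c_1)$. Then $\lambda=\alpha_1+\alpha_2+\alpha_3$. Let $G$ be the block of $\Delta_\Gamma$ whose rows are indexed by the vertices at even distance from $d$ and whose columns are indexed by the vertices at odd distance from $d$. A multi-matrix algebra is a finite direct sum of full matrix algebras over $\mathbb C$. We say that $\Gamma$ admits a commuting square of the form $$\begin{array}{lcl} B & \subset_{G^{t}G-I} & D \\ \cup_{G} & & \cup_{G}\\ A & \subset_{GG^{t}-I} & C\end{array}$$ if there are multi-matrix algebras $A\subset B\subset D$ and $A\subset C\subset D$ (unital $*$-subalgebras), with the minimal central projections of $A$ and of $C$ labelled by the even vertices and those of $B$ and of $D$ by the odd vertices, whose inclusion matrices are $G$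 for $A\subset B$, $GG^{t}-I$ for $A\subset C$, $G^{t}G-I$ for $B\subset D$ and $G$ for $C\subset D$, together with a faithful tracial state on $D$ such that the trace-preserving conditional expectations $E_A,E_B,E_C$ of $D$ onto $A,B,C$ satisfy $E_A=E_BE_C=E_CE_B$. Then $\Gamma$ admits a commuting square of this form if and only if there are nine vectors $(e_{ij})_{i,j=1}^{3}$ in $\mathbb C^2$ such that (a) $\|e_{ii}\|^2=(\lambda-\alpha_i)(\lambda\alpha_i-1)$ for $i=1,2,3$; (b) $\|e_{ij}\|^2=\alpha_i+\alpha_j-\lambda\alpha_i\alpha_j$ for $i\ne j$; (c) $\sum_{j} e_{ij}\otimes\overline{e}_{ij}=\alpha_i I_2$ for $i=1,2,3$; (d) $\sum_{i} e_{ij}\otimes\overline{e}_{ij}=\alpha_j I_2$ for $j=1,2,3$, where $I_2$ is the $2\times 2$ identity matrix and $x\otimes\overline y$ denotes the operator $z\mapsto (z,y)\,x$ on $\mathbb C^2$, the inner product $(\cdot,\cdot)$ being linear in its first variable. -/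

import Mathlib

namespace StarSquare

/-! ### The 3-star and its inclusion matrix -/

/-- Vertices of the 3-star whose rays have `n 0`, `n 1`, `n 2` vertices (centre not counted):
`none` is the centre `d`, and `some ⟨i, j⟩` is the vertex at position `j + 1` on the ray `i`. -/
abbrev Vertex (n : Fin 3 → ℕ) : Type := Option (Σ i : Fin 3, Fin (n i))

/-- `OneStepOut p q`: `q` is the neighbour of `p` that lies one step further from the centre. -/
def OneStepOut (n : Fin 3 → ℕ) : Vertex n → Vertex n → Prop
  | none, some ⟨_, j⟩ => (j : ℕ) = 0
  | some ⟨i, j⟩, some ⟨i', j'⟩ => i = i' ∧ (j' : ℕ) = (j : ℕ) + 1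
  | _, none => False

/-- The 3-star with ray lengths `n 0`, `n 1`, `n 2`. -/
def threeStar (n : Fin 3 → ℕ) : SimpleGraph (Vertex n) := SimpleGraph.fromRel (OneStepOut n)

/-- The vertices at even distance from the centre. -/
abbrev EvenVertex (n : Fin 3 → ℕ) : Type := {p : Vertex n // Even ((threeStar n).dist p none)}

/-- The vertices at odd distance from the centre. -/
abbrev OddVertex (n : Fin 3 → ℕ) : Type := {p : Vertex n // Odd ((threeStar n).dist p none)}

open Classical in
/-- The adjacency matrix of the 3-star. -/
noncomputable def adjacency (n : Fin 3 → ℕ) (R : Type) [Zero R] [One R] :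
    Matrix (Vertex n) (Vertex n) R :=
  (threeStar n).adjMatrix R

/-- The block of the adjacency matrix with rows the even and columns the odd vertices. -/
noncomputable def biadjacency (n : Fin 3 → ℕ) : Matrix (EvenVertex n) (OddVertex n) ℤ :=
  (adjacency n ℤ).submatrix Subtype.val Subtype.val

/-- `ξ` is a Perron-Frobenius eigenvector of `M`, with eigenvalue `lam`: a strictly positive
eigenvector. (For the adjacency matrix of a finite connected graph it is unique up to a positive
factor, and its eigenvalue is the spectral radius.) -/
def IsPerronFrobenius {V : Type} [Fintype V] (M : Matrix V V ℝ) (lam : ℝ) (ξ : V → ℝ) : Prop :=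
  (∀ v, 0 < ξ v) ∧ M.mulVec ξ = lam • ξ

/-! ### Multi-matrix algebras and commuting squares -/

/-- The multi-matrix algebra `⨁ᵢ M_{n i}(ℂ)`, with its minimal central projections (those of the
summands) labelled by `ι`; the sizes `n i` are required to be positive where it is used. -/
abbrev MultiMatrix {ι : Type} (n : ι → ℕ) : Type := ∀ i, Matrix (Fin (n i)) (Fin (n i)) ℂ

/-- `Λ` is the inclusion matrix of `φ`: a minimal projection of the `i`-th summand of the source is
mapped to a projection whose component in the `j`-th summand of the target has rank `Λ i j`. -/
def HasInclusionMatrix {ι κ : Type} [DecidableEq ι] {a : ι → ℕ} {b : κ → ℕ}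
    (φ : MultiMatrix a →⋆ₐ[ℂ] MultiMatrix b) (Λ : Matrix ι κ ℤ) : Prop :=
  ∀ (i : ι) (e : Matrix (Fin (a i)) (Fin (a i)) ℂ), IsStarProjection e → e.rank = 1 →
    ∀ j, ((φ (Pi.single i e) j).rank : ℤ) = Λ i j

/-- `tr` is a faithful tracial state. -/
structure IsFaithfulTracialState {D : Type} [Ring D] [StarRing D] [Algebra ℂ D]
    (tr : D →ₗ[ℂ] ℂ) : Prop where
  map_one : tr 1 = 1
  map_mul_comm : ∀ x y, tr (x * y) = tr (y * x)
  pos : ∀ x, x ≠ 0 → ∃ r : ℝ, 0 < r ∧ tr (star x * x) = r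

/-- `E` is the `tr`-preserving conditional expectation of `D` onto the subalgebra `S`. For a
faithful trace these properties determine `E`, and they imply that it is positive. -/
structure IsCondExp {D : Type} [Ring D] [StarRing D] [Algebra ℂ D] [StarModule ℂ D]
    (tr : D →ₗ[ℂ] ℂ) (S : StarSubalgebra ℂ D) (E : D →ₗ[ℂ] D) : Prop where
  mem : ∀ x, E x ∈ S
  fix : ∀ s ∈ S, E s = s
  bimodule : ∀ s ∈ S, ∀ t ∈ S, ∀ x, E (s * x * t) = s * E x * t
  trace_preserving : ∀ x, tr (E x) = tr x

/-- The subalgebras `A ⊆ B ⊆ D`, `A ⊆ C ⊆ D` form a commuting square with respect to `tr`: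
`E_A = E_B E_C = E_C E_B`. -/
def IsCommutingSquare {D : Type} [Ring D] [StarRing D] [Algebra ℂ D] [StarModule ℂ D]
    (tr : D →ₗ[ℂ] ℂ) (A B C : StarSubalgebra ℂ D) : Prop :=
  A ≤ B ∧ A ≤ C ∧ ∃ EA EB EC : D →ₗ[ℂ] D,
    IsCondExp tr A EA ∧ IsCondExp tr B EB ∧ IsCondExp tr C EC ∧ EA = EB ∘ₗ EC ∧ EA = EC ∘ₗ EB

/-- A commuting square of multi-matrix algebras with prescribed inclusion matrices,
```
  B ⊂_L D
  ∪_G   ∪_H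
  A ⊂_K C
```
together with a faithful tracial state on `D`. The inclusions are unital injective
*-homomorphisms, and the minimal central projections of `A, B, C, D` are labelled by
`IA, IB, IC, ID`. -/
structure CommutingSquare {IA IB IC ID : Type} [DecidableEq IA] [DecidableEq IB] [DecidableEq IC]
    (G : Matrix IA IB ℤ) (K : Matrix IA IC ℤ) (L : Matrix IB ID ℤ) (H : Matrix IC ID ℤ) where
  a : IA → ℕ
  b : IB → ℕ
  c : IC → ℕ
  d : ID → ℕ
  a_pos : ∀ i, 0 < a i
  b_pos : ∀ i, 0 < b i
  c_pos : ∀ i, 0 < c i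
  d_pos : ∀ i, 0 < d i
  inclAB : MultiMatrix a →⋆ₐ[ℂ] MultiMatrix b
  inclAC : MultiMatrix a →⋆ₐ[ℂ] MultiMatrix c
  inclBD : MultiMatrix b →⋆ₐ[ℂ] MultiMatrix d
  inclCD : MultiMatrix c →⋆ₐ[ℂ] MultiMatrix d
  inclAB_injective : Function.Injective inclAB
  inclAC_injective : Function.Injective inclAC
  inclBD_injective : Function.Injective inclBD
  inclCD_injective : Function.Injective inclCD
  square : inclBD.comp inclAB = inclCD.comp inclAC
  inclAB_matrix : HasInclusionMatrix inclAB G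
  inclAC_matrix : HasInclusionMatrix inclAC K
  inclBD_matrix : HasInclusionMatrix inclBD L
  inclCD_matrix : HasInclusionMatrix inclCD H
  tr : MultiMatrix d →ₗ[ℂ] ℂ
  tr_state : IsFaithfulTracialState tr
  commuting : IsCommutingSquare tr (inclBD.comp inclAB).range inclBD.range inclCD.range

/-- The 3-star with biadjacency matrix `G` admits a commuting square with inclusion matrices
`A ⊂_G B`, `A ⊂_{G Gᵗ - I} C`, `B ⊂_{Gᵗ G - I} D`, `C ⊂_G D`. -/
def AdmitsCommutingSquare (n : Fin 3 → ℕ) : Prop :=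
  let G := biadjacency n
  Nonempty (CommutingSquare G (G * G.transpose - 1) (G.transpose * G - 1) G)

end StarSquare

/-!
Write `G` for the biadjacency matrix of the 3-star. A commuting square with inclusion matrices `G`,
`G * Gᵗ - 1`, `Gᵗ * G - 1`, `G` is, up to a choice of bases, a connection: for each cell
`i - j - l`, `i - k - l` of edges of the four graphs a complex number, such that these numbers form
unitary matrices both for fixed `i`, `l` and, after rescaling by the trace, for fixed `j`, `k`. On
the 3-star nearly all of these matrices have size one or two, and up to a choice of phases their
entries are forced. The exception is at the centre, whose row of `G * Gᵗ - 1` has a diagonal entry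
two: the cells with `i` and `k` both at the centre contribute nine vectors in `ℂ²`, and these are
the only freedom left.

*From a commuting square to the vectors.* The trace has to be the Perron-Frobenius one, although
this is not assumed: Bessel's inequality for an orthogonal family in `D` gives an inequality between
the trace vectors for each edge of the graph of `Gᵗ * G - 1` (`CommutingSquare.IsTraceVector.index_le`),
the sum of these over all edges is an equality, and connectedness then forces a common eigenvector
(`traceVector_eq`). The vectors are found in the summands of `D` labelled by the neighbours `y` of
the centre, as overlaps of the rank-one projections coming from the neighbours `x` of the centre in
`B` with the two-dimensional multiplicity space of `C` at the centre. The completeness relations in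
the two indices are the unit of `A` and the commuting square condition, and the norms are computed
from the trace (`exists_vectors`).

*From the vectors to a commuting square.* A connection defines a commuting square by letting `B`,
`C` and `D` be algebras of matrices indexed by paths starting at an arbitrary even vertex, the
connection being the change of basis between the paths `i - k - l` and `i - j - l`
(`Connection.nonempty_commutingSquare`). On each ray the connection is given by an explicit formula
in the eigenvector, whose unitarity is a constancy of Casoratians (`IsEigen.sq_sub`,
`IsEigen.mul_sub`, `rayWeight_unitary`). Near the centre, the three vectors in a row or column of the
nine form two orthogonal columns of a three by three matrix, which is completed by a conjugated cross
product (`exists_completion`). The second unitarity condition is the first one for the reflected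
connection (`starWeight_symm`), which is of the same kind with the nine vectors transposed.
-/

namespace StarSquare

/-! ### Coordinates on the 3-star -/

section Coordinates

variable {n : Fin 3 → ℕ}

/-- The distance of a vertex from the centre, read off from its coordinates. -/
def pos : Vertex n → ℕ
  | none => 0
  | some q => q.2 + 1

/-- The ray of a vertex; the centre, which lies on every ray, is assigned the ray `0`. -/
def ray : Vertex n → Fin 3
  | none => 0
  | some q => q.1

variable (n) in
/-- The vertex at distance `p` from the centre on the ray `x`. Beyond the end of the ray the value
is the centre. -/
def vtx (x : Fin 3) : ℕ → Vertex n
  | 0 => none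
  | p + 1 => if h : p < n x then some ⟨x, ⟨p, h⟩⟩ else none

@[simp] lemma vtx_zero (x : Fin 3) : vtx n x 0 = none := rfl

lemma vtx_succ {x : Fin 3} {p : ℕ} (h : p < n x) : vtx n x (p + 1) = some ⟨x, ⟨p, h⟩⟩ := by
  simp [vtx, h]

@[simp] lemma pos_none : pos (none : Vertex n) = 0 := rfl

@[simp] lemma pos_vtx {x : Fin 3} {p : ℕ} (h : p ≤ n x) : pos (vtx n x p) = p := by
  cases p with
  | zero => rfl
  | succ p => rw [vtx_succ h]; rfl

lemma ray_vtx {x : Fin 3} {p : ℕ} (h0 : 0 < p) (h : p ≤ n x) : ray (vtx n x p) = x := by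
  cases p with
  | zero => omega
  | succ p => rw [vtx_succ h]; rfl

lemma vtx_ray_pos (v : Vertex n) : vtx n (ray v) (pos v) = v := by
  rcases v with _ | ⟨x, r⟩
  · rfl
  · exact vtx_succ r.2

lemma pos_le (v : Vertex n) : pos v ≤ n (ray v) := by
  rcases v with _ | ⟨x, r⟩
  · simp
  · exact r.2

lemma pos_eq_zero {v : Vertex n} : pos v = 0 ↔ v = none := by
  rcases v with _ | q <;> simp [pos]

lemma vertex_ext_iff {u v : Vertex n} : u = v ↔ pos u = pos v ∧ (pos u = 0 ∨ ray u = ray v) := by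
  constructor
  · rintro rfl; simp
  · rintro ⟨h, h0 | h1⟩
    · rw [pos_eq_zero.1 h0, pos_eq_zero.1 (h.symm.trans h0)]
    · rw [← vtx_ray_pos u, ← vtx_ray_pos v, h, h1]

lemma exists_vtx (v : Vertex n) : ∃ x p, p ≤ n x ∧ v = vtx n x p :=
  ⟨ray v, pos v, pos_le v, (vtx_ray_pos v).symm⟩

lemma oneStepOut_iff {u v : Vertex n} :
    OneStepOut n u v ↔ pos v = pos u + 1 ∧ (pos u = 0 ∨ ray u = ray v) := by
  rcases u with _ | ⟨x, r⟩ <;> rcases v with _ | ⟨y, s⟩ <;> simp [OneStepOut, pos, ray]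
  tauto

lemma adj_iff {u v : Vertex n} : (threeStar n).Adj u v ↔
    (pos v = pos u + 1 ∧ (pos u = 0 ∨ ray u = ray v)) ∨
      (pos u = pos v + 1 ∧ (pos v = 0 ∨ ray v = ray u)) := by
  rw [threeStar, SimpleGraph.fromRel_adj, oneStepOut_iff, oneStepOut_iff]
  constructor
  · exact fun h => h.2
  · refine fun h => ⟨?_, h⟩
    rintro rfl
    omega

lemma exists_walk_to_centre (x : Fin 3) (p : ℕ) (hp : p ≤ n x) :
    ∃ w : (threeStar n).Walk (vtx n x p) none, w.length = p := by
  induction p with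
  | zero => exact ⟨SimpleGraph.Walk.nil, rfl⟩
  | succ p ih =>
    obtain ⟨w, hw⟩ := ih (by omega)
    have : (threeStar n).Adj (vtx n x (p + 1)) (vtx n x p) := by
      rw [adj_iff, pos_vtx hp, pos_vtx (by omega : p ≤ n x)]
      right
      refine ⟨rfl, ?_⟩
      rcases Nat.eq_zero_or_pos p with h | h
      · exact Or.inl h
      · right; rw [ray_vtx h (by omega), ray_vtx (by omega) hp]
    exact ⟨SimpleGraph.Walk.cons this w, by simp [hw]⟩

lemma pos_le_length {u v : Vertex n} (w : (threeStar n).Walk u v) : pos u ≤ w.length + pos v := by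
  induction w with
  | nil => simp
  | cons h w ih =>
    rw [adj_iff] at h
    rw [SimpleGraph.Walk.length_cons]
    omega

lemma dist_centre (v : Vertex n) : (threeStar n).dist v none = pos v := by
  obtain ⟨w, hw⟩ : ∃ w : (threeStar n).Walk v none, w.length = pos v := by
    have := exists_walk_to_centre (ray v) (pos v) (pos_le v)
    rwa [vtx_ray_pos] at this
  apply le_antisymm
  · exact hw ▸ SimpleGraph.dist_le w
  · obtain ⟨w', hw'⟩ := w.reachable.exists_walk_length_eq_dist
    have := pos_le_length w'
    rw [← hw']; simpa using this

lemma even_pos (i : EvenVertex n) : Even (pos i.1) := dist_centre i.1 ▸ i.2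

lemma odd_pos (j : OddVertex n) : Odd (pos j.1) := dist_centre j.1 ▸ j.2

/-- The even vertex with given coordinates. -/
def evenVtx (x : Fin 3) (p : ℕ) (h : p ≤ n x) (hp : Even p) : EvenVertex n :=
  ⟨vtx n x p, by rw [dist_centre, pos_vtx h]; exact hp⟩

/-- The odd vertex with given coordinates. -/
def oddVtx (x : Fin 3) (p : ℕ) (h : p ≤ n x) (hp : Odd p) : OddVertex n :=
  ⟨vtx n x p, by rw [dist_centre, pos_vtx h]; exact hp⟩

/-- The centre as an even vertex. -/
def centre : EvenVertex n := ⟨none, by simp [SimpleGraph.dist_self]⟩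

open Classical in
/-- The adjacency indicator. -/
noncomputable def adjI (R : Type) [Zero R] [One R] (u v : Vertex n) : R :=
  if (threeStar n).Adj u v then 1 else 0

lemma adjI_comm (R : Type) [Zero R] [One R] (u v : Vertex n) : adjI R u v = adjI R v u := by
  unfold adjI; congr 1; exact propext ((threeStar n).adj_comm u v)

lemma adjI_mul {R : Type} [NonAssocSemiring R] (u v : Vertex n) (a : R) :
    adjI R u v * a = @ite _ ((threeStar n).Adj u v) (Classical.dec _) a 0 := by
  unfold adjI; split_ifs <;> simp

lemma biadjacency_apply (i : EvenVertex n) (j : OddVertex n) :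
    biadjacency n i j = adjI ℤ i.1 j.1 := by
  simp [biadjacency, adjacency, adjI, SimpleGraph.adjMatrix_apply]

lemma adjacency_apply (R : Type) [Zero R] [One R] (u v : Vertex n) :
    adjacency n R u v = adjI R u v := by
  simp [adjacency, adjI, SimpleGraph.adjMatrix_apply]

lemma adj_none_iff {v : Vertex n} : (threeStar n).Adj none v ↔ pos v = 1 := by
  rw [adj_iff]; simp

lemma adj_vtx_succ_iff {x : Fin 3} {p : ℕ} (hp : p + 1 ≤ n x) {v : Vertex n} :
    (threeStar n).Adj (vtx n x (p + 1)) v ↔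
      v = vtx n x p ∨ (p + 2 ≤ n x ∧ v = vtx n x (p + 2)) := by
  have hv := pos_le v
  rw [adj_iff, pos_vtx hp, ray_vtx (by omega) hp]
  constructor
  · rintro (⟨h1, h2⟩ | ⟨h1, h2⟩)
    · right
      have h2 : x = ray v := by simpa using h2
      have h3 : p + 2 ≤ n x := by rw [h2]; omega
      exact ⟨h3, by rw [← vtx_ray_pos v, h1, h2]⟩
    · left
      rw [vertex_ext_iff, pos_vtx (by omega : p ≤ n x)]
      refine ⟨by omega, ?_⟩
      rcases Nat.eq_zero_or_pos p with h | h
      · left; omega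
      · right; rw [ray_vtx h (by omega)]
        rcases h2 with h2 | h2
        · omega
        · exact h2
  · rintro (rfl | ⟨h, rfl⟩)
    · right
      rw [pos_vtx (by omega : p ≤ n x)]
      refine ⟨rfl, ?_⟩
      rcases Nat.eq_zero_or_pos p with h | h
      · exact Or.inl h
      · right; rw [ray_vtx h (by omega)]
    · left
      rw [pos_vtx h, ray_vtx (by omega) h]
      simp

open Classical in
/-- The sum of `F` over the neighbours of the centre. -/
lemma sum_adj_none (hn : ∀ i, 0 < n i) {M : Type*} [AddCommMonoid M] (F : Vertex n → M) :
    (∑ v, if (threeStar n).Adj none v then F v else 0) = ∑ z, F (vtx n z 1) := by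
  rw [← Finset.sum_filter]
  symm
  apply Finset.sum_bij (fun z _ => vtx n z 1)
  · intro z _
    simp [adj_none_iff, pos_vtx (hn z)]
  · intro z _ z' _ h
    have := congrArg ray h
    rwa [ray_vtx one_pos (hn z), ray_vtx one_pos (hn z')] at this
  · intro v hv
    simp only [Finset.mem_filter, adj_none_iff] at hv
    exact ⟨ray v, Finset.mem_univ _, by rw [← hv.2, vtx_ray_pos]⟩
  · simp

open Classical in
/-- The sum of `F` over the neighbours of a vertex other than the centre. -/
lemma sum_adj_vtx {x : Fin 3} {p : ℕ} (hp : p + 1 ≤ n x) {M : Type*} [AddCommMonoid M]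
    (F : Vertex n → M) :
    (∑ v, if (threeStar n).Adj (vtx n x (p + 1)) v then F v else 0) =
      F (vtx n x p) + if p + 2 ≤ n x then F (vtx n x (p + 2)) else 0 := by
  simp only [adj_vtx_succ_iff hp]
  by_cases h : p + 2 ≤ n x
  · have hne : vtx n x p ≠ vtx n x (p + 2) := by
      intro hc
      have := congrArg pos hc
      rw [pos_vtx h, pos_vtx (by omega)] at this
      omega
    simp only [h, true_and, if_true]
    rw [← Finset.sum_filter, Finset.filter_or, Finset.filter_eq', Finset.filter_eq']
    simp [hne]
  · simp [h]

open Classical in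
lemma sum_odd_adj {M : Type*} [AddCommMonoid M] (i : EvenVertex n) (F : Vertex n → M) :
    (∑ j : OddVertex n, if (threeStar n).Adj i.1 j.1 then F j.1 else 0) =
      ∑ v, if (threeStar n).Adj i.1 v then F v else 0 := by
  rw [← Finset.sum_subtype (Finset.univ.filter fun v : Vertex n => Odd ((threeStar n).dist v none))
    (by simp) (fun v => if (threeStar n).Adj i.1 v then F v else 0), Finset.sum_filter]
  refine Finset.sum_congr rfl fun v _ => ?_
  by_cases h : (threeStar n).Adj i.1 v
  · rw [if_pos]
    have := even_pos i
    rw [dist_centre]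
    rw [adj_iff] at h
    grind
  · simp [h]

open Classical in
lemma sum_even_adj {M : Type*} [AddCommMonoid M] (j : OddVertex n) (F : Vertex n → M) :
    (∑ i : EvenVertex n, if (threeStar n).Adj j.1 i.1 then F i.1 else 0) =
      ∑ v, if (threeStar n).Adj j.1 v then F v else 0 := by
  rw [← Finset.sum_subtype (Finset.univ.filter fun v : Vertex n => Even ((threeStar n).dist v none))
    (by simp) (fun v => if (threeStar n).Adj j.1 v then F v else 0), Finset.sum_filter]
  refine Finset.sum_congr rfl fun v _ => ?_
  by_cases h : (threeStar n).Adj j.1 v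
  · rw [if_pos]
    have := odd_pos j
    rw [dist_centre]
    rw [adj_iff] at h
    grind
  · simp [h]

/-- The pairs of vertices joined by a path of length two that does not backtrack, up to one
missing loop at each vertex: distinct vertices with a common neighbour, and the vertices of
valency two with themselves. (The centre, of valency three, is treated separately.) -/
def TwoStep (u v : Vertex n) : Prop :=
  (pos v = pos u + 2 ∧ (pos u = 0 ∨ ray u = ray v)) ∨
  (pos u = pos v + 2 ∧ (pos v = 0 ∨ ray v = ray u)) ∨
  (pos u = 1 ∧ pos v = 1 ∧ ray u ≠ ray v) ∨
  (pos u = pos v ∧ ray u = ray v ∧ 0 < pos u ∧ pos u < n (ray u))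

lemma twoStep_comm {u v : Vertex n} : TwoStep u v ↔ TwoStep v u := by
  unfold TwoStep; grind

open Classical in
/-- The entries of `M ^ 2 - 1`, for `M` the adjacency matrix. -/
noncomputable def twoStepCount (u v : Vertex n) : ℤ :=
  if u = none ∧ v = none then 2 else if TwoStep u v then 1 else 0

lemma vtx_eq_vtx {x y : Fin 3} {p q : ℕ} (hp : p ≤ n x) (hq : q ≤ n y) :
    vtx n x p = vtx n y q ↔ p = q ∧ (p = 0 ∨ x = y) := by
  rw [vertex_ext_iff, pos_vtx hp, pos_vtx hq]
  refine and_congr_right fun h => ?_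
  rcases Nat.eq_zero_or_pos p with h0 | h0
  · simp [h0]
  · rw [ray_vtx h0 hp, ray_vtx (by omega) hq]

lemma vtx_eq_none {x : Fin 3} {p : ℕ} (hp : p ≤ n x) : vtx n x p = none ↔ p = 0 := by
  rw [← pos_eq_zero, pos_vtx hp]

lemma vtx_adj_vtx {x y : Fin 3} {p q : ℕ} (hp : p ≤ n x) (hq : q ≤ n y) :
    (threeStar n).Adj (vtx n x p) (vtx n y q) ↔
      (q = p + 1 ∧ (p = 0 ∨ x = y)) ∨ (p = q + 1 ∧ (q = 0 ∨ x = y)) := by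
  rw [adj_iff, pos_vtx hp, pos_vtx hq]
  rcases Nat.eq_zero_or_pos p with h0 | h0 <;> rcases Nat.eq_zero_or_pos q with h1 | h1
  · simp [h0]
  · simp [h0]
  · simp [h1]
  · rw [ray_vtx h0 hp, ray_vtx h1 hq, @eq_comm _ y]

lemma twoStep_vtx {x y : Fin 3} {p q : ℕ} (hp : p ≤ n x) (hq : q ≤ n y) :
    TwoStep (vtx n x p) (vtx n y q) ↔
      (q = p + 2 ∧ (p = 0 ∨ x = y)) ∨ (p = q + 2 ∧ (q = 0 ∨ x = y)) ∨
      (p = 1 ∧ q = 1 ∧ x ≠ y) ∨ (p = q ∧ x = y ∧ 0 < p ∧ p < n x) := by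
  rw [TwoStep, pos_vtx hp, pos_vtx hq]
  rcases Nat.eq_zero_or_pos p with h0 | h0 <;> rcases Nat.eq_zero_or_pos q with h1 | h1
  · simp [h0]
  · simp [h0]
  · simp [h1]; omega
  · rw [ray_vtx h0 hp, ray_vtx h1 hq]; grind

open Classical in
lemma twoStepCount_eq (hn : ∀ i, 0 < n i) (u v : Vertex n) :
    (∑ w, adjI ℤ u w * adjI ℤ w v) - (if u = v then 1 else 0) = twoStepCount u v := by
  obtain ⟨x, p, hp, rfl⟩ := exists_vtx u
  obtain ⟨y, q, hq, rfl⟩ := exists_vtx v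
  simp only [adjI_mul]
  rcases p with _ | p
  · rw [vtx_zero, sum_adj_none hn]
    simp only [adjI, vtx_adj_vtx (hn _) hq]
    rw [← vtx_zero (n := n) x]
    unfold twoStepCount
    simp only [twoStep_vtx hp hq, vtx_eq_vtx hp hq, vtx_eq_none hp, vtx_eq_none hq]
    rcases Nat.eq_zero_or_pos q with h0 | h0
    · subst h0; simp
    · by_cases h2 : q = 2
      · subst h2; simp
      · simp [h2, h0.ne', h0.ne]
  · rw [sum_adj_vtx hp]
    have e0 : p ≤ n x := by omega
    simp only [twoStepCount, twoStep_vtx hp hq, vtx_eq_vtx hp hq, vtx_eq_none hp, vtx_eq_none hq]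
    by_cases h2 : p + 2 ≤ n x
    · simp only [adjI, vtx_adj_vtx e0 hq, vtx_adj_vtx h2 hq]
      split_ifs <;> first | rfl | (exfalso; grind)
    · simp only [adjI, vtx_adj_vtx e0 hq]
      split_ifs <;> first | rfl | (exfalso; grind)

open Classical in
lemma evenBlock_apply (hn : ∀ i, 0 < n i) (i k : EvenVertex n) :
    (biadjacency n * (biadjacency n).transpose - 1 : Matrix _ _ ℤ) i k = twoStepCount i.1 k.1 := by
  rw [← twoStepCount_eq hn, Matrix.sub_apply, Matrix.mul_apply, Matrix.one_apply]
  simp only [Subtype.ext_iff, Matrix.transpose_apply, biadjacency_apply]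
  congr 1
  simp only [adjI_comm ℤ k.1, adjI_mul]
  exact sum_odd_adj i (fun w => adjI ℤ w k.1)

open Classical in
lemma oddBlock_apply (hn : ∀ i, 0 < n i) (j l : OddVertex n) :
    ((biadjacency n).transpose * biadjacency n - 1 : Matrix _ _ ℤ) j l = twoStepCount j.1 l.1 := by
  rw [← twoStepCount_eq hn, Matrix.sub_apply, Matrix.mul_apply, Matrix.one_apply]
  simp only [Subtype.ext_iff, Matrix.transpose_apply, biadjacency_apply]
  congr 1
  simp only [adjI_comm ℤ _ j.1, adjI_mul]
  exact sum_even_adj j (fun w => adjI ℤ w l.1)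

end Coordinates

/-! ### The Perron-Frobenius eigenvector of the 3-star -/

section PerronFrobenius

variable {n : Fin 3 → ℕ}

/-- The values of a function on the vertices along the ray `x`, extended by zero beyond the end of
the ray, so that an eigenvector satisfies the same three-term recursion at every vertex of the ray
other than the centre. -/
noncomputable def rayVal (η : Vertex n → ℝ) (x : Fin 3) (p : ℕ) : ℝ :=
  if p ≤ n x then η (vtx n x p) else 0

lemma rayVal_of_le (η : Vertex n → ℝ) {x : Fin 3} {p : ℕ} (h : p ≤ n x) :
    rayVal η x p = η (vtx n x p) := if_pos h

lemma rayVal_of_lt (η : Vertex n → ℝ) {x : Fin 3} {p : ℕ} (h : n x < p) : rayVal η x p = 0 :=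
  if_neg (by omega)

lemma rayVal_zero (η : Vertex n → ℝ) (x : Fin 3) : rayVal η x 0 = η none :=
  rayVal_of_le η (Nat.zero_le _)

/-- `η` is an eigenvector of the adjacency matrix, stated through sums over neighbours. -/
def IsEigen (lam : ℝ) (η : Vertex n → ℝ) : Prop :=
  ∀ u, ∑ v, adjI ℝ u v * η v = lam * η u

lemma isEigen_of_mulVec {lam : ℝ} {η : Vertex n → ℝ}
    (h : (adjacency n ℝ).mulVec η = lam • η) : IsEigen lam η := by
  intro u
  have := congrFun h u
  simpa [Matrix.mulVec, dotProduct, adjacency_apply] using this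

lemma IsEigen.recursion {lam : ℝ} {η : Vertex n → ℝ} (h : IsEigen lam η) {x : Fin 3} {p : ℕ}
    (hp : p + 1 ≤ n x) : lam * rayVal η x (p + 1) = rayVal η x p + rayVal η x (p + 2) := by
  have := h (vtx n x (p + 1))
  simp only [adjI_mul] at this
  rw [sum_adj_vtx hp] at this
  rw [rayVal_of_le η hp, ← this, rayVal_of_le η (by omega : p ≤ n x)]
  rfl

lemma IsEigen.at_centre (hn : ∀ i, 0 < n i) {lam : ℝ} {η : Vertex n → ℝ} (h : IsEigen lam η) :
    lam * η none = ∑ z, rayVal η z 1 := by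
  have := h none
  simp only [adjI_mul] at this
  rw [sum_adj_none hn] at this
  rw [← this]
  exact Finset.sum_congr rfl fun z _ => (rayVal_of_le η (hn z)).symm

lemma IsEigen.casoratian {lam : ℝ} {η ξ : Vertex n → ℝ} (h : IsEigen lam η) (h' : IsEigen lam ξ)
    {x : Fin 3} {p : ℕ} (hp : p ≤ n x) :
    rayVal η x p * rayVal ξ x (p + 1) = rayVal η x (p + 1) * rayVal ξ x p := by
  obtain ⟨k, hk⟩ := Nat.exists_eq_add_of_le hp
  induction k generalizing p with
  | zero => rw [rayVal_of_lt η (by omega : n x < p + 1), rayVal_of_lt ξ (by omega)]; ring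
  | succ k ih =>
    have := ih (p := p + 1) (by omega) (by omega)
    have e1 := h.recursion (by omega : p + 1 ≤ n x)
    have e2 := h'.recursion (by omega : p + 1 ≤ n x)
    rw [show rayVal η x p = lam * rayVal η x (p + 1) - rayVal η x (p + 2) by linarith,
      show rayVal ξ x p = lam * rayVal ξ x (p + 1) - rayVal ξ x (p + 2) by linarith]
    linarith

/-- The eigenspace of a positive eigenvector is one-dimensional: along each ray the recursion leaves
one free parameter, and the three of them are tied together at the centre. -/
lemma IsEigen.eq_smul {lam : ℝ} {η ξ : Vertex n → ℝ} (h : IsEigen lam η) (h' : IsEigen lam ξ)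
    (hpos : ∀ v, 0 < ξ v) (hd : ξ none = 1) (v : Vertex n) : η v = η none * ξ v := by
  obtain ⟨x, p, hp, rfl⟩ := exists_vtx v
  rw [← rayVal_of_le η hp, ← rayVal_of_le ξ hp]
  induction p with
  | zero => rw [rayVal_zero, rayVal_zero, hd, mul_one]
  | succ p ih =>
    have e0 : p ≤ n x := by omega
    have e1 : 0 < rayVal ξ x p := by rw [rayVal_of_le ξ e0]; exact hpos _
    have e2 := h.casoratian h' e0
    rw [ih e0] at e2
    apply mul_right_cancel₀ e1.ne'
    linarith

/-- A Casoratian is constant along a ray. -/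
lemma IsEigen.sq_sub {lam : ℝ} {ξ : Vertex n → ℝ} (h : IsEigen lam ξ) {x : Fin 3} {p : ℕ}
    (hp : p + 1 ≤ n x) :
    rayVal ξ x (p + 1) ^ 2 - rayVal ξ x p * rayVal ξ x (p + 2) = rayVal ξ x (n x) ^ 2 := by
  obtain ⟨k, hk⟩ := Nat.exists_eq_add_of_le hp
  induction k generalizing p with
  | zero => rw [rayVal_of_lt ξ (by omega : n x < p + 2), hk]; ring_nf
  | succ k ih =>
    rw [← ih (p := p + 1) (by omega) (by omega)]
    have e1 := h.recursion (by omega : p + 1 ≤ n x)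
    have e2 := h.recursion (by omega : p + 1 + 1 ≤ n x)
    rw [show rayVal ξ x (p + 1 + 2) = lam * rayVal ξ x (p + 2) - rayVal ξ x (p + 1) by linarith,
      show rayVal ξ x p = lam * rayVal ξ x (p + 1) - rayVal ξ x (p + 2) by linarith]
    ring

lemma IsEigen.mul_sub {lam : ℝ} {ξ : Vertex n → ℝ} (h : IsEigen lam ξ) {x : Fin 3} {p : ℕ}
    (hp : p + 2 ≤ n x) :
    rayVal ξ x (p + 1) * rayVal ξ x (p + 2) - rayVal ξ x p * rayVal ξ x (p + 3) =
      lam * rayVal ξ x (n x) ^ 2 := by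
  rw [← h.sq_sub (by omega : p + 1 ≤ n x)]
  have e1 := h.recursion (by omega : p + 1 ≤ n x)
  have e2 := h.recursion (by omega : p + 1 + 1 ≤ n x)
  rw [show rayVal ξ x (p + 3) = lam * rayVal ξ x (p + 2) - rayVal ξ x (p + 1) by linarith,
      show rayVal ξ x p = lam * rayVal ξ x (p + 1) - rayVal ξ x (p + 2) by linarith]
  ring

lemma IsEigen.lam_pos (hn : ∀ i, 0 < n i) {lam : ℝ} {ξ : Vertex n → ℝ} (h : IsEigen lam ξ)
    (hpos : ∀ v, 0 < ξ v) : 0 < lam := by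
  have e := h.at_centre hn
  have : 0 < ∑ z, rayVal ξ z 1 :=
    Finset.sum_pos (fun z _ => by rw [rayVal_of_le ξ (hn z)]; exact hpos _) Finset.univ_nonempty
  exact pos_of_mul_pos_left (e ▸ this) (hpos _).le

variable (n) in
/-- The biadjacency matrix with real entries. -/
noncomputable def biadj : Matrix (EvenVertex n) (OddVertex n) ℝ := fun i j => adjI ℝ i.1 j.1

lemma biadj_eq (i : EvenVertex n) (j : OddVertex n) : biadj n i j = (biadjacency n i j : ℝ) := by
  rw [biadjacency_apply]; simp [biadj, adjI]

lemma sum_biadj_mul (i : EvenVertex n) (F : Vertex n → ℝ) :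
    ∑ j, biadj n i j * F j.1 = ∑ v, adjI ℝ i.1 v * F v := by
  simp only [biadj, adjI_mul]
  exact sum_odd_adj i F

lemma sum_biadj_mul' (j : OddVertex n) (F : Vertex n → ℝ) :
    ∑ i, biadj n i j * F i.1 = ∑ v, adjI ℝ j.1 v * F v := by
  simp only [biadj, adjI_comm ℝ _ j.1, adjI_mul]
  exact sum_even_adj j F

lemma vertex_cases (v : Vertex n) :
    (∃ i : EvenVertex n, i.1 = v) ∨ (∃ j : OddVertex n, j.1 = v) := by
  rcases Nat.even_or_odd ((threeStar n).dist v none) with h | h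
  · exact Or.inl ⟨⟨v, h⟩, rfl⟩
  · exact Or.inr ⟨⟨v, h⟩, rfl⟩

/-- A positive eigenvector of `Gᵗ G` is proportional to the restriction of the Perron-Frobenius
eigenvector to the odd vertices. -/
lemma odd_eigenvector (hn : ∀ i, 0 < n i) {lam : ℝ} {ξ : Vertex n → ℝ} (h : IsEigen lam ξ)
    (hpos : ∀ v, 0 < ξ v) (hd : ξ none = 1) {μ : ℝ} {δ : OddVertex n → ℝ} (hδ : ∀ l, 0 < δ l)
    (hμ : (biadj n).transpose.mulVec ((biadj n).mulVec δ) = μ • δ) :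
    μ = lam ^ 2 ∧ ∃ t, 0 < t ∧ (∀ l, δ l = t * ξ l.1) ∧
      ∀ i, (biadj n).mulVec δ i = t * lam * ξ i.1 := by
  have hlam := h.lam_pos hn hpos
  have e1 : (biadj n).mulVec (fun j => ξ j.1) = lam • fun i => ξ i.1 := by
    ext i; simp only [Matrix.mulVec, dotProduct]; rw [sum_biadj_mul, h]; rfl
  have e2 : (biadj n).transpose.mulVec (fun i => ξ i.1) = lam • fun j => ξ j.1 := by
    ext j; simp only [Matrix.mulVec, dotProduct, Matrix.transpose_apply]
    rw [sum_biadj_mul', h]; rfl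
  have e3 : μ = lam ^ 2 := by
    have a1 : (fun j : OddVertex n => ξ j.1) ⬝ᵥ (biadj n).transpose.mulVec ((biadj n).mulVec δ) =
        lam ^ 2 * ((fun j : OddVertex n => ξ j.1) ⬝ᵥ δ) := by
      rw [Matrix.dotProduct_mulVec, Matrix.vecMul_transpose, e1, Matrix.dotProduct_mulVec,
        ← Matrix.mulVec_transpose, Matrix.mulVec_smul, e2, smul_dotProduct, smul_dotProduct]
      simp; ring
    rw [hμ, dotProduct_smul, smul_eq_mul] at a1
    have : 0 < (fun j : OddVertex n => ξ j.1) ⬝ᵥ δ :=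
      Finset.sum_pos (fun j _ => mul_pos (hpos _) (hδ _))
        ⟨oddVtx 0 1 (hn 0) odd_one, Finset.mem_univ _⟩
    exact mul_right_cancel₀ this.ne' a1
  refine ⟨e3, ?_⟩
  let η : Vertex n → ℝ := fun v => if hv : Even ((threeStar n).dist v none) then
    (biadj n).mulVec δ ⟨v, hv⟩ / lam else δ ⟨v, Nat.not_even_iff_odd.1 hv⟩
  have h1 : ∀ i : EvenVertex n, η i.1 = (biadj n).mulVec δ i / lam := fun i => by
    simp only [η]; rw [dif_pos i.2]
  have h2 : ∀ j : OddVertex n, η j.1 = δ j := fun j => by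
    simp only [η]; rw [dif_neg (Nat.not_even_iff_odd.2 j.2)]
  have h3 : IsEigen lam η := by
    intro u
    rcases vertex_cases u with ⟨i, rfl⟩ | ⟨j, rfl⟩
    · rw [← sum_biadj_mul i η, h1]
      simp only [h2]
      rw [mul_div_cancel₀ _ hlam.ne']; rfl
    · rw [← sum_biadj_mul' j η, h2]
      simp only [h1]
      have := congrFun hμ j
      simp only [Pi.smul_apply, smul_eq_mul, e3] at this
      apply mul_left_cancel₀ hlam.ne'
      rw [← mul_assoc, ← sq, ← this, Finset.mul_sum]
      simp only [Matrix.mulVec, dotProduct, Matrix.transpose_apply]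
      refine Finset.sum_congr rfl fun i _ => ?_
      field_simp
  have h4 := h3.eq_smul h hpos hd
  have h5 : 0 < η none := by
    have := h4 (oddVtx (n := n) 0 1 (hn 0) odd_one).1
    rw [h2] at this
    have h6 := hδ (oddVtx (n := n) 0 1 (hn 0) odd_one)
    rw [this] at h6
    exact pos_of_mul_pos_left h6 (hpos _).le
  refine ⟨η none, h5, fun l => by rw [← h2, h4], fun i => ?_⟩
  have := h4 i.1
  rw [h1] at this
  rw [div_eq_iff hlam.ne'] at this
  rw [this]; ring

/-- The bipartite graph with incidence matrix `Gᵗ G - 1` is connected: the first vertices of the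
three rays form a hexagon, to which all the others are joined by steps along the rays. -/
lemma eq_of_twoStepCount (hn : ∀ i, 0 < n i) (r s : OddVertex n → ℝ)
    (h : ∀ j l : OddVertex n, twoStepCount j.1 l.1 ≠ 0 → r j = s l) :
    ∃ μ, ∀ j, r j = μ ∧ s j = μ := by
  have h' : ∀ j l : OddVertex n, TwoStep j.1 l.1 → r j = s l := by
    intro j l hjl
    apply h
    rw [twoStepCount, if_neg, if_pos hjl]
    · simp
    · intro h0
      have := odd_pos j
      rw [h0.1] at this
      simp at this
  have h1 : ∀ x y (_ : x ≠ y), r (oddVtx x 1 (hn x) odd_one) = s (oddVtx y 1 (hn y) odd_one) := by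
    intro x y hxy
    apply h'
    simp only [oddVtx]
    rw [twoStep_vtx (hn x) (hn y)]
    exact Or.inr (Or.inr (Or.inl ⟨rfl, rfl, hxy⟩))
  have h2 : ∀ x, r (oddVtx x 1 (hn x) odd_one) = r (oddVtx 0 1 (hn 0) odd_one) ∧
      s (oddVtx x 1 (hn x) odd_one) = r (oddVtx 0 1 (hn 0) odd_one) := by
    have a01 := h1 0 1 (by decide)
    have a02 := h1 0 2 (by decide)
    have a10 := h1 1 0 (by decide)
    have a12 := h1 1 2 (by decide)
    have a20 := h1 2 0 (by decide)
    have a21 := h1 2 1 (by decide)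
    intro x
    fin_cases x <;> constructor <;> simp only [Fin.zero_eta, Fin.mk_one, Fin.reduceFinMk] <;>
      linarith
  refine ⟨r (oddVtx 0 1 (hn 0) odd_one), ?_⟩
  have h3 : ∀ x k (hk : 2 * k + 1 ≤ n x),
      r (oddVtx x (2 * k + 1) hk ⟨k, rfl⟩) = r (oddVtx 0 1 (hn 0) odd_one) ∧
      s (oddVtx x (2 * k + 1) hk ⟨k, rfl⟩) = r (oddVtx 0 1 (hn 0) odd_one) := by
    intro x k
    induction k with
    | zero => exact fun _ => h2 x
    | succ k ih =>
      intro hk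
      have hk' : 2 * k + 1 ≤ n x := by omega
      obtain ⟨i1, i2⟩ := ih hk'
      have b1 : r (oddVtx x (2 * k + 1) hk' ⟨k, rfl⟩) =
          s (oddVtx x (2 * (k + 1) + 1) hk ⟨k + 1, rfl⟩) := by
        apply h'
        simp only [oddVtx]
        rw [twoStep_vtx hk' hk]
        exact Or.inl ⟨by ring, Or.inr rfl⟩
      have b2 : r (oddVtx x (2 * (k + 1) + 1) hk ⟨k + 1, rfl⟩) =
          s (oddVtx x (2 * k + 1) hk' ⟨k, rfl⟩) := by
        apply h'
        simp only [oddVtx]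
        rw [twoStep_vtx hk hk']
        exact Or.inr (Or.inl ⟨by ring, Or.inr rfl⟩)
      exact ⟨b2.trans i2, b1.symm.trans i1⟩
  intro j
  obtain ⟨k, hk⟩ := odd_pos j
  have hle : 2 * k + 1 ≤ n (ray j.1) := hk ▸ pos_le j.1
  have : j = oddVtx (ray j.1) (2 * k + 1) hle ⟨k, rfl⟩ := by
    apply Subtype.ext
    simp only [oddVtx]
    rw [← hk, vtx_ray_pos]
  rw [this]
  exact h3 _ k hle

end PerronFrobenius

/-! ### Projections and traces in multi-matrix algebras -/

section Traces

open Matrix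

/-- A projection is the sum of the rank-one projections onto an orthonormal basis of its range. -/
lemma exists_orthonormal_of_isStarProjection {m : Type*} [Fintype m] [DecidableEq m]
    {P : Matrix m m ℂ} (hP : IsStarProjection P) {r : ℕ} (hr : P.rank = r) :
    ∃ v : Fin r → m → ℂ, (∀ s t, star (v s) ⬝ᵥ v t = if s = t then 1 else 0) ∧
      P = ∑ t, vecMulVec (v t) (star (v t)) := by
  have hH : P.IsHermitian := hP.isSelfAdjoint
  have hcard : Fintype.card {i // hH.eigenvalues i ≠ 0} = r := by
    rw [← hH.rank_eq_card_non_zero_eigs, hr]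
  let u : m → m → ℂ := fun i => (hH.eigenvectorBasis i : EuclideanSpace ℂ m)
  have horth : ∀ i j, star (u i) ⬝ᵥ u j = if i = j then 1 else 0 := by
    intro i j
    have := orthonormal_iff_ite.1 hH.eigenvectorBasis.orthonormal i j
    rw [EuclideanSpace.inner_eq_star_dotProduct] at this
    rw [← this, dotProduct_comm]
  have hmul : ∀ i, P *ᵥ u i = (hH.eigenvalues i : ℂ) • u i := fun i => hH.mulVec_eigenvectorBasis i
  have hev : ∀ i, hH.eigenvalues i ≠ 0 → hH.eigenvalues i = 1 := by
    intro i hi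
    have h1 : P *ᵥ (P *ᵥ u i) = P *ᵥ u i := by
      rw [mulVec_mulVec, hP.isIdempotentElem.eq]
    rw [hmul, mulVec_smul, hmul] at h1
    have h2 := congrArg (fun w => star (u i) ⬝ᵥ w) h1
    simp only [dotProduct_smul, horth, if_true, smul_eq_mul, mul_one] at h2
    have h3 : hH.eigenvalues i * hH.eigenvalues i = hH.eigenvalues i := by exact_mod_cast h2
    exact mul_right_cancel₀ hi (by rw [h3, one_mul])
  have hsum : P = ∑ i, (hH.eigenvalues i : ℂ) • vecMulVec (u i) (star (u i)) := by
    have hspec := hH.spectral_theorem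
    ext a b
    conv_lhs => rw [hspec]
    simp only [Unitary.conjStarAlgAut_apply, Matrix.mul_apply, Matrix.sum_apply, Matrix.smul_apply,
      vecMulVec_apply, diagonal_apply, Function.comp, star_apply, hH.eigenvectorUnitary_apply,
      smul_eq_mul]
    refine Finset.sum_congr rfl fun i _ => ?_
    simp [u]
    ring
  obtain ⟨e⟩ : Nonempty (Fin r ≃ {i // hH.eigenvalues i ≠ 0}) :=
    ⟨(Fintype.equivFinOfCardEq hcard).symm⟩
  refine ⟨fun t => u (e t), fun s t => ?_, ?_⟩
  · rw [horth]
    simp [← Subtype.ext_iff]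
  · rw [e.sum_comp (fun i => vecMulVec (u i.1) (star (u i.1)))]
    conv_lhs => rw [hsum]
    rw [← Finset.sum_subtype (Finset.univ.filter fun i => hH.eigenvalues i ≠ 0) (by simp)
      (fun i => vecMulVec (u i) (star (u i))), Finset.sum_filter]
    refine Finset.sum_congr rfl fun i _ => ?_
    split_ifs with h
    · rw [hev i h]; simp
    · simp only [ne_eq, not_not] at h
      simp [h]

lemma trace_eq_rank_of_isStarProjection {m : Type*} [Fintype m] [DecidableEq m]
    {P : Matrix m m ℂ} (hP : IsStarProjection P) : P.trace = P.rank := by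
  obtain ⟨v, hv, h⟩ := exists_orthonormal_of_isStarProjection hP rfl
  conv_lhs => rw [h]
  simp [trace_sum, trace_vecMulVec, dotProduct_comm _ (star _), hv]

variable {ι κ : Type} [DecidableEq ι]

/-- A minimal projection of the `i`-th summand of a multi-matrix algebra: the first diagonal
matrix unit. -/
noncomputable def minProj {a : ι → ℕ} (ha : ∀ i, 0 < a i) (i : ι) : MultiMatrix a :=
  Pi.single i (Matrix.single ⟨0, ha i⟩ ⟨0, ha i⟩ 1)

lemma pi_single_mul_single {a : ι → ℕ} (i : ι) (x y : Matrix (Fin (a i)) (Fin (a i)) ℂ) :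
    (Pi.single i x * Pi.single i y : MultiMatrix a) = Pi.single i (x * y) := by
  ext k : 1
  rcases eq_or_ne k i with rfl | h
  · simp
  · simp [h]

lemma star_pi_single {a : ι → ℕ} (i : ι) (x : Matrix (Fin (a i)) (Fin (a i)) ℂ) :
    star (Pi.single i x : MultiMatrix a) = Pi.single i (star x) := by
  ext k : 1
  rcases eq_or_ne k i with rfl | h
  · simp
  · simp [h]

lemma pi_single_mul {a : ι → ℕ} (i : ι) (x : Matrix (Fin (a i)) (Fin (a i)) ℂ)
    (y : MultiMatrix a) : Pi.single i x * y = Pi.single i (x * y i) := by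
  ext k : 1
  rcases eq_or_ne k i with rfl | h
  · simp
  · simp [h]

lemma mul_pi_single {a : ι → ℕ} (i : ι) (x : Matrix (Fin (a i)) (Fin (a i)) ℂ)
    (y : MultiMatrix a) : y * Pi.single i x = Pi.single i (y i * x) := by
  ext k : 1
  rcases eq_or_ne k i with rfl | h
  · simp
  · simp [h]

/-- A tracial functional on a multi-matrix algebra is the combination of the matrix traces with its
values at minimal projections as coefficients. -/
lemma tracial_eq_sum [Fintype ι] {a : ι → ℕ} (ha : ∀ i, 0 < a i) (τ : MultiMatrix a →ₗ[ℂ] ℂ)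
    (hτ : ∀ x y, τ (x * y) = τ (y * x)) (x : MultiMatrix a) :
    τ x = ∑ i, τ (minProj ha i) * (x i).trace := by
  have h1 : ∀ i (s t : Fin (a i)), τ (Pi.single i (Matrix.single s t 1)) =
      if s = t then τ (minProj ha i) else 0 := by
    intro i s t
    have e1 : (Pi.single i (Matrix.single s t 1) : MultiMatrix a) =
        Pi.single i (Matrix.single s ⟨0, ha i⟩ 1) * Pi.single i (Matrix.single ⟨0, ha i⟩ t 1) := by
      rw [pi_single_mul_single, single_mul_single_same, mul_one]
    rw [e1, hτ, pi_single_mul_single]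
    rcases eq_or_ne s t with rfl | h
    · rw [single_mul_single_same, if_pos rfl, mul_one, minProj]
    · rw [single_mul_single_of_ne _ _ _ _ h.symm, if_neg h, Pi.single_zero, map_zero]
  have h2 : x = ∑ i, ∑ s, ∑ t, x i s t • (Pi.single i (Matrix.single s t 1) : MultiMatrix a) := by
    conv_lhs => rw [← Finset.univ_sum_single x]
    refine Finset.sum_congr rfl fun i _ => ?_
    conv_lhs => rw [matrix_eq_sum_single (x i)]
    ext k : 1
    rcases eq_or_ne k i with rfl | h
    · simp [Finset.sum_apply, smul_single]
    · simp [Finset.sum_apply, h]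
  conv_lhs => rw [h2]
  simp only [map_sum, map_smul, h1, smul_eq_mul, mul_ite, mul_zero, Finset.sum_ite_eq,
    Finset.mem_univ, if_true, trace, diag_apply, Finset.mul_sum]
  exact Finset.sum_congr rfl fun i _ => Finset.sum_congr rfl fun s _ => mul_comm _ _

lemma minProj_isStarProjection {a : ι → ℕ} (ha : ∀ i, 0 < a i) (i : ι) :
    IsStarProjection (minProj ha i) where
  isIdempotentElem := by
    rw [IsIdempotentElem, minProj, pi_single_mul_single]; simp
  isSelfAdjoint := by
    rw [IsSelfAdjoint, minProj, star_pi_single, star_eq_conjTranspose]; simp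

lemma single_isStarProjection {m : ℕ} (s : Fin m) :
    IsStarProjection (Matrix.single s s (1 : ℂ)) where
  isIdempotentElem := by simp [IsIdempotentElem]
  isSelfAdjoint := by simp [IsSelfAdjoint, star_eq_conjTranspose]

lemma single_rank {m : ℕ} (s : Fin m) : (Matrix.single s s (1 : ℂ)).rank = 1 := by
  have := trace_eq_rank_of_isStarProjection (single_isStarProjection s)
  rw [trace_single_eq_same] at this
  exact_mod_cast this.symm

lemma isStarProjection_apply {b : κ → ℕ} {x : MultiMatrix b} (hx : IsStarProjection x) (j : κ) :
    IsStarProjection (x j) where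
  isIdempotentElem := congrFun hx.isIdempotentElem j
  isSelfAdjoint := congrFun hx.isSelfAdjoint j

lemma rank_map_minProj {a : ι → ℕ} {b : κ → ℕ} (ha : ∀ i, 0 < a i)
    {φ : MultiMatrix a →⋆ₐ[ℂ] MultiMatrix b} {Λ : Matrix ι κ ℤ} (h : HasInclusionMatrix φ Λ)
    (i : ι) (j : κ) : ((φ (minProj ha i) j).rank : ℤ) = Λ i j :=
  h i _ (single_isStarProjection _) (single_rank _) j

lemma map_minProj_isStarProjection {a : ι → ℕ} {b : κ → ℕ} (ha : ∀ i, 0 < a i)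
    (φ : MultiMatrix a →⋆ₐ[ℂ] MultiMatrix b) (i : ι) (j : κ) :
    IsStarProjection (φ (minProj ha i) j) :=
  isStarProjection_apply ((minProj_isStarProjection ha i).map φ) j

lemma trace_map_minProj {a : ι → ℕ} {b : κ → ℕ} (ha : ∀ i, 0 < a i)
    {φ : MultiMatrix a →⋆ₐ[ℂ] MultiMatrix b} {Λ : Matrix ι κ ℤ} (h : HasInclusionMatrix φ Λ)
    (i : ι) (j : κ) : (φ (minProj ha i) j).trace = (Λ i j : ℂ) := by
  rw [trace_eq_rank_of_isStarProjection (map_minProj_isStarProjection ha φ i j),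
    ← rank_map_minProj ha h i j]
  simp

/-- A trace pulls back along an inclusion, its coefficient vector being multiplied by the inclusion
matrix. -/
lemma coeff_pullback [Fintype κ] {a : ι → ℕ} {b : κ → ℕ} (ha : ∀ i, 0 < a i)
    {φ : MultiMatrix a →⋆ₐ[ℂ] MultiMatrix b} {Λ : Matrix ι κ ℤ} (h : HasInclusionMatrix φ Λ)
    (τ : MultiMatrix b →ₗ[ℂ] ℂ) (w : κ → ℝ) (hw : ∀ y, τ y = ∑ j, (w j : ℂ) * (y j).trace) (i : ι) :
    τ (φ (minProj ha i)) = ((∑ j, (Λ i j : ℝ) * w j : ℝ) : ℂ) := by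
  rw [hw]; push_cast
  exact Finset.sum_congr rfl fun j _ => by rw [trace_map_minProj ha h]; ring

/-- The pull-back of a faithful trace along an injective *-homomorphism is a combination of matrix
traces with positive coefficients. -/
lemma exists_coeff [Fintype ι] {D : Type} [Ring D] [StarRing D] [Algebra ℂ D] {tr : D →ₗ[ℂ] ℂ}
    (htr : IsFaithfulTracialState tr) {a : ι → ℕ} (ha : ∀ i, 0 < a i)
    (φ : MultiMatrix a →⋆ₐ[ℂ] D) (hφ : Function.Injective φ) :
    ∃ w : ι → ℝ, (∀ i, 0 < w i) ∧ (∀ i, tr (φ (minProj ha i)) = w i) ∧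
      ∀ x, tr (φ x) = ∑ i, (w i : ℂ) * (x i).trace := by
  have h1 : ∀ i, ∃ r : ℝ, 0 < r ∧ tr (φ (minProj ha i)) = r := by
    intro i
    have hp := minProj_isStarProjection ha i
    have hne : φ (minProj ha i) ≠ 0 := by
      rw [Ne, map_eq_zero_iff φ hφ]
      intro h0
      have := congrFun h0 i
      simp only [minProj, Pi.single_eq_same, Pi.zero_apply] at this
      have := congrFun (congrFun this ⟨0, ha i⟩) ⟨0, ha i⟩
      simp at this
    obtain ⟨r, hr, h⟩ := htr.pos _ hne
    refine ⟨r, hr, ?_⟩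
    rw [← h, ← map_star, ← map_mul, hp.isSelfAdjoint.star_eq, hp.isIdempotentElem.eq]
  choose w hw h using h1
  refine ⟨w, hw, h, fun x => ?_⟩
  have := tracial_eq_sum ha (tr ∘ₗ φ.toAlgHom.toLinearMap)
    (fun x y => by simpa using htr.map_mul_comm _ _) x
  simpa [h] using this

/-- Bessel's inequality for an orthogonal family in the Hilbert space of a faithful trace. -/
lemma bessel_of_faithful {D : Type} [Ring D] [StarRing D] [Algebra ℂ D] [StarModule ℂ D]
    {tr : D →ₗ[ℂ] ℂ} (htr : IsFaithfulTracialState tr) {P : Type*} [Fintype P] [DecidableEq P]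
    (X : P → D) (g u : P → ℝ) (hX : ∀ p q, tr (star (X p) * X q) = if p = q then (g p : ℂ) else 0)
    (hu : ∀ p, 0 ≤ u p) (hug : ∀ p, u p * g p ≤ 1) (y : D) (m : ℝ) (hy : tr (star y * y) = m) :
    ∑ p, u p * ‖tr (star (X p) * y)‖ ^ 2 ≤ m := by
  have hstar : ∀ x : D, tr (star x) = star (tr x) := by
    -- The trace is real on positive elements, and these span by polarization.
    have hreal : ∀ x : D, star (tr (star x * x)) = tr (star x * x) := by
      intro x
      by_cases hx : x = 0
      · simp [hx]
      · obtain ⟨r, _, h⟩ := htr.pos x hx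
        rw [h]; simp
    intro x
    have e1 := hreal (1 + x)
    have e2 := hreal (1 + Complex.I • x)
    have e3 := hreal x
    have e4 : star (tr (star (1 : D) * 1)) = tr (star (1 : D) * 1) := hreal 1
    simp only [star_add, star_one, add_mul, mul_add, one_mul, mul_one, map_add, star_smul,
      smul_mul_assoc, mul_smul_comm, map_smul, smul_eq_mul, RCLike.star_def, Complex.conj_I,
      map_mul, map_neg] at e1 e2 e3 e4
    rw [e3, e4] at e1 e2
    simp only [RCLike.star_def]
    have e5 : Complex.I * (starRingEnd ℂ) (tr (star x)) - Complex.I * (starRingEnd ℂ) (tr x) =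
        Complex.I * tr x - Complex.I * tr (star x) := by linear_combination e2
    have e6 : (starRingEnd ℂ) (tr (star x)) - (starRingEnd ℂ) (tr x) = tr x - tr (star x) := by
      apply mul_left_cancel₀ Complex.I_ne_zero
      linear_combination e5
    have e7 : (starRingEnd ℂ) (tr x) + (starRingEnd ℂ) (tr (star x)) = tr x + tr (star x) := by
      linear_combination e1
    linear_combination (e6 - e7) / 2
  have hnn : ∀ x : D, 0 ≤ (tr (star x * x)).re := by
    intro x
    by_cases hx : x = 0
    · simp [hx]
    · obtain ⟨r, hr, h⟩ := htr.pos x hx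
      rw [h]; exact hr.le
  set a : P → ℂ := fun p => tr (star (X p) * y) with ha
  set z : D := ∑ p, ((u p : ℂ) * a p) • X p with hz
  have h1 : tr (star z * y) = ((∑ p, u p * ‖a p‖ ^ 2 : ℝ) : ℂ) := by
    simp only [hz, star_sum, star_smul, Finset.sum_mul, map_sum, smul_mul_assoc, map_smul]
    push_cast
    refine Finset.sum_congr rfl fun p _ => ?_
    rw [← Complex.conj_mul', smul_eq_mul, star_mul']
    simp [a]; ring
  have h2 : tr (star y * z) = ((∑ p, u p * ‖a p‖ ^ 2 : ℝ) : ℂ) := by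
    rw [show star y * z = star (star z * y) by rw [star_mul, star_star], hstar, h1]
    simp
  have h3 : tr (star z * z) = ((∑ p, u p * (u p * g p) * ‖a p‖ ^ 2 : ℝ) : ℂ) := by
    simp only [hz, star_sum, star_smul, Finset.sum_mul, Finset.mul_sum, map_sum, smul_mul_assoc,
      mul_smul_comm, map_smul, hX]
    push_cast
    simp only [smul_eq_mul, mul_ite, mul_zero, Finset.mem_univ, if_true,
      Finset.sum_ite_eq']
    refine Finset.sum_congr rfl fun p _ => ?_
    rw [← Complex.conj_mul', star_mul']
    simp; ring
  have h4 := hnn (y - z)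
  rw [star_sub, sub_mul, mul_sub, mul_sub, map_sub, map_sub, map_sub, h1, h2, h3, hy] at h4
  simp only [Complex.sub_re, Complex.ofReal_re] at h4
  have h5 : ∑ p, u p * (u p * g p) * ‖a p‖ ^ 2 ≤ ∑ p, u p * ‖a p‖ ^ 2 := by
    refine Finset.sum_le_sum fun p _ => ?_
    have := mul_le_mul_of_nonneg_left (hug p) (hu p)
    nlinarith [sq_nonneg ‖a p‖]
  linarith

end Traces

/-! ### The trace of a commuting square -/

section Forward

open Matrix

/-- The vector functional `M ↦ ⟨M ζ, ζ'⟩` on the summand `l` of a multi-matrix algebra. -/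
noncomputable def vecFunctional {κ : Type} {d : κ → ℕ} (l : κ) (ζ' ζ : Fin (d l) → ℂ) :
    MultiMatrix d →ₗ[ℂ] ℂ where
  toFun M := star ζ' ⬝ᵥ (M l *ᵥ ζ)
  map_add' M N := by simp [add_mulVec]
  map_smul' c M := by simp [smul_mulVec]

/-- The image of a minimal projection of the `i`-th summand, cut down to the `j`-th summand of the
target, is a sum of `Λ i j` projections equivalent to the standard minimal projection; the partial
isometries implementing this. -/
lemma exists_partialIsometries {ι κ : Type} [DecidableEq ι] [DecidableEq κ] {a : ι → ℕ} {b : κ → ℕ}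
    (ha : ∀ i, 0 < a i) (hb : ∀ j, 0 < b j) {φ : MultiMatrix a →⋆ₐ[ℂ] MultiMatrix b}
    {Λ : Matrix ι κ ℤ} (h : HasInclusionMatrix φ Λ) (i : ι) (j : κ) {r : ℕ} (hr : Λ i j = r) :
    ∃ V : Fin r → MultiMatrix b,
      (∀ s t, star (V s) * V t = if s = t then minProj hb j else 0) ∧
      ∑ t, V t * star (V t) = Pi.single j (φ (minProj ha i) j) ∧
      (∀ t, φ (minProj ha i) * V t = V t) ∧
      ∀ t, V t * minProj hb j = V t := by
  have hP := map_minProj_isStarProjection ha φ i j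
  have hrk : (φ (minProj ha i) j).rank = r := by
    have := rank_map_minProj ha h i j
    rw [hr] at this; exact_mod_cast this
  obtain ⟨v, hv, hsum⟩ := exists_orthonormal_of_isStarProjection hP hrk
  let e : Fin (b j) → ℂ := Pi.single ⟨0, hb j⟩ 1
  have he : star e = e := by
    ext s; simp [e, Pi.single_apply, apply_ite]
  have hee : e ⬝ᵥ e = 1 := by simp [e]
  have hE : vecMulVec e e = Matrix.single ⟨0, hb j⟩ ⟨0, hb j⟩ (1 : ℂ) := by
    simp [e, single_eq_single_vecMulVec_single]
  have hst : ∀ t, star (vecMulVec (v t) e) = vecMulVec e (star (v t)) := by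
    intro t
    rw [star_eq_conjTranspose, conjTranspose_vecMulVec, he]
  refine ⟨fun t => Pi.single j (vecMulVec (v t) e), fun s t => ?_, ?_, fun t => ?_, fun t => ?_⟩
  · rw [star_pi_single, hst, pi_single_mul_single, vecMulVec_mul_vecMulVec, hv, minProj]
    split_ifs <;> simp [hE]
  · simp only [star_pi_single, hst, pi_single_mul_single, vecMulVec_mul_vecMulVec, hee]
    rw [hsum]
    ext k : 1
    rcases eq_or_ne k j with rfl | hk
    · simp [Finset.sum_apply]
    · simp [Finset.sum_apply, hk]
  · rw [mul_pi_single, hsum, Finset.sum_mul]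
    simp only [vecMulVec_mul_vecMulVec, hv]
    congr 1
    rw [Finset.sum_eq_single t] <;> simp +contextual
  · rw [minProj, pi_single_mul_single, ← hE, vecMulVec_mul_vecMulVec, hee, one_smul]

lemma sum_norm_sq_dotProduct {m : Type*} [Fintype m] {r : ℕ} {η : Fin r → m → ℂ}
    {P X : Matrix m m ℂ} (hP : P = ∑ t, vecMulVec (η t) (star (η t))) (hX : X * P = X) (ζ : m → ℂ) :
    ∑ s, ‖star (η s) ⬝ᵥ (star X *ᵥ ζ)‖ ^ 2 = (star ζ ⬝ᵥ ((X * star X) *ᵥ ζ)).re := by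
  have e : star ζ ⬝ᵥ ((X * star X) *ᵥ ζ) =
      star (star X *ᵥ ζ) ⬝ᵥ (P *ᵥ (star X *ᵥ ζ)) := by
    rw [star_mulVec, ← dotProduct_mulVec, star_eq_conjTranspose, conjTranspose_conjTranspose,
      mulVec_mulVec, mulVec_mulVec, hX]
  rw [e, hP, sum_mulVec, dotProduct_sum, Complex.re_sum]
  refine Finset.sum_congr rfl fun s _ => ?_
  have e2 : star (star X *ᵥ ζ) ⬝ᵥ η s = star (star (η s) ⬝ᵥ (star X *ᵥ ζ)) := by
    rw [star_dotProduct]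
  rw [vecMulVec_mulVec, dotProduct_smul, e2, op_smul_eq_smul, smul_eq_mul, RCLike.star_def,
    Complex.mul_conj']
  norm_cast

variable {IA IB IC ID : Type} [DecidableEq IA] [DecidableEq IB] [DecidableEq IC]
  {G : Matrix IA IB ℤ} {K : Matrix IA IC ℤ} {L : Matrix IB ID ℤ} {H : Matrix IC ID ℤ}

lemma CommutingSquare.square_apply (S : CommutingSquare G K L H) (x : MultiMatrix S.a) :
    S.inclBD (S.inclAB x) = S.inclCD (S.inclAC x) := DFunLike.congr_fun S.square x

lemma CommutingSquare.inclAD_injective (S : CommutingSquare G K L H) :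
    Function.Injective (S.inclBD.comp S.inclAB) :=
  S.inclBD_injective.comp S.inclAB_injective

lemma apply_minProj_mul_mul {a : IA → ℕ} (ha : ∀ i, 0 < a i) (i i' : IA) (x : MultiMatrix a) :
    minProj ha i * x * minProj ha i' =
      if i = i' then x i ⟨0, ha i⟩ ⟨0, ha i⟩ • minProj ha i else 0 := by
  rw [minProj, pi_single_mul, minProj]
  rcases eq_or_ne i i' with rfl | h
  · rw [pi_single_mul_single, if_pos rfl, ← Pi.single_smul]
    congr 1
    ext s t
    by_cases hs : s = ⟨0, ha i⟩ <;> by_cases ht : t = ⟨0, ha i⟩ <;>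
      simp [Matrix.mul_apply, Matrix.single_apply, hs, ht, eq_comm]
  · rw [if_neg h, pi_single_mul, Pi.single_eq_of_ne h]
    simp

/-- The commuting square condition on the corners of `A`: if `b` lies in the corner of `B` cut out
by the minimal projections of `A` labelled by `i` and `i'`, its conditional expectation onto `C`,
which lies in `A`, is a multiple of the minimal projection when `i = i'` and zero otherwise. -/
lemma CommutingSquare.trace_mul_of_corner (S : CommutingSquare G K L H) {α : IA → ℝ}
    (hα : ∀ i, 0 < α i) (hαtr : ∀ i, S.tr (S.inclBD (S.inclAB (minProj S.a_pos i))) = α i)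
    (i i' : IA) (b : MultiMatrix S.b)
    (hb : S.inclAB (minProj S.a_pos i) * b * S.inclAB (minProj S.a_pos i') = b)
    (c : MultiMatrix S.c) :
    S.tr (S.inclBD b * S.inclCD c) = if i = i' then
      S.tr (S.inclBD b) / α i * S.tr (S.inclCD (S.inclAC (minProj S.a_pos i) * c)) else 0 := by
  obtain ⟨-, -, EA, EB, EC, hEA, hEB, hEC, -, h⟩ := S.commuting
  have h1 : EC (S.inclBD b) = EA (S.inclBD b) := by
    rw [h, LinearMap.comp_apply, hEB.fix (S.inclBD b) ⟨b, rfl⟩]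
  have h2 : S.tr (S.inclBD b * S.inclCD c) = S.tr (EA (S.inclBD b) * S.inclCD c) := by
    rw [← hEC.trace_preserving, ← h1]
    have := hEC.bimodule 1 (one_mem _) (S.inclCD c) ⟨c, rfl⟩ (S.inclBD b)
    rw [one_mul, one_mul] at this
    rw [this]
  obtain ⟨a, ha⟩ := hEA.mem (S.inclBD b)
  have ha' : S.inclBD (S.inclAB a) = EA (S.inclBD b) := ha
  have h3 : EA (S.inclBD b) =
      S.inclBD (S.inclAB (minProj S.a_pos i * a * minProj S.a_pos i')) := by
    have e1 : ∀ i, S.inclBD (S.inclAB (minProj S.a_pos i)) ∈ (S.inclBD.comp S.inclAB).range :=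
      fun i => ⟨minProj S.a_pos i, rfl⟩
    have := hEA.bimodule _ (e1 i) _ (e1 i') (S.inclBD b)
    rw [← map_mul, ← map_mul, hb, ← ha'] at this
    rw [← ha']
    simpa [map_mul] using this
  rw [apply_minProj_mul_mul] at h3
  split_ifs at h3 ⊢ with hii
  · have h4 := congrArg S.tr h3
    rw [hEA.trace_preserving, map_smul, map_smul, map_smul, hαtr, smul_eq_mul] at h4
    have hne : (α i : ℂ) ≠ 0 := by exact_mod_cast (hα i).ne'
    rw [h2, h3, map_smul, map_smul, S.square_apply, smul_mul_assoc, map_smul, ← map_mul, h4,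
      mul_div_cancel_right₀ _ hne, smul_eq_mul]
  · rw [h2, h3]; simp

variable [Fintype IA] [Fintype IB] [Fintype IC] [Fintype ID] [DecidableEq ID]

/-- The coefficient vectors of the trace on the four algebras of a commuting square. -/
structure CommutingSquare.IsTraceVector (S : CommutingSquare G K L H) (α : IA → ℝ) (β : IB → ℝ)
    (γ : IC → ℝ) (δ : ID → ℝ) : Prop where
  α_pos : ∀ i, 0 < α i
  β_pos : ∀ i, 0 < β i
  γ_pos : ∀ i, 0 < γ i
  δ_pos : ∀ i, 0 < δ i
  trA : ∀ i, S.tr (S.inclBD (S.inclAB (minProj S.a_pos i))) = α i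
  trB : ∀ i, S.tr (S.inclBD (minProj S.b_pos i)) = β i
  trC : ∀ i, S.tr (S.inclCD (minProj S.c_pos i)) = γ i
  trD : ∀ x, S.tr x = ∑ l, (δ l : ℂ) * (x l).trace
  α_eq : ∀ i, α i = ∑ j, (G i j : ℝ) * β j
  β_eq : ∀ j, β j = ∑ l, (L j l : ℝ) * δ l
  γ_eq : ∀ k, γ k = ∑ l, (H k l : ℝ) * δ l

lemma CommutingSquare.exists_isTraceVector (S : CommutingSquare G K L H) :
    ∃ α β γ δ, S.IsTraceVector α β γ δ := by
  obtain ⟨α, hα, hα1, hα2⟩ := exists_coeff S.tr_state S.a_pos _ S.inclAD_injective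
  obtain ⟨β, hβ, hβ1, hβ2⟩ := exists_coeff S.tr_state S.b_pos _ S.inclBD_injective
  obtain ⟨γ, hγ, hγ1, hγ2⟩ := exists_coeff S.tr_state S.c_pos _ S.inclCD_injective
  obtain ⟨δ, hδ, hδ1, hδ2⟩ := exists_coeff S.tr_state S.d_pos
    (StarAlgHom.id ℂ (MultiMatrix S.d)) Function.injective_id
  refine ⟨α, β, γ, δ, hα, hβ, hγ, hδ, hα1, hβ1, hγ1, hδ2, fun i => ?_, fun j => ?_, fun k => ?_⟩
  · have h2 := coeff_pullback S.a_pos S.inclAB_matrix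
      (S.tr ∘ₗ S.inclBD.toAlgHom.toLinearMap) β hβ2 i
    have h1 := hα1 i
    exact_mod_cast h1.symm.trans h2
  · exact_mod_cast (hβ1 j).symm.trans (coeff_pullback S.b_pos S.inclBD_matrix S.tr δ hδ2 j)
  · exact_mod_cast (hγ1 k).symm.trans (coeff_pullback S.c_pos S.inclCD_matrix S.tr δ hδ2 k)

/-- If the summands `B_j` and `D_l` are joined by an edge, the partial isometries from
`A` to `B` and from `A` to `C` give orthogonal elements of `D`; Bessel's inequality for them, tested
on the matrix units of `D_l`, is a comparison of the indices of `A ⊆ B` and `C ⊆ D`. -/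
lemma CommutingSquare.IsTraceVector.index_le {S : CommutingSquare G K L H} {α : IA → ℝ}
    {β : IB → ℝ} {γ : IC → ℝ} {δ : ID → ℝ} (h : S.IsTraceVector α β γ δ) (j : IB) (l : ID)
    (hjl : L j l ≠ 0) :
    δ l * ∑ i, (G i j : ℝ) * α i ≤ β j * ∑ k, (H k l : ℝ) * γ k := by
  -- All multiplicities are natural numbers, being ranks.
  have hG : ∀ i, ∃ r : ℕ, G i j = r :=
    fun i => ⟨_, (rank_map_minProj S.a_pos S.inclAB_matrix i j).symm⟩
  have hK : ∀ i k, ∃ r : ℕ, K i k = r :=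
    fun i k => ⟨_, (rank_map_minProj S.a_pos S.inclAC_matrix i k).symm⟩
  have hH : ∀ k, ∃ r : ℕ, H k l = r :=
    fun k => ⟨_, (rank_map_minProj S.c_pos S.inclCD_matrix k l).symm⟩
  choose rG hG using hG
  choose rK hK using hK
  choose rH hH using hH
  have hW := fun i => exists_partialIsometries S.a_pos S.b_pos S.inclAB_matrix i j (hG i)
  choose W hW1 hW2 hW3 hW4 using hW
  have hV := fun i k => exists_partialIsometries S.a_pos S.c_pos S.inclAC_matrix i k (hK i k)
  choose V hV1 hV2 hV3 hV4 using hV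
  have hη := fun k => exists_orthonormal_of_isStarProjection
    (map_minProj_isStarProjection S.c_pos S.inclCD k l)
    (by have := rank_map_minProj S.c_pos S.inclCD_matrix k l
        rw [hH k] at this; exact_mod_cast this : _ = rH k)
  choose η hη1 hη2 using hη
  -- A unit vector `ζ` in the range of the minimal projection of `B_j` in `D_l`.
  obtain ⟨ζ, hζ1, hζ2⟩ : ∃ ζ : Fin (S.d l) → ℂ, star ζ ⬝ᵥ ζ = 1 ∧
      S.inclBD (minProj S.b_pos j) l *ᵥ ζ = ζ := by
    obtain ⟨r, hr⟩ : ∃ r, (S.inclBD (minProj S.b_pos j) l).rank = r + 1 := by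
      refine Nat.exists_eq_add_one_of_ne_zero fun h0 => hjl ?_
      rw [← rank_map_minProj S.b_pos S.inclBD_matrix j l, h0]
      rfl
    obtain ⟨v, hv1, hv2⟩ := exists_orthonormal_of_isStarProjection
      (map_minProj_isStarProjection S.b_pos S.inclBD j l) hr
    refine ⟨v 0, by rw [hv1, if_pos rfl], ?_⟩
    rw [hv2, sum_mulVec]
    simp only [vecMulVec_mulVec, hv1]
    rw [Finset.sum_eq_single 0] <;> simp +contextual
  let f := vecFunctional (d := S.d) l ζ ζ
  have key : ∀ k, ∑ i, ∑ m, ∑ t, δ l * α i *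
      (f (S.inclBD (star (W i m)) * S.inclCD (V i k t * star (V i k t)) * S.inclBD (W i m))).re ≤
      β j * ((H k l : ℝ) * γ k) := by
    intro k
    let X : (Σ i, Fin (rG i) × Fin (rK i k)) → MultiMatrix S.d :=
      fun p => S.inclBD (star (W p.1 p.2.1)) * S.inclCD (V p.1 k p.2.2)
    have hX : ∀ p q, S.tr (star (X p) * X q) =
        if p = q then ((β j * γ k / α p.1 : ℝ) : ℂ) else 0 := by
      rintro ⟨i, m, t⟩ ⟨i', m', t'⟩
      have e1 : S.tr (star (X ⟨i, m, t⟩) * X ⟨i', m', t'⟩) =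
          S.tr (S.inclBD (W i m * star (W i' m')) * S.inclCD (V i' k t' * star (V i k t))) := by
        simp only [X, star_mul, ← map_star, star_star]
        rw [mul_assoc, S.tr_state.map_mul_comm]
        simp only [map_mul, mul_assoc]
      have e2 : S.inclAB (minProj S.a_pos i) * (W i m * star (W i' m')) *
          S.inclAB (minProj S.a_pos i') = W i m * star (W i' m') := by
        have e3 : star (W i' m') * S.inclAB (minProj S.a_pos i') = star (W i' m') := by
          have := congrArg star (hW3 i' m')
          rwa [star_mul, ← map_star, (minProj_isStarProjection _ _).isSelfAdjoint.star_eq] at this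
        rw [← mul_assoc, hW3, mul_assoc, e3]
      rw [e1, S.trace_mul_of_corner h.α_pos h.trA i i' _ e2]
      by_cases hi : i = i'
      · subst hi
        rw [if_pos rfl, map_mul, S.tr_state.map_mul_comm, ← map_mul, hW1, ← mul_assoc, hV3,
          map_mul S.inclCD, S.tr_state.map_mul_comm, ← map_mul, hV1]
        by_cases hm : m' = m
        · by_cases ht : t = t'
          · subst hm ht
            simp only [if_true, h.trB, h.trC]
            push_cast; ring
          · subst hm; simp [ht]
        · simp [hm, Ne.symm hm]
      · rw [if_neg hi, if_neg]
        simp [hi]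
    have hbes : ∀ s : Fin (rH k), ∑ p : (Σ i, Fin (rG i) × Fin (rK i k)),
        α p.1 / (β j * γ k) * ‖S.tr (star (X p) *
          Pi.single l (vecMulVec ζ (star (η k s))))‖ ^ 2 ≤ δ l := by
      intro s
      refine bessel_of_faithful S.tr_state X _ _ hX
        (fun p => (div_pos (h.α_pos _) (mul_pos (h.β_pos _) (h.γ_pos _))).le) (fun p => ?_) _ _ ?_
      · have h1 := (h.α_pos p.1).ne'
        have h2 := (h.β_pos j).ne'
        have h3 := (h.γ_pos k).ne'
        apply le_of_eq
        field_simp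
      · rw [star_pi_single, pi_single_mul_single, star_eq_conjTranspose, conjTranspose_vecMulVec,
          star_star, vecMulVec_mul_vecMulVec, hζ1, one_smul, h.trD, Finset.sum_eq_single l]
        · rw [Pi.single_eq_same, trace_vecMulVec, dotProduct_comm, hη1]; simp
        · intro l' _ hl'; simp [hl']
        · simp
    have hval : ∀ p, ∑ s, ‖S.tr (star (X p) * Pi.single l (vecMulVec ζ (star (η k s))))‖ ^ 2 =
        δ l ^ 2 * (f (X p * star (X p))).re := by
      intro p
      have e1 : ∀ s, S.tr (star (X p) * Pi.single l (vecMulVec ζ (star (η k s)))) =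
          δ l * (star (η k s) ⬝ᵥ (star (X p l) *ᵥ ζ)) := by
        intro s
        rw [mul_pi_single, h.trD, Finset.sum_eq_single l]
        · rw [Pi.single_eq_same, mul_vecMulVec, trace_vecMulVec, dotProduct_comm]; rfl
        · intro l' _ hl'; simp [hl']
        · simp
      have e2 : X p * S.inclCD (minProj S.c_pos k) = X p := by
        simp only [X]
        rw [mul_assoc, ← map_mul, hV4]
      have e3 := sum_norm_sq_dotProduct (hη2 k) (X := X p l)
        (by rw [← Pi.mul_apply, e2]) ζ
      simp only [e1, norm_mul, mul_pow, Complex.norm_real, Real.norm_eq_abs, sq_abs]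
      rw [← Finset.mul_sum, e3]
      rfl
    have hsum := Finset.sum_le_sum fun s (_ : s ∈ Finset.univ) => hbes s
    rw [Finset.sum_comm] at hsum
    simp only [← Finset.mul_sum, hval] at hsum
    simp only [Finset.sum_const, Finset.card_univ, Fintype.card_fin, nsmul_eq_mul] at hsum
    have hβγ := mul_pos (h.β_pos j) (h.γ_pos k)
    have e5 : ∑ i, ∑ m, ∑ t, δ l * α i *
        (f (S.inclBD (star (W i m)) * S.inclCD (V i k t * star (V i k t)) * S.inclBD (W i m))).re =
        (∑ p, α p.1 / (β j * γ k) * (δ l ^ 2 * (f (X p * star (X p))).re)) *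
          (β j * γ k) / δ l := by
      rw [Fintype.sum_sigma, Finset.sum_mul, Finset.sum_div]
      refine Finset.sum_congr rfl fun i _ => ?_
      rw [Fintype.sum_prod_type, Finset.sum_mul, Finset.sum_div]
      refine Finset.sum_congr rfl fun m _ => ?_
      rw [Finset.sum_mul, Finset.sum_div]
      refine Finset.sum_congr rfl fun t _ => ?_
      have h1 := (h.δ_pos l).ne'
      have h2 := (h.β_pos j).ne'
      have h3 := (h.γ_pos k).ne'
      simp only [X, star_mul, ← map_star, star_star, map_mul, mul_assoc]
      field_simp
    rw [e5, div_le_iff₀ (h.δ_pos l), hH k]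
    push_cast
    calc _ ≤ (rH k : ℝ) * δ l * (β j * γ k) := mul_le_mul_of_nonneg_right hsum hβγ.le
      _ = _ := by ring
  have hfin : ∀ i m, ∑ k, ∑ t, (f (S.inclBD (star (W i m)) * S.inclCD (V i k t * star (V i k t)) *
      S.inclBD (W i m))).re = 1 := by
    intro i m
    simp only [← Complex.re_sum, ← map_sum, ← Finset.sum_mul, ← Finset.mul_sum, hV2]
    rw [Finset.univ_sum_single, ← S.square_apply, ← map_mul, ← map_mul, mul_assoc, hW3, hW1,
      if_pos rfl]
    simp [f, vecFunctional, hζ2, hζ1]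
  calc δ l * ∑ i, (G i j : ℝ) * α i
      = ∑ i, ∑ m, δ l * α i * ∑ k, ∑ t, (f (S.inclBD (star (W i m)) *
          S.inclCD (V i k t * star (V i k t)) * S.inclBD (W i m))).re := by
        simp only [hfin, mul_one, Finset.sum_const, Finset.card_univ, Fintype.card_fin, hG,
          nsmul_eq_mul, Finset.mul_sum, Int.cast_natCast]
        exact Finset.sum_congr rfl fun i _ => by ring
    _ = ∑ k, ∑ i, ∑ m, ∑ t, δ l * α i * (f (S.inclBD (star (W i m)) *
          S.inclCD (V i k t * star (V i k t)) * S.inclBD (W i m))).re := by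
        simp only [Finset.mul_sum]
        rw [Finset.sum_comm]
        refine Finset.sum_congr rfl fun i _ => ?_
        rw [Finset.sum_comm]
    _ ≤ ∑ k, β j * ((H k l : ℝ) * γ k) := Finset.sum_le_sum fun k _ => key k
    _ = _ := by rw [Finset.mul_sum]

end Forward

/-! ### From a commuting square to nine vectors -/

section ForwardStar

open Matrix

/-- The resolution conditions on the vectors, read off in coordinates. -/
lemma sum_rankOne_eq_iff {J : Type*} [Fintype J] (e : J → EuclideanSpace ℂ (Fin 2)) (a : ℂ) :
    ∑ j, InnerProductSpace.rankOne ℂ (e j) (e j) =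
        a • ContinuousLinearMap.id ℂ (EuclideanSpace ℂ (Fin 2)) ↔
      ∀ s t, ∑ j, e j s * star (e j t) = if s = t then a else 0 := by
  have key : ∀ (z : EuclideanSpace ℂ (Fin 2)) s,
      ((∑ j, InnerProductSpace.rankOne ℂ (e j) (e j)) z) s =
        ∑ t, z t * ∑ j, e j s * star (e j t) := by
    intro z s
    simp only [_root_.sum_apply, InnerProductSpace.rankOne_apply, WithLp.ofLp_sum,
      Finset.sum_apply, PiLp.smul_apply, PiLp.inner_apply, RCLike.inner_apply, smul_eq_mul,
      Finset.mul_sum, Finset.sum_mul]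
    rw [Finset.sum_comm]
    refine Finset.sum_congr rfl fun t _ => Finset.sum_congr rfl fun j _ => ?_
    rw [RCLike.star_def]; ring
  constructor
  · intro h s t
    have := key (EuclideanSpace.single t 1) s
    rw [h] at this
    simpa [Pi.single_apply] using this.symm
  · intro h
    ext z s
    rw [key]
    simp only [h, mul_ite, mul_zero, Finset.sum_ite_eq, Finset.mem_univ, if_true]
    simp [mul_comm]

variable {n : Fin 3 → ℕ}

lemma biadj_block_eq (j l : OddVertex n) :
    ((biadj n).transpose * biadj n - 1 : Matrix _ _ ℝ) j l =
      (((biadjacency n).transpose * biadjacency n - 1 : Matrix _ _ ℤ) j l : ℝ) := by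
  simp only [Matrix.sub_apply, Matrix.mul_apply, Matrix.transpose_apply, biadj_eq, Matrix.one_apply]
  push_cast
  simp

lemma twoStepCount_nonneg (u v : Vertex n) : 0 ≤ twoStepCount u v := by
  unfold twoStepCount; split_ifs <;> norm_num

/-- The commuting squares admitted by the 3-star. -/
abbrev StarCommutingSquare (n : Fin 3 → ℕ) : Type :=
  CommutingSquare (biadjacency n) (biadjacency n * (biadjacency n).transpose - 1)
    ((biadjacency n).transpose * biadjacency n - 1) (biadjacency n)

/-- In a commuting square of the 3-star the trace is given by the Perron-Frobenius eigenvector: the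
index comparisons, weighted by the entries of `Gᵗ G - 1`, add up to an equality, hence are all
equalities, and the graph of `Gᵗ G - 1` is connected. -/
lemma traceVector_eq (hn : ∀ i, 0 < n i) {lam : ℝ} {ξ : Vertex n → ℝ} (hξ : IsEigen lam ξ)
    (hpos : ∀ v, 0 < ξ v) (hd : ξ none = 1) {S : StarCommutingSquare n} {α γ : EvenVertex n → ℝ}
    {β δ : OddVertex n → ℝ} (h : S.IsTraceVector α β γ δ) :
    ∃ t, 0 < t ∧ 0 < lam ^ 2 - 1 ∧ (∀ l, δ l = t * ξ l.1) ∧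
      (∀ j, β j = (lam ^ 2 - 1) * t * ξ j.1) ∧ (∀ k, γ k = t * lam * ξ k.1) ∧
      ∀ i, α i = (lam ^ 2 - 1) * t * lam * ξ i.1 := by
  set g := biadj n with hg
  have hL : ∀ j l, (gᵀ * g - 1 : Matrix _ _ ℝ) j l = (twoStepCount j.1 l.1 : ℝ) := by
    intro j l; rw [biadj_block_eq, oddBlock_apply hn]
  have hα : α = g *ᵥ β := by
    ext i; rw [h.α_eq]; simp only [mulVec, dotProduct, hg, biadj_eq]
  have hβ : β = (gᵀ * g - 1) *ᵥ δ := by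
    ext j; rw [h.β_eq]; simp only [mulVec, dotProduct, hg, biadj_block_eq]
  have hγ : γ = g *ᵥ δ := by
    ext i; rw [h.γ_eq]; simp only [mulVec, dotProduct, hg, biadj_eq]
  have hβ' : β = gᵀ *ᵥ (g *ᵥ δ) - δ := by rw [hβ, sub_mulVec, one_mulVec, mulVec_mulVec]
  have hle : ∀ j l, twoStepCount j.1 l.1 ≠ 0 →
      δ l * (gᵀ *ᵥ α) j ≤ β j * (gᵀ *ᵥ γ) l := by
    intro j l hjl
    have := h.index_le j l (by rwa [oddBlock_apply hn])
    simpa only [mulVec, dotProduct, hg, biadj_eq, transpose_apply] using this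
  have hsum : ∑ j, ∑ l, (twoStepCount j.1 l.1 : ℝ) *
      (β j * (gᵀ *ᵥ γ) l - δ l * (gᵀ *ᵥ α) j) = 0 := by
    have e1 : ∑ j, ∑ l, (twoStepCount j.1 l.1 : ℝ) *
        (β j * (gᵀ *ᵥ γ) l - δ l * (gᵀ *ᵥ α) j) =
        β ⬝ᵥ ((gᵀ * g - 1) *ᵥ (gᵀ *ᵥ γ)) - (gᵀ *ᵥ α) ⬝ᵥ ((gᵀ * g - 1) *ᵥ δ) := by
      simp only [dotProduct, mulVec, hL]
      rw [← Finset.sum_sub_distrib]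
      refine Finset.sum_congr rfl fun j _ => ?_
      rw [Finset.mul_sum, Finset.mul_sum, ← Finset.sum_sub_distrib]
      exact Finset.sum_congr rfl fun l _ => by ring
    rw [e1, ← hβ, hα, hγ, dotProduct_comm (gᵀ *ᵥ _), ← dotProduct_sub]
    have e2 : (gᵀ * g - 1) *ᵥ (gᵀ *ᵥ (g *ᵥ δ)) = gᵀ *ᵥ (g *ᵥ β) := by
      rw [hβ']
      simp only [mulVec_sub, mulVec_mulVec]
      rw [← sub_mulVec, sub_mul, one_mul]
      simp only [Matrix.mul_assoc]
    rw [e2, sub_self, dotProduct_zero]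
  have hnn : ∀ j l, 0 ≤ (twoStepCount j.1 l.1 : ℝ) *
      (β j * (gᵀ *ᵥ γ) l - δ l * (gᵀ *ᵥ α) j) := by
    intro j l
    rcases eq_or_ne (twoStepCount j.1 l.1) 0 with h0 | h0
    · simp [h0]
    · exact mul_nonneg (by exact_mod_cast twoStepCount_nonneg _ _) (by linarith [hle j l h0])
  have heq : ∀ j l, twoStepCount j.1 l.1 ≠ 0 → (gᵀ *ᵥ α) j / β j = (gᵀ *ᵥ γ) l / δ l := by
    intro j l hjl
    have e1 := (Finset.sum_eq_zero_iff_of_nonneg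
      (fun j _ => Finset.sum_nonneg fun l _ => hnn j l)).1 hsum j (Finset.mem_univ _)
    have e2 := (Finset.sum_eq_zero_iff_of_nonneg (fun l _ => hnn j l)).1 e1 l (Finset.mem_univ _)
    have e3 := (mul_eq_zero.1 e2).resolve_left (by exact_mod_cast hjl)
    rw [div_eq_div_iff (h.β_pos j).ne' (h.δ_pos l).ne']
    linarith
  obtain ⟨μ, hμ⟩ := eq_of_twoStepCount hn _ _ heq
  have hμ' : gᵀ *ᵥ (g *ᵥ δ) = μ • δ := by
    ext l
    rw [← hγ]
    have := (hμ l).2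
    rw [div_eq_iff (h.δ_pos l).ne'] at this
    simpa using this
  obtain ⟨e1, t, ht, e2, e3⟩ := odd_eigenvector hn hξ hpos hd h.δ_pos hμ'
  have e4 : ∀ j, β j = (lam ^ 2 - 1) * t * ξ j.1 := by
    intro j
    have := congrFun hβ' j
    rw [hμ'] at this
    rw [this, e1]
    simp only [Pi.sub_apply, Pi.smul_apply, smul_eq_mul, e2]
    ring
  have e5 : β = (lam ^ 2 - 1) • δ := by
    ext j; rw [e4]; simp only [Pi.smul_apply, smul_eq_mul, e2]; ring
  refine ⟨t, ht, ?_, e2, e4, fun k => by rw [hγ, e3], fun i => ?_⟩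
  · have := h.β_pos (oddVtx 0 1 (hn 0) odd_one)
    rw [e4, mul_assoc] at this
    exact pos_of_mul_pos_left this (mul_pos ht (hpos _)).le
  · rw [hα, e5, mulVec_smul, Pi.smul_apply, e3, smul_eq_mul]; ring

/-- The vertex next to the centre on the ray `x`. -/
def firstVtx (hn : ∀ i, 0 < n i) (x : Fin 3) : OddVertex n := oddVtx x 1 (hn x) odd_one

lemma biadjacency_centre (hn : ∀ i, 0 < n i) (x : Fin 3) :
    biadjacency n centre (firstVtx hn x) = 1 := by
  rw [biadjacency_apply, adjI, if_pos]
  exact adj_none_iff.2 (pos_vtx (hn x))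

lemma biadjacency_centre_of_ne (hn : ∀ i, 0 < n i) {j : OddVertex n}
    (hj : ∀ x, firstVtx hn x ≠ j) : biadjacency n centre j = 0 := by
  rw [biadjacency_apply, adjI, if_neg]
  intro h
  have h1 : pos j.1 = 1 := adj_none_iff.1 h
  apply hj (ray j.1)
  apply Subtype.ext
  simp only [firstVtx, oddVtx]
  rw [← h1, vtx_ray_pos]

lemma firstVtx_injective (hn : ∀ i, 0 < n i) : Function.Injective (firstVtx hn) := by
  intro x y h
  have := congrArg (fun j : OddVertex n => ray j.1) h
  simpa only [firstVtx, oddVtx, ray_vtx one_pos (hn _)] using this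

lemma sum_eq_sum_firstVtx (hn : ∀ i, 0 < n i) {M : Type*} [AddCommMonoid M] (F : OddVertex n → M)
    (hF : ∀ j, biadjacency n centre j = 0 → F j = 0) : ∑ j, F j = ∑ x, F (firstVtx hn x) :=
  (Fintype.sum_of_injective _ (firstVtx_injective hn) _ _
    (fun j hj => hF j (biadjacency_centre_of_ne hn fun x hx => hj ⟨x, hx⟩)) fun _ => rfl).symm

lemma twoStepCount_firstVtx (hn : ∀ i, 0 < n i) {x y : Fin 3} (h : x ≠ y) :
    twoStepCount (firstVtx hn x).1 (firstVtx hn y).1 = 1 := by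
  rw [twoStepCount, if_neg, if_pos]
  · exact (twoStep_vtx (hn x) (hn y)).2 (Or.inr (Or.inr (Or.inl ⟨rfl, rfl, h⟩)))
  · exact fun h0 => one_ne_zero ((vtx_eq_none (hn x)).1 h0.1)

lemma twoStepCount_firstVtx_le (hn : ∀ i, 0 < n i) (x y : Fin 3) :
    twoStepCount (firstVtx hn x).1 (firstVtx hn y).1 = 0 ∨
      twoStepCount (firstVtx hn x).1 (firstVtx hn y).1 = 1 := by
  rw [twoStepCount, if_neg]
  · split_ifs <;> simp
  · exact fun h0 => one_ne_zero ((vtx_eq_none (hn x)).1 h0.1)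

/-- A vertex other than the centre next to the first vertex of the ray `y` is the second vertex of
that ray. -/
lemma eq_vtx_two (hn : ∀ i, 0 < n i) {k : EvenVertex n} (hk : k ≠ centre) {y : Fin 3}
    (h : biadjacency n k (firstVtx hn y) ≠ 0) : 2 ≤ n y ∧ k.1 = vtx n y 2 := by
  rw [biadjacency_apply, adjI] at h
  have h1 : (threeStar n).Adj (firstVtx hn y).1 k.1 := by
    by_contra h0
    exact h (if_neg fun h2 => h0 h2.symm)
  rcases (adj_vtx_succ_iff (hn y)).1 h1 with h2 | h2
  · exact absurd (Subtype.ext h2) hk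
  · exact h2

lemma map_single_eq_zero {ι κ : Type} [DecidableEq ι] {a : ι → ℕ} {b : κ → ℕ}
    {φ : MultiMatrix a →⋆ₐ[ℂ] MultiMatrix b} {Λ : Matrix ι κ ℤ} (h : HasInclusionMatrix φ Λ)
    (ha : ∀ i, 0 < a i) {i : ι} {j : κ} (h0 : Λ i j = 0) (x : Matrix (Fin (a i)) (Fin (a i)) ℂ) :
    φ (Pi.single i x) j = 0 := by
  have h1 : φ (minProj ha i) j = 0 := by
    have := rank_map_minProj ha h i j
    rw [h0] at this
    obtain ⟨v, -, hv⟩ := exists_orthonormal_of_isStarProjection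
      (map_minProj_isStarProjection ha φ i j) (r := 0) (by exact_mod_cast this)
    simpa using hv
  have h2 : (Pi.single i x : MultiMatrix a) =
      ∑ s, Pi.single i (Matrix.single s ⟨0, ha i⟩ 1) * minProj ha i *
        Pi.single i (Matrix.single ⟨0, ha i⟩ s 1 * x) := by
    simp only [minProj, pi_single_mul_single]
    ext k : 1
    rcases eq_or_ne k i with rfl | hk
    · rw [Finset.sum_apply]
      simp only [Pi.single_eq_same]
      simp only [← Matrix.mul_assoc, single_mul_single_same, mul_one]
      rw [← Finset.sum_mul]
      have : ∑ s, Matrix.single s s (1 : ℂ) = (1 : Matrix (Fin (a k)) (Fin (a k)) ℂ) := by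
        rw [← diagonal_one, ← sum_single_eq_diagonal]
      rw [this, one_mul]
    · simp [Finset.sum_apply, hk]
  rw [h2, map_sum, Finset.sum_apply]
  refine Finset.sum_eq_zero fun s _ => ?_
  rw [map_mul, map_mul, Pi.mul_apply, Pi.mul_apply, h1]
  simp

end ForwardStar

section ForwardVectors

open Matrix

variable {n : Fin 3 → ℕ}

set_option maxHeartbeats 1000000 in
/-- A commuting square of the 3-star yields nine vectors. In the summand of `D` labelled by the
first vertex of the ray `y`, the image of the minimal projection of `A` at the centre, cut down by
the central projection of `B` at the first vertex of the ray `x`, has rank at most one; `e x y` is a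
rescaling of its range vector, in the coordinates given by the two partial isometries from `A` to
`C` at the centre. -/
lemma exists_vectors (hn : ∀ i, 0 < n i) {lam : ℝ} {ξ : Vertex n → ℝ} (hξ : IsEigen lam ξ)
    (hpos : ∀ v, 0 < ξ v) (hd : ξ none = 1) (S : StarCommutingSquare n) :
    ∃ e : Fin 3 → Fin 3 → Fin 2 → ℂ,
      (∀ x y, x ≠ y → ∑ s, ‖e x y s‖ ^ 2 = ξ (firstVtx hn y).1 -
        ξ (firstVtx hn x).1 * (lam * ξ (firstVtx hn y).1 - 1)) ∧
      (∀ y s t, ∑ x, e x y s * star (e x y t) =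
        if s = t then ((ξ (firstVtx hn y).1 : ℝ) : ℂ) else 0) ∧
      (∀ x s t, ∑ y, e x y s * star (e x y t) =
        if s = t then ((ξ (firstVtx hn x).1 : ℝ) : ℂ) else 0) := by
  obtain ⟨α, β, γ, δ, h⟩ := S.exists_isTraceVector
  obtain ⟨τ, hτ, hlam2, hδ, hβ, hγ, hα⟩ := traceVector_eq hn hξ hpos hd h
  have hlam := hξ.lam_pos hn hpos
  set o := firstVtx hn with ho
  have hcc : (biadjacency n * (biadjacency n).transpose - 1 : Matrix _ _ ℤ) centre centre =
      ((2 : ℕ) : ℤ) := by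
    rw [evenBlock_apply hn]; simp [twoStepCount, centre]
  have hd1 : ξ (centre (n := n)).1 = 1 := hd
  -- `P` is the image in `B` of the minimal projection of `A` at the centre, and `p x` is its
  -- component at the first vertex of the ray `x`.
  set P := S.inclAB (minProj S.a_pos centre) with hP
  have hW := fun x => exists_partialIsometries S.a_pos S.b_pos S.inclAB_matrix centre (o x)
    (r := 1) (by rw [biadjacency_centre hn]; rfl)
  choose W hW1 hW2 hW3 hW4 using hW
  set p : Fin 3 → MultiMatrix S.b := fun x => Pi.single (o x) (P (o x)) with hp
  have hpW : ∀ x, p x = W x 0 * star (W x 0) := fun x => by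
    have := hW2 x
    rw [Fin.sum_univ_one] at this
    exact this.symm
  have hpx : ∀ x, P * p x * P = p x := by
    intro x
    have hPi := (minProj_isStarProjection S.a_pos centre).map S.inclAB
    have e1 : star (W x 0) * P = star (W x 0) := by
      have := congrArg star (hW3 x 0)
      rwa [star_mul, hPi.isSelfAdjoint.star_eq] at this
    rw [hpW, ← mul_assoc, hW3, mul_assoc, e1]
  have htrp : ∀ x, S.tr (S.inclBD (p x)) = β (o x) := by
    intro x
    rw [hpW, map_mul, S.tr_state.map_mul_comm, ← map_mul, hW1, if_pos rfl, h.trB]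
  have hcorner : ∀ x c, S.tr (S.inclBD (p x) * S.inclCD c) =
      β (o x) / α centre * S.tr (S.inclCD (S.inclAC (minProj S.a_pos centre) * c)) := by
    intro x c
    rw [S.trace_mul_of_corner h.α_pos h.trA centre centre _ (hpx x), if_pos rfl, htrp]
  have hsump : ∑ x, p x = P := by
    rw [← sum_eq_sum_firstVtx hn (fun j => (Pi.single j (P j) : MultiMatrix S.b)),
      Finset.univ_sum_single]
    intro j hj
    have h0 : P j = 0 := by
      have := rank_map_minProj S.a_pos S.inclAB_matrix centre j
      rw [hj] at this
      obtain ⟨v, -, hv⟩ := exists_orthonormal_of_isStarProjection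
        (map_minProj_isStarProjection S.a_pos S.inclAB centre j) (r := 0) (by exact_mod_cast this)
      simpa using hv
    rw [h0, Pi.single_zero]
  -- The two partial isometries onto the component in `C` at the centre.
  obtain ⟨V, hV1, hV2, hV3, hV4⟩ :=
    exists_partialIsometries S.a_pos S.c_pos S.inclAC_matrix centre centre hcc
  have hη : ∀ y, ∃ v : Fin (S.d (o y)) → ℂ, star v ⬝ᵥ v = 1 ∧
      S.inclCD (minProj S.c_pos centre) (o y) = vecMulVec v (star v) := by
    intro y
    obtain ⟨v, hv1, hv2⟩ := exists_orthonormal_of_isStarProjection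
      (map_minProj_isStarProjection S.c_pos S.inclCD centre (o y)) (r := 1)
      (by have := rank_map_minProj S.c_pos S.inclCD_matrix centre (o y)
          rw [biadjacency_centre hn] at this; exact_mod_cast this)
    exact ⟨v 0, by simp [hv1], by simpa using hv2⟩
  choose η hη1 hη2 using hη
  have hrank : ∀ x l, ((S.inclBD (p x) l).rank : ℤ) = twoStepCount (o x).1 l.1 := by
    intro x l
    rw [← oddBlock_apply hn]
    refine S.inclBD_matrix (o x) _ (map_minProj_isStarProjection S.a_pos S.inclAB centre (o x)) ?_ l
    have := rank_map_minProj S.a_pos S.inclAB_matrix centre (o x)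
    rw [biadjacency_centre hn] at this
    exact_mod_cast this
  have hproj : ∀ x l, IsStarProjection (S.inclBD (p x) l) := by
    intro x l
    refine isStarProjection_apply (IsStarProjection.map ?_ S.inclBD) l
    have hq := map_minProj_isStarProjection S.a_pos S.inclAB centre (o x)
    exact ⟨by rw [IsIdempotentElem, hp, pi_single_mul_single, hq.isIdempotentElem.eq],
      by rw [IsSelfAdjoint, hp, star_pi_single, hq.isSelfAdjoint.star_eq]⟩
  have hζ : ∀ x y, ∃ v : Fin (S.d (o y)) → ℂ,
      S.inclBD (p x) (o y) = vecMulVec v (star v) := by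
    intro x y
    have hr := hrank x (o y)
    rcases twoStepCount_firstVtx_le hn x y with h0 | h0
    · rw [h0] at hr
      obtain ⟨v, -, hv⟩ := exists_orthonormal_of_isStarProjection (hproj x (o y)) (r := 0)
        (by exact_mod_cast hr)
      exact ⟨0, by rw [hv]; simp⟩
    · rw [h0] at hr
      obtain ⟨v, -, hv⟩ := exists_orthonormal_of_isStarProjection (hproj x (o y)) (r := 1)
        (by exact_mod_cast hr)
      exact ⟨v 0, by rw [hv]; simp⟩
  choose ζ hζ using hζ
  let θ : (y : Fin 3) → Fin 2 → Fin (S.d (o y)) → ℂ := fun y s => S.inclCD (V s) (o y) *ᵥ η y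
  let e : Fin 3 → Fin 3 → Fin 2 → ℂ := fun x y s =>
    (Real.sqrt (ξ (o y).1) : ℂ) * (star (θ y s) ⬝ᵥ ζ x y)
  let T : Fin 3 → Fin 3 → Fin 2 → Fin 2 → ℂ := fun x y s t =>
    vecFunctional (o y) (η y) (η y) (S.inclCD (star (V s)) * S.inclBD (p x) * S.inclCD (V t))
  have heT : ∀ x y s t, e x y s * star (e x y t) = ξ (o y).1 * T x y s t := by
    intro x y s t
    have e1 : T x y s t = star (θ y s) ⬝ᵥ ζ x y * star (star (θ y t) ⬝ᵥ ζ x y) := by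
      simp only [T, vecFunctional, LinearMap.coe_mk, AddHom.coe_mk, Pi.mul_apply, map_star,
        Pi.star_apply, hζ, θ, ← mulVec_mulVec, vecMulVec_mulVec, star_mulVec]
      rw [mulVec_smul, dotProduct_smul, dotProduct_mulVec, star_eq_conjTranspose,
        op_smul_eq_smul, smul_eq_mul, mul_comm]
      congr 1
      · rw [dotProduct_mulVec]
      · rw [← star_mulVec, ← star_dotProduct, ← dotProduct_mulVec]
    have e2 : ((Real.sqrt (ξ (o y).1) : ℝ) : ℂ) * (Real.sqrt (ξ (o y).1) : ℝ) = ξ (o y).1 := by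
      rw [← Complex.ofReal_mul, Real.mul_self_sqrt (hpos _).le]
    rw [e1, ← e2]
    simp only [e, star_mul', RCLike.star_def, Complex.conj_ofReal]
    ring
  -- The projections `p x` add up to the minimal projection of `A` at the centre.
  have hTcol : ∀ y s t, ∑ x, T x y s t = if s = t then 1 else 0 := by
    intro y s t
    simp only [T, ← map_sum, ← Finset.sum_mul, ← Finset.mul_sum]
    rw [hsump, hP, S.square_apply, ← map_mul, ← map_mul, mul_assoc, hV3, hV1]
    split_ifs
    · simp only [vecFunctional, LinearMap.coe_mk, AddHom.coe_mk, hη2, vecMulVec_mulVec, hη1]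
      simp [hη1]
    · simp
  -- Summed over `y` with the trace weights, completeness is the commuting square condition.
  have hTrow : ∀ x s t, ∑ y, (ξ (o y).1 : ℂ) * T x y s t =
      if s = t then (ξ (o x).1 : ℂ) else 0 := by
    intro x s t
    have e1 : S.tr (S.inclCD (star (V s)) * S.inclBD (p x) * S.inclCD (V t)) =
        ∑ y, ((δ (o y) : ℝ) : ℂ) * T x y s t := by
      rw [h.trD, sum_eq_sum_firstVtx hn]
      · refine Finset.sum_congr rfl fun y _ => ?_
        congr 1
        have : S.inclCD (star (V s)) * S.inclBD (p x) * S.inclCD (V t) =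
            S.inclCD (star (V s)) * S.inclBD (p x) * S.inclCD (V t) *
              S.inclCD (minProj S.c_pos centre) := by
          rw [mul_assoc _ (S.inclCD (V t)), ← map_mul, hV4]
        rw [this, Pi.mul_apply, hη2, mul_vecMulVec, trace_vecMulVec, dotProduct_comm]
        rfl
      · intro l hl
        have : S.inclCD (V t) l = 0 := by
          rw [← hV4 t, map_mul, Pi.mul_apply, minProj, map_single_eq_zero S.inclCD_matrix S.c_pos hl,
            mul_zero]
        rw [Pi.mul_apply, this]; simp
    have e2 : S.tr (S.inclCD (star (V s)) * S.inclBD (p x) * S.inclCD (V t)) =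
        β (o x) / α centre * if s = t then (γ centre : ℂ) else 0 := by
      rw [mul_assoc, S.tr_state.map_mul_comm, mul_assoc, ← map_mul, hcorner, ← mul_assoc, hV3,
        map_mul, S.tr_state.map_mul_comm, ← map_mul, hV1]
      split_ifs
      · rw [h.trC]
      · simp
    have e3 : (τ : ℂ) ≠ 0 := by exact_mod_cast hτ.ne'
    apply mul_left_cancel₀ e3
    rw [e2] at e1
    have e4 : ∑ y, ((δ (o y) : ℝ) : ℂ) * T x y s t = τ * ∑ y, (ξ (o y).1 : ℂ) * T x y s t := by
      rw [Finset.mul_sum]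
      refine Finset.sum_congr rfl fun y _ => ?_
      rw [hδ]; push_cast; ring
    rw [← e4, ← e1, hβ, hα, hγ, hd1]
    have e5 : (lam : ℂ) ≠ 0 := by exact_mod_cast hlam.ne'
    have e6 : (lam : ℂ) ^ 2 - 1 ≠ 0 := by exact_mod_cast hlam2.ne'
    split_ifs
    · push_cast
      field_simp
    · simp
  -- The part of `p x` at `y` that lies under the centre in `C` is what the other even vertices leave
  -- over, and their parts are determined by the trace.
  have hnorm : ∀ x y, x ≠ y → ∑ s, ‖e x y s‖ ^ 2 = ξ (o y).1 -
        ξ (o x).1 * (lam * ξ (o y).1 - 1) := by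
    intro x y hxy
    let Q : EvenVertex n → MultiMatrix S.c := fun k =>
      Pi.single k (S.inclAC (minProj S.a_pos centre) k)
    let M : EvenVertex n → OddVertex n → ℂ := fun k l =>
      ((S.inclBD (p x) * S.inclCD (Q k)) l).trace
    have hsumT : ∑ s, T x y s s = M centre (o y) := by
      have e1 : ∀ s, T x y s s = ((S.inclBD (p x) * S.inclCD (V s * star (V s))) (o y)).trace := by
        intro s
        have e2 : S.inclCD (V s * star (V s)) =
            S.inclCD (V s) * S.inclCD (minProj S.c_pos centre) * S.inclCD (star (V s)) := by
          rw [← map_mul, ← map_mul, hV4]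
        rw [e2, ← mul_assoc, Pi.mul_apply, trace_mul_comm, ← Pi.mul_apply, ← mul_assoc,
          ← mul_assoc, Pi.mul_apply, hη2, mul_vecMulVec, trace_vecMulVec, dotProduct_comm]
        rfl
      simp only [e1, M, Q]
      rw [← hV2, map_sum, Finset.mul_sum, Finset.sum_apply, trace_sum]
    have hMsum : ∑ k, M k (o y) = 1 := by
      simp only [M]
      rw [← trace_sum, ← Finset.sum_apply, ← Finset.mul_sum, ← map_sum]
      simp only [Q]
      rw [Finset.univ_sum_single, ← S.square_apply, ← map_mul]
      have e1 : p x * P = p x := by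
        rw [← hpx x, mul_assoc, ((minProj_isStarProjection S.a_pos centre).map
          S.inclAB).isIdempotentElem.eq]
      rw [← hP, e1, trace_eq_rank_of_isStarProjection (hproj x (o y))]
      have := hrank x (o y)
      rw [twoStepCount_firstVtx hn hxy] at this
      exact_mod_cast this
    have hMk : ∀ k, k ≠ centre → (δ (o y) : ℂ) * M k (o y) =
        β (o x) / α centre * (biadj n k (o y) * γ k) := by
      intro k hk
      rw [biadj_eq]
      by_cases hky : biadjacency n k (o y) = 0
      · rw [hky]
        simp only [M, Q, Pi.mul_apply]
        rw [map_single_eq_zero S.inclCD_matrix S.c_pos hky]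
        simp
      · obtain ⟨h2, hk2⟩ := eq_vtx_two hn hk hky
        have e1 : biadjacency n k (o y) = 1 := by
          rw [biadjacency_apply, adjI] at hky ⊢
          by_contra h0
          exact h0 (if_pos (by by_contra h3; exact hky (if_neg h3)))
        have e2 : S.tr (S.inclBD (p x) * S.inclCD (Q k)) = (δ (o y) : ℂ) * M k (o y) := by
          rw [h.trD, Finset.sum_eq_single (o y)]
          · intro l _ hl
            by_cases h3 : biadjacency n k l = 0
            · simp only [Pi.mul_apply, Q]
              rw [map_single_eq_zero S.inclCD_matrix S.c_pos h3]
              simp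
            · have h4 : l.1 = vtx n y 3 ∧ 3 ≤ n y := by
                have h5 : (threeStar n).Adj (vtx n y 2) l.1 := by
                  rw [biadjacency_apply, adjI, hk2] at h3
                  by_contra h0
                  exact h3 (if_neg h0)
                rcases (adj_vtx_succ_iff h2).1 h5 with h6 | h6
                · exact absurd (Subtype.ext h6) hl
                · exact ⟨h6.2, h6.1⟩
              have h5 : S.inclBD (p x) l = 0 := by
                have := hrank x l
                rw [twoStepCount, if_neg, if_neg] at this
                · obtain ⟨v, -, hv⟩ := exists_orthonormal_of_isStarProjection (hproj x l)
                    (r := 0) (by exact_mod_cast this)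
                  simpa using hv
                · rw [h4.1]
                  intro h6
                  have := (twoStep_vtx (hn x) h4.2).1 h6
                  simp [hxy] at this
                · rintro ⟨h6, -⟩
                  exact one_ne_zero ((vtx_eq_none (hn x)).1 h6)
              rw [Pi.mul_apply, h5]; simp
          · simp
        rw [← e2, hcorner, e1]
        have e3 : S.inclAC (minProj S.a_pos centre) * Q k = Q k := by
          simp only [Q]
          rw [mul_pi_single,
            (map_minProj_isStarProjection S.a_pos S.inclAC centre k).isIdempotentElem.eq]
        have e4 : S.tr (S.inclCD (Q k)) = γ k := by
          obtain ⟨V', h1', h2', -, -⟩ :=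
            exists_partialIsometries S.a_pos S.c_pos S.inclAC_matrix centre k (r := 1) (by
              rw [evenBlock_apply hn, hk2, twoStepCount, if_neg, if_pos]
              · rfl
              · exact (twoStep_vtx (x := y) (Nat.zero_le _) h2).2 (Or.inl ⟨rfl, Or.inl rfl⟩)
              · rintro ⟨-, h6⟩
                exact two_ne_zero ((vtx_eq_none h2).1 h6))
          have e5 : Q k = V' 0 * star (V' 0) := by
            simp only [Q]
            rw [← h2']; simp
          rw [e5, map_mul, S.tr_state.map_mul_comm, ← map_mul, h1', if_pos rfl, h.trC]
        rw [e3, e4]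
        push_cast; ring
    have hγsum : ∑ k, (biadj n k (o y) * γ k) = τ * lam * (lam * ξ (o y).1) := by
      rw [← hξ, ← sum_biadj_mul', Finset.mul_sum]
      exact Finset.sum_congr rfl fun k _ => by rw [hγ]; ring
    have hcy : biadj n centre (o y) = 1 := by
      rw [biadj_eq, biadjacency_centre hn]; simp
    have e1 : (δ (o y) : ℂ) = δ (o y) * M centre (o y) +
        β (o x) / α centre * ((τ * lam * (lam * ξ (o y).1) - γ centre : ℝ) : ℂ) := by
      have e2 : (δ (o y) : ℂ) = ∑ k, (δ (o y) : ℂ) * M k (o y) := by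
        rw [← Finset.mul_sum, hMsum, mul_one]
      rw [← hγsum]
      conv_lhs => rw [e2]
      rw [← Finset.add_sum_erase _ _ (Finset.mem_univ centre),
        ← Finset.add_sum_erase _ (fun k => biadj n k (o y) * γ k) (Finset.mem_univ centre), hcy]
      congr 1
      rw [one_mul, add_sub_cancel_left]
      push_cast
      rw [Finset.mul_sum]
      exact Finset.sum_congr rfl fun k hk => hMk k (Finset.ne_of_mem_erase hk)
    have e2 : ((∑ s, ‖e x y s‖ ^ 2 : ℝ) : ℂ) = ξ (o y).1 * M centre (o y) := by
      rw [← hsumT, Finset.mul_sum]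
      push_cast
      refine Finset.sum_congr rfl fun s _ => ?_
      rw [← heT, RCLike.star_def, Complex.mul_conj']
    have e3 : (τ : ℂ) ≠ 0 := by exact_mod_cast hτ.ne'
    have e5 : (lam : ℂ) ≠ 0 := by exact_mod_cast hlam.ne'
    have e6 : (lam : ℂ) ^ 2 - 1 ≠ 0 := by exact_mod_cast hlam2.ne'
    have e7 : ((∑ s, ‖e x y s‖ ^ 2 : ℝ) : ℂ) =
        ((ξ (o y).1 - ξ (o x).1 * (lam * ξ (o y).1 - 1) : ℝ) : ℂ) := by
      rw [e2]
      rw [hδ, hβ, hα, hγ, hd1] at e1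
      apply mul_left_cancel₀ e3
      push_cast at e1 ⊢
      field_simp at e1
      linear_combination -(τ : ℂ) * e1
    exact_mod_cast e7
  refine ⟨e, hnorm, fun y s t => ?_, fun x s t => ?_⟩
  · simp only [heT, ← Finset.mul_sum, hTcol]
    split_ifs <;> simp
  · simp only [heT, hTrow]

end ForwardVectors

/-! ### Conditional expectations -/

section CondExp

variable {D : Type} [Ring D] [StarRing D] [Algebra ℂ D] [StarModule ℂ D] {tr : D →ₗ[ℂ] ℂ}

lemma eq_zero_of_trace_mul_eq_zero (htr : IsFaithfulTracialState tr) {S : StarSubalgebra ℂ D}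
    {x : D} (hx : x ∈ S) (h : ∀ s ∈ S, tr (s * x) = 0) : x = 0 := by
  by_contra hne
  obtain ⟨r, hr, h'⟩ := htr.pos x hne
  rw [h _ (star_mem hx)] at h'
  exact hr.ne (by exact_mod_cast h')

/-- In finite dimension the trace-preserving conditional expectation exists: it is the orthogonal
projection for the trace form. -/
lemma exists_isCondExp [FiniteDimensional ℂ D] (htr : IsFaithfulTracialState tr)
    (S : StarSubalgebra ℂ D) : ∃ E, IsCondExp tr S E := by
  let B : LinearMap.BilinForm ℂ D := (LinearMap.mul ℂ D).compr₂ tr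
  have hB : ∀ x y, B x y = tr (x * y) := fun x y => rfl
  let W : Submodule ℂ D := Subalgebra.toSubmodule S.toSubalgebra
  have hW : ∀ x, x ∈ W ↔ x ∈ S := fun x => Iff.rfl
  have hrefl : B.IsRefl := fun x y hxy => by rw [hB, htr.map_mul_comm, ← hB, hxy]
  have hcompl : IsCompl W (B.orthogonal W) := by
    rw [LinearMap.BilinForm.isCompl_orthogonal_iff_disjoint hrefl, Submodule.disjoint_def]
    intro x hx hx'
    exact eq_zero_of_trace_mul_eq_zero htr hx fun s hs => hx' s hs
  have horth : ∀ y, y ∈ B.orthogonal W ↔ ∀ s ∈ S, tr (s * y) = 0 := fun y => Iff.rfl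
  let E : D →ₗ[ℂ] D := Submodule.projection W (B.orthogonal W) hcompl
  have hmem : ∀ x, E x ∈ W := fun x => Submodule.projection_apply_mem hcompl x
  have hfix : ∀ x ∈ W, E x = x := fun x hx => Submodule.projection_apply_left hcompl ⟨x, hx⟩
  have hker : ∀ x, x - E x ∈ B.orthogonal W := by
    intro x
    have := Submodule.projection_add_projection_eq_self hcompl x
    rw [show x - E x = Submodule.projection (B.orthogonal W) W hcompl.symm x from
      sub_eq_of_eq_add' this.symm]
    exact Submodule.projection_apply_mem _ _
  have hzero : ∀ x ∈ B.orthogonal W, E x = 0 := fun x hx =>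
    (Submodule.projection_apply_eq_zero_iff hcompl).2 hx
  refine ⟨E, hmem, hfix, fun s hs t ht x => ?_, fun x => ?_⟩
  · have h1 : s * (x - E x) * t ∈ B.orthogonal W := by
      rw [horth]
      intro u hu
      have := (horth _).1 (hker x) (t * u * s) (mul_mem (mul_mem ht hu) hs)
      rw [← this, ← mul_assoc, ← mul_assoc, htr.map_mul_comm]
      simp only [mul_assoc]
    have h2 : s * x * t = s * E x * t + s * (x - E x) * t := by noncomm_ring
    rw [h2, map_add, hzero _ h1, add_zero]
    exact hfix _ ((hW _).2 (mul_mem (mul_mem hs ((hW _).1 (hmem x))) ht))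
  · have := (horth _).1 (hker x) 1 (one_mem S)
    rw [one_mul, map_sub, sub_eq_zero] at this
    exact this.symm

lemma IsCondExp.trace_mul {S : StarSubalgebra ℂ D} {E : D →ₗ[ℂ] D} (hE : IsCondExp tr S E)
    {s : D} (hs : s ∈ S) (x : D) : tr (s * E x) = tr (s * x) := by
  have := hE.bimodule s hs 1 (one_mem S) x
  rw [mul_one, mul_one] at this
  rw [← this, hE.trace_preserving]

lemma IsCondExp.eq_of_trace_mul (htr : IsFaithfulTracialState tr) {S : StarSubalgebra ℂ D}
    {E : D →ₗ[ℂ] D} (hE : IsCondExp tr S E) {x y : D} (hy : y ∈ S)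
    (h : ∀ s ∈ S, tr (s * y) = tr (s * x)) : E x = y := by
  rw [← sub_eq_zero]
  refine eq_zero_of_trace_mul_eq_zero htr (sub_mem (hE.mem x) hy) fun s hs => ?_
  rw [mul_sub, map_sub, hE.trace_mul hs, h s hs, sub_self]

/-- The commuting square condition holds as soon as every element of `B` has the same inner products
with the elements of `C` as some element of `A`. -/
lemma isCommutingSquare_of_trace [FiniteDimensional ℂ D] (htr : IsFaithfulTracialState tr)
    {A B C : StarSubalgebra ℂ D} (hAB : A ≤ B) (hAC : A ≤ C)
    (h : ∀ b ∈ B, ∃ a ∈ A, ∀ c ∈ C, tr (b * c) = tr (a * c)) : IsCommutingSquare tr A B C := by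
  obtain ⟨EA, hEA⟩ := exists_isCondExp htr A
  obtain ⟨EB, hEB⟩ := exists_isCondExp htr B
  obtain ⟨EC, hEC⟩ := exists_isCondExp htr C
  refine ⟨hAB, hAC, EA, EB, EC, hEA, hEB, hEC, ?_, ?_⟩
  · ext x
    rw [LinearMap.comp_apply]
    refine (hEB.eq_of_trace_mul htr (hAB (hEA.mem x)) fun b hb => ?_).symm
    obtain ⟨a, ha, hbc⟩ := h b hb
    rw [hbc _ (hAC (hEA.mem x)), hEA.trace_mul ha, hbc _ (hEC.mem x), hEC.trace_mul (hAC ha)]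
  · ext x
    rw [LinearMap.comp_apply]
    obtain ⟨a, ha, hbc⟩ := h _ (hEB.mem x)
    have h1 : EC (EB x) = a := hEC.eq_of_trace_mul htr (hAC ha) fun c hc => by
      rw [htr.map_mul_comm, ← hbc c hc, htr.map_mul_comm]
    rw [h1]
    refine hEA.eq_of_trace_mul htr ha fun s hs => ?_
    rw [htr.map_mul_comm, ← hbc s (hAC hs), htr.map_mul_comm, hEB.trace_mul (hAB hs)]

end CondExp

/-! ### Commuting squares from block-diagonal inclusions -/

section Builder

open Matrix

/-- A multi-matrix algebra whose summands are matrices over arbitrary finite index types. -/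
abbrev MatrixSum {ι : Type} (X : ι → Type) : Type := ∀ i, Matrix (X i) (X i) ℂ

/-- The change of index types, as a *-homomorphism. -/
def reindexHom {ι : Type} {X Y : ι → Type} [∀ i, Fintype (X i)] [∀ i, DecidableEq (X i)]
    [∀ i, Fintype (Y i)] [∀ i, DecidableEq (Y i)] (e : ∀ i, X i ≃ Y i) :
    MatrixSum X →⋆ₐ[ℂ] MatrixSum Y where
  toFun x i := (x i).submatrix (e i).symm (e i).symm
  map_one' := by ext i : 1; simp
  map_mul' x y := by ext i : 1; simp [submatrix_mul_equiv]
  map_zero' := by ext i : 1; simp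
  map_add' x y := by ext i : 1; simp [submatrix_add]
  commutes' r := by
    ext i : 1
    simp [Algebra.algebraMap_eq_smul_one, submatrix_smul]
  map_star' x := by ext i : 1; simp [star_eq_conjTranspose, conjTranspose_submatrix]

variable {ι κ : Type}

lemma reindexHom_symm {X Y : ι → Type} [∀ i, Fintype (X i)] [∀ i, DecidableEq (X i)]
    [∀ i, Fintype (Y i)] [∀ i, DecidableEq (Y i)] (e : ∀ i, X i ≃ Y i) (x : MatrixSum Y) :
    reindexHom e (reindexHom (fun i => (e i).symm) x) = x := by
  ext i s t
  simp [reindexHom]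

lemma reindexHom_symm' {X Y : ι → Type} [∀ i, Fintype (X i)] [∀ i, DecidableEq (X i)]
    [∀ i, Fintype (Y i)] [∀ i, DecidableEq (Y i)] (e : ∀ i, X i ≃ Y i) (x : MatrixSum X) :
    reindexHom (fun i => (e i).symm) (reindexHom e x) = x := by
  ext i s t
  simp [reindexHom]

lemma trace_reindexHom {X Y : ι → Type} [∀ i, Fintype (X i)] [∀ i, DecidableEq (X i)]
    [∀ i, Fintype (Y i)] [∀ i, DecidableEq (Y i)] (e : ∀ i, X i ≃ Y i) (x : MatrixSum X) (i : ι) :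
    (reindexHom e x i).trace = (x i).trace := by
  simp only [reindexHom, StarAlgHom.coe_mk', trace, diag_apply]
  exact (e i).symm.sum_comp (fun s => x i s s)

variable [Fintype ι]

/-- An inclusion multiplies trace vectors by the inclusion matrix; conversely this determines the
inclusion matrix. -/
lemma hasInclusionMatrix_of_trace [DecidableEq ι] {a : ι → ℕ} {b : κ → ℕ} {φ : MultiMatrix a →⋆ₐ[ℂ] MultiMatrix b}
    {Λ : Matrix ι κ ℤ} (h : ∀ x j, (φ x j).trace = ∑ i, (Λ i j : ℂ) * (x i).trace) :
    HasInclusionMatrix φ Λ := by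
  intro i e he hr j
  have h1 : IsStarProjection (Pi.single i e : MultiMatrix a) :=
    ⟨by rw [IsIdempotentElem, pi_single_mul_single, he.isIdempotentElem.eq],
      by rw [IsSelfAdjoint, star_pi_single, he.isSelfAdjoint.star_eq]⟩
  have h2 := trace_eq_rank_of_isStarProjection (isStarProjection_apply (h1.map φ) j)
  rw [h, Finset.sum_eq_single i] at h2
  · rw [Pi.single_eq_same, trace_eq_rank_of_isStarProjection he, hr] at h2
    simp only [Nat.cast_one, mul_one] at h2
    exact_mod_cast h2.symm
  · intro i' _ hi'
    simp [hi']
  · simp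

/-- A combination of matrix traces with positive coefficients is a faithful trace. -/
lemma isFaithfulTracialState_of_pos {d : ι → ℕ} {δ : ι → ℝ} (hδ : ∀ l, 0 < δ l)
    (tr : MultiMatrix d →ₗ[ℂ] ℂ) (htr : ∀ x, tr x = ∑ l, (δ l : ℂ) * (x l).trace)
    (h1 : tr 1 = 1) : IsFaithfulTracialState tr where
  map_one := h1
  map_mul_comm x y := by
    rw [htr, htr]
    exact Finset.sum_congr rfl fun l _ => by rw [Pi.mul_apply, Pi.mul_apply, trace_mul_comm]
  pos x hx := by
    refine ⟨∑ l, δ l * ∑ i, ∑ j, ‖x l j i‖ ^ 2, ?_, ?_⟩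
    · obtain ⟨l, hl⟩ : ∃ l, x l ≠ 0 := by
        by_contra h0
        exact hx (funext fun l => not_not.1 fun h2 => h0 ⟨l, h2⟩)
      obtain ⟨j, i, hij⟩ : ∃ j i, x l j i ≠ 0 := by
        by_contra! h0
        exact hl (Matrix.ext h0)
      refine Finset.sum_pos' (fun l _ => mul_nonneg (hδ l).le (by positivity))
        ⟨l, Finset.mem_univ _, mul_pos (hδ l) ?_⟩
      refine Finset.sum_pos' (fun i _ => by positivity) ⟨i, Finset.mem_univ _, ?_⟩
      exact Finset.sum_pos' (fun j _ => by positivity) ⟨j, Finset.mem_univ _, by positivity⟩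
    · rw [htr]
      push_cast
      refine Finset.sum_congr rfl fun l _ => ?_
      congr 1
      simp only [trace, diag_apply, Pi.mul_apply, Matrix.mul_apply, Pi.star_apply,
        star_eq_conjTranspose, conjTranspose_apply, RCLike.star_def, Complex.conj_mul']

end Builder

section Transport

open Matrix

variable {IA IB IC ID : Type} [Fintype IA] [Fintype IB] [Fintype IC] [Fintype ID]
  [DecidableEq IA] [DecidableEq IB] [DecidableEq IC]

/-- A commuting square may be given by multi-matrix algebras over arbitrary finite index types, by
the effect of its inclusions on traces, and by the trace criterion for the commuting square
condition. -/
lemma nonempty_commutingSquare {G : Matrix IA IB ℤ} {K : Matrix IA IC ℤ} {L : Matrix IB ID ℤ}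
    {H : Matrix IC ID ℤ} {XA : IA → Type} {XB : IB → Type} {XC : IC → Type} {XD : ID → Type}
    [∀ i, Fintype (XA i)] [∀ i, DecidableEq (XA i)] [∀ i, Nonempty (XA i)]
    [∀ i, Fintype (XB i)] [∀ i, DecidableEq (XB i)] [∀ i, Nonempty (XB i)]
    [∀ i, Fintype (XC i)] [∀ i, DecidableEq (XC i)] [∀ i, Nonempty (XC i)]
    [∀ i, Fintype (XD i)] [∀ i, DecidableEq (XD i)] [∀ i, Nonempty (XD i)]
    (φAB : MatrixSum XA →⋆ₐ[ℂ] MatrixSum XB) (φAC : MatrixSum XA →⋆ₐ[ℂ] MatrixSum XC)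
    (φBD : MatrixSum XB →⋆ₐ[ℂ] MatrixSum XD) (φCD : MatrixSum XC →⋆ₐ[ℂ] MatrixSum XD)
    (hAB : Function.Injective φAB) (hAC : Function.Injective φAC)
    (hBD : Function.Injective φBD) (hCD : Function.Injective φCD)
    (hsq : ∀ a, φBD (φAB a) = φCD (φAC a))
    (tAB : ∀ x j, (φAB x j).trace = ∑ i, (G i j : ℂ) * (x i).trace)
    (tAC : ∀ x j, (φAC x j).trace = ∑ i, (K i j : ℂ) * (x i).trace)
    (tBD : ∀ x j, (φBD x j).trace = ∑ i, (L i j : ℂ) * (x i).trace)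
    (tCD : ∀ x j, (φCD x j).trace = ∑ i, (H i j : ℂ) * (x i).trace)
    (δ : ID → ℝ) (hδ : ∀ l, 0 < δ l) (hID : Nonempty ID)
    (hcrit : ∀ b, ∃ a, ∀ c, ∑ l, (δ l : ℂ) * ((φBD b * φCD c) l).trace =
      ∑ l, (δ l : ℂ) * ((φBD (φAB a) * φCD c) l).trace) :
    Nonempty (CommutingSquare G K L H) := by
  let eA := fun i => Fintype.equivFin (XA i)
  let eB := fun i => Fintype.equivFin (XB i)
  let eC := fun i => Fintype.equivFin (XC i)
  let eD := fun i => Fintype.equivFin (XD i)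
  let ρA : MatrixSum XA →⋆ₐ[ℂ] MultiMatrix fun i => Fintype.card (XA i) := reindexHom eA
  let ρB : MatrixSum XB →⋆ₐ[ℂ] MultiMatrix fun i => Fintype.card (XB i) := reindexHom eB
  let ρC : MatrixSum XC →⋆ₐ[ℂ] MultiMatrix fun i => Fintype.card (XC i) := reindexHom eC
  let ρD : MatrixSum XD →⋆ₐ[ℂ] MultiMatrix fun i => Fintype.card (XD i) := reindexHom eD
  let σA : (MultiMatrix fun i => Fintype.card (XA i)) →⋆ₐ[ℂ] MatrixSum XA :=
    reindexHom fun i => (eA i).symm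
  let σB : (MultiMatrix fun i => Fintype.card (XB i)) →⋆ₐ[ℂ] MatrixSum XB :=
    reindexHom fun i => (eB i).symm
  let σC : (MultiMatrix fun i => Fintype.card (XC i)) →⋆ₐ[ℂ] MatrixSum XC :=
    reindexHom fun i => (eC i).symm
  have hσA : ∀ x, σA (ρA x) = x := reindexHom_symm' eA
  have hσB : ∀ x, σB (ρB x) = x := reindexHom_symm' eB
  have hσC : ∀ x, σC (ρC x) = x := reindexHom_symm' eC
  have iA : Function.Injective σA := Function.LeftInverse.injective (reindexHom_symm eA)
  have iB : Function.Injective σB := Function.LeftInverse.injective (reindexHom_symm eB)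
  have iC : Function.Injective σC := Function.LeftInverse.injective (reindexHom_symm eC)
  have jB : Function.Injective ρB := Function.LeftInverse.injective hσB
  have jC : Function.Injective ρC := Function.LeftInverse.injective hσC
  have jD : Function.Injective ρD := Function.LeftInverse.injective (reindexHom_symm' eD)
  -- The normalization of the trace.
  let N : ℝ := ∑ l, δ l * Fintype.card (XD l)
  have hN : 0 < N := Finset.sum_pos
    (fun l _ => mul_pos (hδ l) (by exact_mod_cast Fintype.card_pos)) Finset.univ_nonempty
  let tr : (MultiMatrix fun l => Fintype.card (XD l)) →ₗ[ℂ] ℂ :=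
    { toFun := fun x => ∑ l, ((δ l / N : ℝ) : ℂ) * (x l).trace
      map_add' := fun x y => by simp [mul_add, Finset.sum_add_distrib]
      map_smul' := fun r x => by
        simp only [Pi.smul_apply, trace_smul, smul_eq_mul, RingHom.id_apply, Finset.mul_sum]
        exact Finset.sum_congr rfl fun l _ => by ring }
  have htr : ∀ x, tr x = ∑ l, ((δ l / N : ℝ) : ℂ) * (x l).trace := fun x => rfl
  have htr' : ∀ x, tr (ρD x) = (N : ℂ)⁻¹ * ∑ l, (δ l : ℂ) * (x l).trace := by
    intro x
    rw [htr, Finset.mul_sum]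
    refine Finset.sum_congr rfl fun l _ => ?_
    rw [trace_reindexHom]
    push_cast; ring
  have hstate : IsFaithfulTracialState tr := by
    refine isFaithfulTracialState_of_pos (fun l => div_pos (hδ l) hN) tr htr ?_
    rw [htr]
    have : (N : ℂ) ≠ 0 := by exact_mod_cast hN.ne'
    simp only [Pi.one_apply, trace_one, Fintype.card_fin]
    push_cast
    simp only [div_mul_eq_mul_div]
    rw [← Finset.sum_div, div_eq_one_iff_eq this]
    simp [N]
  refine ⟨{
    a := _, b := _, c := _, d := _
    a_pos := fun i => Fintype.card_pos
    b_pos := fun i => Fintype.card_pos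
    c_pos := fun i => Fintype.card_pos
    d_pos := fun i => Fintype.card_pos
    inclAB := ρB.comp (φAB.comp σA)
    inclAC := ρC.comp (φAC.comp σA)
    inclBD := ρD.comp (φBD.comp σB)
    inclCD := ρD.comp (φCD.comp σC)
    inclAB_injective := jB.comp (hAB.comp iA)
    inclAC_injective := jC.comp (hAC.comp iA)
    inclBD_injective := jD.comp (hBD.comp iB)
    inclCD_injective := jD.comp (hCD.comp iC)
    square := ?_
    inclAB_matrix := hasInclusionMatrix_of_trace fun x j => ?_
    inclAC_matrix := hasInclusionMatrix_of_trace fun x j => ?_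
    inclBD_matrix := hasInclusionMatrix_of_trace fun x j => ?_
    inclCD_matrix := hasInclusionMatrix_of_trace fun x j => ?_
    tr := tr
    tr_state := hstate
    commuting := isCommutingSquare_of_trace hstate ?_ ?_ ?_ }⟩
  · ext x : 1
    simp only [StarAlgHom.comp_apply, hσB, hσC, hsq]
  · simp only [StarAlgHom.comp_apply]
    rw [trace_reindexHom, tAB]
    simp only [σA, trace_reindexHom]
  · simp only [StarAlgHom.comp_apply]
    rw [trace_reindexHom, tAC]
    simp only [σA, trace_reindexHom]
  · simp only [StarAlgHom.comp_apply]
    rw [trace_reindexHom, tBD]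
    simp only [σB, trace_reindexHom]
  · simp only [StarAlgHom.comp_apply]
    rw [trace_reindexHom, tCD]
    simp only [σC, trace_reindexHom]
  · rintro _ ⟨x, rfl⟩
    exact ⟨ρB (φAB (σA x)), rfl⟩
  · rintro _ ⟨x, rfl⟩
    refine ⟨ρC (φAC (σA x)), ?_⟩
    show ρD (φCD (σC (ρC (φAC (σA x))))) = ρD (φBD (σB (ρB (φAB (σA x)))))
    rw [hσB, hσC, hsq]
  · rintro _ ⟨b, rfl⟩
    obtain ⟨a, ha⟩ := hcrit (σB b)
    refine ⟨ρD (φBD (φAB a)), ⟨ρA a, ?_⟩, ?_⟩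
    · show ρD (φBD (σB (ρB (φAB (σA (ρA a)))))) = _
      rw [hσA, hσB]
    · rintro _ ⟨c, rfl⟩
      show tr (ρD (φBD (σB b)) * ρD (φCD (σC c))) = tr (ρD (φBD (φAB a)) * ρD (φCD (σC c)))
      rw [← map_mul, ← map_mul, htr', htr', ha]

/-- The *-homomorphism placing the summands labelled by `σ l e` down the diagonal of the summand
`l`. -/
noncomputable def blockHom {ι κ : Type} {X : ι → Type} [∀ i, Fintype (X i)]
    [∀ i, DecidableEq (X i)] {E : κ → Type} [∀ l, Fintype (E l)] [∀ l, DecidableEq (E l)]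
    (σ : ∀ l, E l → ι) : MatrixSum X →⋆ₐ[ℂ] MatrixSum fun l => Σ e : E l, X (σ l e) where
  toFun x l := blockDiagonal' fun e => x (σ l e)
  map_one' := by
    ext l : 1
    exact blockDiagonal'_one
  map_mul' x y := by
    ext l : 1
    exact blockDiagonal'_mul _ _
  map_zero' := by
    ext l : 1
    exact blockDiagonal'_zero
  map_add' x y := by
    ext l : 1
    exact blockDiagonal'_add _ _
  commutes' r := by
    ext l : 1
    simp only [Algebra.algebraMap_eq_smul_one, Pi.smul_apply, Pi.one_apply]
    rw [← blockDiagonal'_one, ← blockDiagonal'_smul]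
    rfl
  map_star' x := by
    ext l : 1
    exact (blockDiagonal'_conjTranspose _).symm

lemma trace_blockHom {ι κ : Type} {X : ι → Type} [∀ i, Fintype (X i)]
    [∀ i, DecidableEq (X i)] {E : κ → Type} [∀ l, Fintype (E l)] [∀ l, DecidableEq (E l)]
    (σ : ∀ l, E l → ι) (x : MatrixSum X) (l : κ) :
    (blockHom σ x l).trace = ∑ e, (x (σ l e)).trace := by
  show (blockDiagonal' fun e => x (σ l e)).trace = _
  simp [trace, Fintype.sum_sigma]

lemma blockHom_injective {ι κ : Type} {X : ι → Type} [∀ i, Fintype (X i)]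
    [∀ i, DecidableEq (X i)] {E : κ → Type} [∀ l, Fintype (E l)] [∀ l, DecidableEq (E l)]
    (σ : ∀ l, E l → ι) (h : ∀ i, ∃ l e, σ l e = i) :
    Function.Injective (blockHom (X := X) σ) := by
  intro x y hxy
  ext i : 1
  obtain ⟨l, e, rfl⟩ := h i
  have h2 : (blockDiagonal' fun e => x (σ l e)) = blockDiagonal' fun e => y (σ l e) :=
    congrFun hxy l
  exact congrFun (blockDiagonal'_injective h2) e

/-- Conjugation by a family of unitaries, as a *-homomorphism. -/
noncomputable def conjHom {κ : Type} {X Y : κ → Type} [∀ i, Fintype (X i)]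
    [∀ i, DecidableEq (X i)] [∀ i, Fintype (Y i)] [∀ i, DecidableEq (Y i)]
    (U : ∀ l, Matrix (Y l) (X l) ℂ) (h1 : ∀ l, U l * (U l)ᴴ = 1) (h2 : ∀ l, (U l)ᴴ * U l = 1) :
    MatrixSum X →⋆ₐ[ℂ] MatrixSum Y where
  toFun x l := U l * x l * (U l)ᴴ
  map_one' := by ext l : 1; simp [h1]
  map_mul' x y := by
    ext l : 1
    simp only [Pi.mul_apply]
    rw [show U l * x l * (U l)ᴴ * (U l * y l * (U l)ᴴ) =
      U l * x l * ((U l)ᴴ * U l) * y l * (U l)ᴴ by simp only [Matrix.mul_assoc], h2]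
    simp [Matrix.mul_assoc]
  map_zero' := by ext l : 1; simp
  map_add' x y := by ext l : 1; simp [Matrix.mul_add, Matrix.add_mul]
  commutes' r := by
    ext l : 1
    simp [Algebra.algebraMap_eq_smul_one, h1]
  map_star' x := by
    ext l : 1
    simp [star_eq_conjTranspose, Matrix.mul_assoc]

lemma trace_conjHom {κ : Type} {X Y : κ → Type} [∀ i, Fintype (X i)]
    [∀ i, DecidableEq (X i)] [∀ i, Fintype (Y i)] [∀ i, DecidableEq (Y i)]
    (U : ∀ l, Matrix (Y l) (X l) ℂ) (h1 : ∀ l, U l * (U l)ᴴ = 1) (h2 : ∀ l, (U l)ᴴ * U l = 1)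
    (x : MatrixSum X) (l : κ) : (conjHom U h1 h2 x l).trace = (x l).trace := by
  show (U l * x l * (U l)ᴴ).trace = _
  rw [trace_mul_comm, ← Matrix.mul_assoc, h2, Matrix.one_mul]

lemma conjHom_injective {κ : Type} {X Y : κ → Type} [∀ i, Fintype (X i)]
    [∀ i, DecidableEq (X i)] [∀ i, Fintype (Y i)] [∀ i, DecidableEq (Y i)]
    (U : ∀ l, Matrix (Y l) (X l) ℂ) (h1 : ∀ l, U l * (U l)ᴴ = 1) (h2 : ∀ l, (U l)ᴴ * U l = 1) :
    Function.Injective (conjHom U h1 h2) := by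
  intro x y hxy
  ext l : 1
  have h3 : U l * x l * (U l)ᴴ = U l * y l * (U l)ᴴ := congrFun hxy l
  have h4 : ∀ z : Matrix (X l) (X l) ℂ, (U l)ᴴ * (U l * z * (U l)ᴴ) * U l = z := by
    intro z
    rw [show (U l)ᴴ * (U l * z * (U l)ᴴ) * U l = ((U l)ᴴ * U l) * z * ((U l)ᴴ * U l) by
      simp only [Matrix.mul_assoc], h2]
    simp
  rw [← h4 (x l), h3, h4]

end Transport

section Connection

open Matrix

open Classical in
lemma sum_subtype_eq_ite {ι M : Type*} [Fintype ι] [AddCommMonoid M] (P : ι → Prop)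
    [Fintype {i // P i}] (F : ι → M) : ∑ e : {i // P i}, F e.1 = ∑ i, if P i then F i else 0 := by
  rw [← Finset.sum_filter]
  exact (Finset.sum_subtype _ (by simp) F).symm

lemma trace_blockDiagonal'_mul {E : Type*} [Fintype E] [DecidableEq E] {X : E → Type*}
    [∀ e, Fintype (X e)] (M : ∀ e, Matrix (X e) (X e) ℂ) (N : Matrix (Σ e, X e) (Σ e, X e) ℂ) :
    (blockDiagonal' M * N).trace = ∑ e, ∑ x, ∑ x', M e x x' * N ⟨e, x'⟩ ⟨e, x⟩ := by
  rw [trace, Fintype.sum_sigma]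
  refine Finset.sum_congr rfl fun e _ => Finset.sum_congr rfl fun x _ => ?_
  rw [diag_apply, mul_apply, Fintype.sum_sigma, Finset.sum_eq_single e]
  · simp [blockDiagonal'_apply_eq]
  · intro e' _ he
    simp [blockDiagonal'_apply_ne _ _ _ he.symm]
  · simp

lemma mul_blockDiagonal'_mul_apply {E Y : Type*} [Fintype E] [DecidableEq E] {X : E → Type*}
    [∀ e, Fintype (X e)] (M : ∀ e, Matrix (X e) (X e) ℂ) (P : Matrix Y (Σ e, X e) ℂ)
    (Q : Matrix (Σ e, X e) Y ℂ) (a b : Y) :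
    (P * blockDiagonal' M * Q) a b =
      ∑ e, ∑ z, ∑ z', P a ⟨e, z⟩ * M e z z' * Q ⟨e, z'⟩ b := by
  rw [Matrix.mul_assoc, mul_apply, Fintype.sum_sigma]
  refine Finset.sum_congr rfl fun e _ => Finset.sum_congr rfl fun x _ => ?_
  rw [mul_apply, Fintype.sum_sigma, Finset.sum_eq_single e]
  · simp [blockDiagonal'_apply_eq, Finset.mul_sum, mul_assoc]
  · intro e' _ he
    simp [blockDiagonal'_apply_ne _ _ _ he.symm]
  · simp

open Classical in
/-- The pairing of two block diagonal algebras that are conjugate by matrices `U l`, whose entries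
satisfy an orthogonality relation in `l`. -/
lemma sum_trace_blockDiagonal'_mul {IB IC ID : Type} [Fintype IB] [Fintype IC] [Fintype ID]
    [DecidableEq IB] [DecidableEq IC] {LE : IB → ID → Prop} {HE : IC → ID → Prop} {XB : IB → Type} {XC : IC → Type}
    [∀ j, Fintype (XB j)] [∀ k, Fintype (XC k)] [∀ j, DecidableEq (XB j)]
    [∀ k, DecidableEq (XC k)] (δ : ID → ℂ)
    (V : ∀ j k, XB j → XC k → ID → ℂ) (r : ∀ j k, XB j → XC k → ℂ)
    (hV : ∀ j k x x' z z', (∑ l, if LE j l ∧ HE k l then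
      δ l * (V j k x' z l * star (V j k x z' l)) else 0) = if x = x' ∧ z = z' then r j k x z else 0)
    (b : MatrixSum XB) (c : MatrixSum XC) :
    ∑ l, δ l * ((blockDiagonal' fun e : {j // LE j l} => b e.1) *
      ((of fun x z => V x.1.1 z.1.1 x.2 z.2 l : Matrix (Σ e : {j // LE j l}, XB e.1)
        (Σ e : {k // HE k l}, XC e.1) ℂ) * (blockDiagonal' fun e : {k // HE k l} => c e.1) *
        (of fun x z => V x.1.1 z.1.1 x.2 z.2 l : Matrix (Σ e : {j // LE j l}, XB e.1)
        (Σ e : {k // HE k l}, XC e.1) ℂ)ᴴ)).trace =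
      ∑ k, ∑ z, c k z z * ∑ j, ∑ x, b j x x * r j k x z := by
  have h1 : ∀ l, ((blockDiagonal' fun e : {j // LE j l} => b e.1) *
      ((of fun x z => V x.1.1 z.1.1 x.2 z.2 l : Matrix (Σ e : {j // LE j l}, XB e.1)
        (Σ e : {k // HE k l}, XC e.1) ℂ) * (blockDiagonal' fun e : {k // HE k l} => c e.1) *
        (of fun x z => V x.1.1 z.1.1 x.2 z.2 l : Matrix (Σ e : {j // LE j l}, XB e.1)
        (Σ e : {k // HE k l}, XC e.1) ℂ)ᴴ)).trace =
      ∑ j, ∑ x, ∑ x', ∑ k, ∑ z, ∑ z', b j x x' * c k z z' * if LE j l ∧ HE k l then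
        V j k x' z l * star (V j k x z' l) else 0 := by
    intro l
    rw [trace_blockDiagonal'_mul]
    simp only [mul_blockDiagonal'_mul_apply, conjTranspose_apply, of_apply]
    rw [sum_subtype_eq_ite (fun j => LE j l) fun j => ∑ x, ∑ x', b j x x' *
      ∑ e : {k // HE k l}, ∑ z, ∑ z', V j e.1 x' z l * c e.1 z z' * star (V j e.1 x z' l)]
    refine Finset.sum_congr rfl fun j _ => ?_
    by_cases hj : LE j l
    · simp only [hj, if_true, true_and]
      refine Finset.sum_congr rfl fun x _ => Finset.sum_congr rfl fun x' _ => ?_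
      rw [sum_subtype_eq_ite (fun k => HE k l) fun k =>
        ∑ z, ∑ z', V j k x' z l * c k z z' * star (V j k x z' l), Finset.mul_sum]
      refine Finset.sum_congr rfl fun k _ => ?_
      by_cases hk : HE k l
      · simp only [hk, if_true, Finset.mul_sum]
        exact Finset.sum_congr rfl fun z _ => Finset.sum_congr rfl fun z' _ => by ring
      · simp [hk]
    · simp [hj]
  have h2 : ∀ j k x x' z z', (∑ l, δ l * (b j x x' * c k z z' *
      if LE j l ∧ HE k l then V j k x' z l * star (V j k x z' l) else 0)) =
      if x = x' then if z = z' then b j x x' * c k z z' * r j k x z else 0 else 0 := by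
    intro j k x x' z z'
    rw [← ite_and, ← mul_ite_zero, ← hV, Finset.mul_sum]
    refine Finset.sum_congr rfl fun l _ => ?_
    split_ifs <;> ring
  simp only [h1, Finset.mul_sum]
  calc _ = ∑ j, ∑ x, ∑ k, ∑ z, b j x x * c k z z * r j k x z := by
        rw [Finset.sum_comm]
        refine Finset.sum_congr rfl fun j _ => ?_
        rw [Finset.sum_comm]
        refine Finset.sum_congr rfl fun x _ => ?_
        rw [Finset.sum_comm, Finset.sum_eq_single x]
        · rw [Finset.sum_comm]
          refine Finset.sum_congr rfl fun k _ => ?_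
          rw [Finset.sum_comm]
          refine Finset.sum_congr rfl fun z _ => ?_
          rw [Finset.sum_comm, Finset.sum_eq_single z]
          · rw [h2]; simp
          · intro z' _ hz
            rw [h2]; simp [hz.symm]
          · simp
        · intro x' _ hx
          rw [Finset.sum_comm]
          refine Finset.sum_eq_zero fun k _ => ?_
          rw [Finset.sum_comm]
          refine Finset.sum_eq_zero fun z _ => ?_
          rw [Finset.sum_comm]
          refine Finset.sum_eq_zero fun z' _ => ?_
          rw [h2]; simp [hx.symm]
        · simp
    _ = ∑ j, ∑ k, ∑ z, ∑ x, c k z z * (b j x x * r j k x z) := by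
        refine Finset.sum_congr rfl fun j _ => ?_
        rw [Finset.sum_comm]
        refine Finset.sum_congr rfl fun k _ => ?_
        rw [Finset.sum_comm]
        exact Finset.sum_congr rfl fun z _ => Finset.sum_congr rfl fun x _ => by ring
    _ = _ := by
        rw [Finset.sum_comm]
        refine Finset.sum_congr rfl fun k _ => ?_
        rw [Finset.sum_comm]

variable {IA IB IC ID : Type} [Fintype IA] [Fintype IB] [Fintype IC] [Fintype ID]
  [DecidableEq IA] [DecidableEq IB] [DecidableEq IC] [DecidableEq ID]

/-- A connection on a square of graphs: complex numbers `u i j k t l` attached to the pairs of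
paths `i - j - l` and `i - k - l` (with `t` the name of the edge `i - k`), such that for fixed `i`
and `l` they form a unitary matrix, and for fixed `j` and `k` they do so after rescaling by the
vector `δ` of a trace and by further factors `ρ` and `g`. Only the values at cells whose four edges
are present matter. -/
structure Connection (GE : IA → IB → Prop) (LE : IB → ID → Prop) (KE : IA → IC → Fin 2 → Prop)
    (HE : IC → ID → Prop) (δ : ID → ℝ) where
  u : IA → IB → IC → Fin 2 → ID → ℂ
  ρ : IA → IB → ℝ
  g : IC → ℝ
  unitary : ∀ i l k t k' t', KE i k t → HE k l → KE i k' t' → HE k' l →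
    ∑ j, @ite _ (GE i j ∧ LE j l) (Classical.dec _) (u i j k t l * star (u i j k' t' l)) 0 =
      if k = k' ∧ t = t' then 1 else 0
  biunitary : ∀ j k i t i' t', GE i j → KE i k t → GE i' j → KE i' k t' →
    ∑ l, @ite _ (LE j l ∧ HE k l) (Classical.dec _)
      ((δ l : ℂ) * (u i j k t l * star (u i' j k t' l))) 0 =
      if i = i' ∧ t = t' then ((ρ i j * g k : ℝ) : ℂ) else 0
  sum_ρ : ∀ i, ∑ j, @ite _ (GE i j) (Classical.dec _) (ρ i j) 0 = 1

set_option maxHeartbeats 400000 in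
open Classical in
/-- A connection gives a commuting square. The summands of `B` and `C` are the matrices indexed by
the edges `i - j`, respectively `i - k`, with a given endpoint, and `A` is the diagonal. The summands
of `D` are the matrices indexed by the paths `i - j - l` with a given endpoint, and the connection is
the change of basis to the paths `i - k - l`. -/
theorem Connection.nonempty_commutingSquare {GE : IA → IB → Prop} {LE : IB → ID → Prop}
    {KE : IA → IC → Fin 2 → Prop} {HE : IC → ID → Prop} {δ : ID → ℝ}
    (W : Connection GE LE KE HE δ) (hδ : ∀ l, 0 < δ l) [Nonempty ID]
    {G : Matrix IA IB ℤ} {K : Matrix IA IC ℤ} {L : Matrix IB ID ℤ} {H : Matrix IC ID ℤ}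
    (hG : ∀ i j, G i j = if GE i j then 1 else 0)
    (hK : ∀ i k, K i k = ∑ t, if KE i k t then 1 else 0)
    (hL : ∀ j l, L j l = if LE j l then 1 else 0)
    (hH : ∀ k l, H k l = if HE k l then 1 else 0)
    (hdim : G * L = K * H)
    (exG : ∀ i, ∃ j, GE i j) (exG' : ∀ j, ∃ i, GE i j)
    (exK : ∀ i, ∃ k t, KE i k t) (exK' : ∀ k, ∃ i t, KE i k t)
    (exL : ∀ j, ∃ l, LE j l) (exL' : ∀ l, ∃ j, LE j l)
    (exH : ∀ k, ∃ l, HE k l) :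
    Nonempty (CommutingSquare G K L H) := by
  let XA : IA → Type := fun _ => Unit
  let EB : IB → Type := fun j => {i // GE i j}
  let XB : IB → Type := fun j => Σ e : EB j, XA e.1
  let EC : IC → Type := fun k => {q : IA × Fin 2 // KE q.1 k q.2}
  let XC : IC → Type := fun k => Σ e : EC k, XA e.1.1
  let ED : ID → Type := fun l => {j // LE j l}
  let XD : ID → Type := fun l => Σ e : ED l, XB e.1
  let EP : ID → Type := fun l => {k // HE k l}
  let XP : ID → Type := fun l => Σ e : EP l, XC e.1
  have (j : IB) : Nonempty (XB j) := let ⟨i, h⟩ := exG' j; ⟨⟨⟨i, h⟩, ()⟩⟩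
  have (k : IC) : Nonempty (XC k) := let ⟨i, t, h⟩ := exK' k; ⟨⟨⟨(i, t), h⟩, ()⟩⟩
  have (l : ID) : Nonempty (XD l) :=
    let ⟨j, h⟩ := exL' l
    let ⟨i, h'⟩ := exG' j
    ⟨⟨⟨j, h⟩, ⟨⟨i, h'⟩, ()⟩⟩⟩
  let U : ∀ l, Matrix (XD l) (XP l) ℂ := fun l a b =>
    if a.2.1.1 = b.2.1.1.1 then W.u a.2.1.1 a.1.1 b.1.1 b.2.1.1.2 l else 0
  have sumB : ∀ {M : Type} [AddCommMonoid M] (j : IB) (F : IA → M),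
      ∑ x : XB j, F x.1.1 = ∑ i, if GE i j then F i else 0 := by
    intro M _ j F
    rw [← sum_subtype_eq_ite (fun i => GE i j), Fintype.sum_sigma]
    exact Finset.sum_congr rfl fun e _ => Fintype.sum_unique _
  have sumC : ∀ {M : Type} [AddCommMonoid M] (k : IC) (F : IA × Fin 2 → M),
      ∑ x : XC k, F x.1.1 = ∑ q : IA × Fin 2, if KE q.1 k q.2 then F q else 0 := by
    intro M _ k F
    rw [← sum_subtype_eq_ite (fun q : IA × Fin 2 => KE q.1 k q.2), Fintype.sum_sigma]
    exact Finset.sum_congr rfl fun e _ => Fintype.sum_unique _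
  have sumD : ∀ {M : Type} [AddCommMonoid M] (l : ID) (F : IA → IB → M),
      ∑ x : XD l, F x.2.1.1 x.1.1 =
        ∑ j, if LE j l then ∑ i, if GE i j then F i j else 0 else 0 := by
    intro M _ l F
    rw [← sum_subtype_eq_ite (fun j => LE j l), Fintype.sum_sigma]
    exact Finset.sum_congr rfl fun e _ => sumB e.1 fun i => F i e.1
  have sumP : ∀ {M : Type} [AddCommMonoid M] (l : ID) (F : IA × Fin 2 → IC → M),
      ∑ x : XP l, F x.2.1.1 x.1.1 =
        ∑ k, if HE k l then ∑ q : IA × Fin 2, if KE q.1 k q.2 then F q k else 0 else 0 := by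
    intro M _ l F
    rw [← sum_subtype_eq_ite (fun k => HE k l), Fintype.sum_sigma]
    exact Finset.sum_congr rfl fun e _ => sumC e.1 fun i => F i e.1
  have hU2 : ∀ l, (U l)ᴴ * U l = 1 := by
    intro l
    ext ⟨⟨k', hk'⟩, ⟨⟨⟨i', t'⟩, hi'⟩, ⟨⟩⟩⟩ ⟨⟨k, hk⟩, ⟨⟨⟨i, t⟩, hi⟩, ⟨⟩⟩⟩
    rw [mul_apply]
    simp only [conjTranspose_apply]
    by_cases hii : i = i'
    · subst hii
      have h1 := W.unitary i l k t k' t' hi hk hi' hk'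
      refine (sumD l fun x j => star (if x = i then W.u x j k' t' l else 0) *
        if x = i then W.u x j k t l else 0).trans (Eq.trans ?_ (h1.trans ?_))
      · refine Finset.sum_congr rfl fun j _ => ?_
        rw [Finset.sum_eq_single i]
        · by_cases h3 : LE j l <;> by_cases h4 : GE i j <;> simp [h3, h4, mul_comm]
        · intro x _ hx
          simp [hx]
        · simp
      · rw [one_apply]
        refine if_congr ?_ rfl rfl
        constructor
        · rintro ⟨rfl, rfl⟩; rfl
        · intro h
          exact ⟨(congrArg (fun x : XP l => x.1.1) h).symm,
            (congrArg (fun x : XP l => x.2.1.1.2) h).symm⟩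
    · rw [one_apply_ne, Finset.sum_eq_zero]
      · intro x _
        simp only [U]
        split_ifs with h1 h2
        · exact absurd (h2.symm.trans h1) hii
        all_goals simp
      · intro h
        exact hii (congrArg (fun x : XP l => x.2.1.1.1) h).symm
  -- `U l` is square because `G * L = K * H`, so one of the two unitarity relations suffices.
  have hcard : ∀ l, Fintype.card (XP l) = Fintype.card (XD l) := by
    intro l
    have h1 : ∑ i, (G * L) i l = ∑ i, (K * H) i l := by rw [hdim]
    have h2 : (∑ _x : XP l, 1 : ℤ) = ∑ i, (K * H) i l := by
      rw [sumP l fun _ _ => (1 : ℤ)]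
      simp only [Matrix.mul_apply, hK, hH, Fintype.sum_prod_type]
      rw [Finset.sum_comm]
      simp
    have h3 : (∑ _x : XD l, 1 : ℤ) = ∑ i, (G * L) i l := by
      rw [sumD l fun _ _ => (1 : ℤ)]
      simp only [Matrix.mul_apply, hG, hL]
      rw [Finset.sum_comm]
      simp
    have h4 := h2.trans (h1.symm.trans h3.symm)
    simp only [Finset.sum_const, Finset.card_univ, nsmul_eq_mul, mul_one] at h4
    exact_mod_cast h4
  have hU1 : ∀ l, U l * (U l)ᴴ = 1 := fun l => by
    rw [Matrix.mul_eq_one_comm_of_card_eq]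
    · exact hU2 l
    · exact (hcard l).symm
  let φAB : MatrixSum XA →⋆ₐ[ℂ] MatrixSum XB := blockHom fun j (e : EB j) => e.1
  let φAC : MatrixSum XA →⋆ₐ[ℂ] MatrixSum XC := blockHom fun k (e : EC k) => e.1.1
  let φBD : MatrixSum XB →⋆ₐ[ℂ] MatrixSum XD := blockHom fun l (e : ED l) => e.1
  let φCP : MatrixSum XC →⋆ₐ[ℂ] MatrixSum XP := blockHom fun l (e : EP l) => e.1
  have hAB : ∀ a j, φAB a j = diagonal fun x => a x.1.1 () () := by
    intro a j
    show (blockDiagonal' fun e : EB j => a e.1) = _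
    rw [← blockDiagonal'_diagonal fun (e : EB j) (_ : Unit) => a e.1 () ()]
    rfl
  have hAC : ∀ a k, φAC a k = diagonal fun x => a x.1.1.1 () () := by
    intro a k
    show (blockDiagonal' fun e : EC k => a e.1.1) = _
    rw [← blockDiagonal'_diagonal fun (e : EC k) (_ : Unit) => a e.1.1 () ()]
    rfl
  refine StarSquare.nonempty_commutingSquare φAB φAC φBD ((conjHom U hU1 hU2).comp φCP)
    (blockHom_injective _ fun i => ?_) (blockHom_injective _ fun i => ?_)
    (blockHom_injective _ fun i => ?_)
    ((conjHom_injective U hU1 hU2).comp (blockHom_injective _ fun i => ?_)) ?_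
    (fun x j => ?_) (fun x k => ?_) (fun x l => ?_) (fun x l => ?_) δ hδ inferInstance ?_
  · obtain ⟨j, h⟩ := exG i; exact ⟨j, ⟨i, h⟩, rfl⟩
  · obtain ⟨k, t, h⟩ := exK i; exact ⟨k, ⟨(i, t), h⟩, rfl⟩
  · obtain ⟨l, h⟩ := exL i; exact ⟨l, ⟨i, h⟩, rfl⟩
  · obtain ⟨l, h⟩ := exH i; exact ⟨l, ⟨i, h⟩, rfl⟩
  · intro a
    ext l : 1
    have h1 : φBD (φAB a) l = diagonal fun x => a x.2.1.1 () () := by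
      show (blockDiagonal' fun e : ED l => φAB a e.1) = _
      simp only [hAB]
      exact blockDiagonal'_diagonal _
    have h2 : φCP (φAC a) l = diagonal fun x => a x.2.1.1.1 () () := by
      show (blockDiagonal' fun e : EP l => φAC a e.1) = _
      simp only [hAC]
      exact blockDiagonal'_diagonal _
    show φBD (φAB a) l = U l * φCP (φAC a) l * (U l)ᴴ
    have h3 : U l * φCP (φAC a) l = φBD (φAB a) l * U l := by
      rw [h1, h2]
      ext x y
      rw [mul_diagonal, diagonal_mul]
      simp only [U]
      split_ifs with h
      · rw [h, mul_comm]
      · simp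
    rw [h3, Matrix.mul_assoc, hU1, Matrix.mul_one]
  · rw [trace_blockHom, sum_subtype_eq_ite (fun i => GE i j) fun i => (x i).trace]
    simp [hG]
  · rw [trace_blockHom, sum_subtype_eq_ite (fun q : IA × Fin 2 => KE q.1 k q.2)
      fun q => (x q.1).trace, Fintype.sum_prod_type]
    simp only [hK, Int.cast_sum, Finset.sum_mul]
    simp
  · rw [trace_blockHom, sum_subtype_eq_ite (fun i => LE i l) fun i => (x i).trace]
    simp [hL]
  · rw [StarAlgHom.comp_apply, trace_conjHom, trace_blockHom,
      sum_subtype_eq_ite (fun i => HE i l) fun i => (x i).trace]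
    simp [hH]
  · have hV : ∀ j k (x x' : XB j) (z z' : XC k), (∑ l, if LE j l ∧ HE k l then (δ l : ℂ) *
        ((if x'.1.1 = z.1.1.1 then W.u x'.1.1 j k z.1.1.2 l else 0) *
          star (if x.1.1 = z'.1.1.1 then W.u x.1.1 j k z'.1.1.2 l else 0)) else 0) =
        if x = x' ∧ z = z' then if x.1.1 = z.1.1.1 then ((W.ρ x.1.1 j * W.g k : ℝ) : ℂ)
          else 0 else 0 := by
      rintro j k ⟨⟨i, hi⟩, ⟨⟩⟩ ⟨⟨i', hi'⟩, ⟨⟩⟩ ⟨⟨⟨i1, t⟩, hz⟩, ⟨⟩⟩ ⟨⟨⟨i2, t'⟩, hz'⟩, ⟨⟩⟩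
      have e1 : ((⟨⟨i, hi⟩, ()⟩ : XB j) = ⟨⟨i', hi'⟩, ()⟩) ↔ i = i' :=
        ⟨fun h => congrArg (fun x : XB j => x.1.1) h, by rintro rfl; rfl⟩
      have e2 : ((⟨⟨(i1, t), hz⟩, ()⟩ : XC k) = ⟨⟨(i2, t'), hz'⟩, ()⟩) ↔ i1 = i2 ∧ t = t' :=
        ⟨fun h => ⟨congrArg (fun x : XC k => x.1.1.1) h, congrArg (fun x : XC k => x.1.1.2) h⟩,
          by rintro ⟨rfl, rfl⟩; rfl⟩
      simp only [e1, e2]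
      by_cases h3 : i' = i1
      · by_cases h4 : i = i2
        · subst h3 h4
          simp only [if_true]
          refine Eq.trans (Finset.sum_congr rfl fun l _ => ?_)
            ((W.biunitary j k i' t i t' hi' hz hi hz').trans ?_)
          · split_ifs <;> rfl
          by_cases h5 : i = i'
          · subst h5
            simp
          · simp [h5, Ne.symm h5]
        · simp only [h4, if_false, star_zero, mul_zero, ite_self, Finset.sum_const_zero]
          split_ifs with h5 h6
          · exact absurd (h6.trans h5.2.1) h4
          all_goals rfl
      · simp only [h3, if_false, zero_mul, mul_zero, ite_self, Finset.sum_const_zero]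
        split_ifs with h5 h6
        · exact absurd (h5.1.symm.trans h6) h3
        all_goals rfl
    have key : ∀ b c, ∑ l, (δ l : ℂ) * ((φBD b * ((conjHom U hU1 hU2).comp φCP) c) l).trace =
        ∑ k, ∑ z : XC k, c k z z * ∑ j, ∑ x : XB j, b j x x *
          if x.1.1 = z.1.1.1 then ((W.ρ x.1.1 j * W.g k : ℝ) : ℂ) else 0 := by
      intro b c
      refine Eq.trans (Finset.sum_congr rfl fun l _ => ?_)
        (sum_trace_blockDiagonal'_mul (LE := LE) (HE := HE) (XB := XB) (XC := XC) (fun l => (δ l : ℂ))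
        (fun j k x z l => if x.1.1 = z.1.1.1 then W.u x.1.1 j k z.1.1.2 l else 0)
        (fun j k x z => if x.1.1 = z.1.1.1 then ((W.ρ x.1.1 j * W.g k : ℝ) : ℂ) else 0) ?_ b c)
      · rfl
      · exact hV
    intro b
    -- The conditional expectation of `b` onto `A`.
    let a : MatrixSum XA := fun i _ _ =>
      ∑ j, if h : GE i j then W.ρ i j * b j ⟨⟨i, h⟩, ()⟩ ⟨⟨i, h⟩, ()⟩ else 0
    refine ⟨a, fun c => ?_⟩
    rw [key, key]
    refine Finset.sum_congr rfl fun k _ => Finset.sum_congr rfl fun z _ => ?_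
    congr 1
    have h1 : ∀ (i : IA) (F : ∀ j, XB j → ℂ), (∑ j, ∑ x : XB j, if x.1.1 = i then F j x else 0) =
        ∑ j, if h : GE i j then F j ⟨⟨i, h⟩, ()⟩ else 0 := by
      intro i F
      refine Finset.sum_congr rfl fun j _ => ?_
      split_ifs with h
      · rw [Finset.sum_eq_single (⟨⟨i, h⟩, ()⟩ : XB j)]
        · simp
        · rintro ⟨⟨i', hi'⟩, ⟨⟩⟩ _ hne
          rw [if_neg]
          rintro rfl
          exact hne rfl
        · simp
      · refine Finset.sum_eq_zero fun x _ => if_neg ?_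
        rintro rfl
        exact h x.1.2
    simp only [hAB, diagonal_apply_eq, mul_ite, mul_zero]
    rw [h1 z.1.1.1 fun j x => b j x x * ((W.ρ x.1.1 j * W.g k : ℝ) : ℂ),
      h1 z.1.1.1 fun j x => a x.1.1 () () * ((W.ρ x.1.1 j * W.g k : ℝ) : ℂ)]
    simp only [dite_eq_ite]
    have h2 := congrArg (fun r : ℝ => (r : ℂ)) (W.sum_ρ z.1.1.1)
    simp only [Complex.ofReal_sum, Complex.ofReal_one] at h2
    calc _ = W.g k * a z.1.1.1 () () := by
          simp only [a, Finset.mul_sum]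
          refine Finset.sum_congr rfl fun j _ => ?_
          split_ifs
          · push_cast; ring
          · simp
      _ = 1 * (W.g k * a z.1.1.1 () ()) := (one_mul _).symm
      _ = _ := by
        rw [← h2, Finset.sum_mul]
        refine Finset.sum_congr rfl fun j _ => ?_
        split_ifs
        · push_cast; ring
        · simp

end Connection

/-! ### The connection on the 3-star -/

section RayWeight

/-- The weight of a cell with corners at the positions `a - b - d` and `a - c - d` of one ray, for
the eigenvector `η` along the ray and the constant `s` of the ray: these are the values of the
connection of the path algebra construction. -/
noncomputable def rayWeight (η : ℕ → ℝ) (s : ℝ) (a b c d : ℕ) : ℝ :=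
  if a = c ∧ b = d then -√(η (min a b - 1) * η (min a b + 2))
  else if a = c ∨ b = d then s
  else √(η (min (min a b) (min c d)) * η (max (max a b) (max c d)))

variable {η : ℕ → ℝ} {s : ℝ}

lemma rayWeight_symm (a b c d : ℕ) : rayWeight η s a b c d = rayWeight η s c d a b := by
  unfold rayWeight
  by_cases h1 : a = c <;> by_cases h2 : b = d
  · subst h1 h2; rfl
  · simp [h1, h2, Ne.symm h2]
  · simp [h1, h2, Ne.symm h1]
  · simp [h1, h2, Ne.symm h1, Ne.symm h2, min_comm (min c d), max_comm (max c d)]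

lemma rayWeight_both {a b m M : ℕ} (hm : m = min a b - 1) (hM : M = min a b + 2) :
    rayWeight η s a b a b = -√(η m * η M) := by
  simp [rayWeight, hm, hM]

lemma rayWeight_left {a b d : ℕ} (h : b ≠ d) : rayWeight η s a b a d = s := by
  simp [rayWeight, h]

lemma rayWeight_right {a b c : ℕ} (h : a ≠ c) : rayWeight η s a b c b = s := by
  simp [rayWeight, h]

lemma rayWeight_none {a b c d m M : ℕ} (h1 : a ≠ c) (h2 : b ≠ d)
    (hm : m = min (min a b) (min c d)) (hM : M = max (max a b) (max c d)) :
    rayWeight η s a b c d = √(η m * η M) := by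
  simp [rayWeight, h1, h2, hm, hM]

/-- Unitarity of the connection at a pair of vertices of one ray, neither of them the centre. -/
lemma rayWeight_unitary (hη : ∀ a, 0 ≤ η a) {N : ℕ} (hN1 : η (N + 1) = 0)
    (hs : ∀ a, a + 2 ≤ N → s * s + η a * η (a + 3) = η (a + 1) * η (a + 2))
    {P Q C C' : ℕ} (hP : P ≤ N) (hP2 : 2 ≤ P) (hQ : Q ≤ N) (hC : C ≤ N) (hC' : C' ≤ N)
    (hQ1 : 1 ≤ Q) (hQC : C = Q + 1 ∨ Q = C + 1) (hQC' : C' = Q + 1 ∨ Q = C' + 1)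
    (hPC : C = P + 2 ∨ P = C + 2 ∨ P = C ∧ P < N)
    (hPC' : C' = P + 2 ∨ P = C' + 2 ∨ P = C' ∧ P < N) :
    (if Q = P - 1 + 2 ∨ P - 1 = Q + 2 ∨ P - 1 = Q ∧ P - 1 < N then
      rayWeight η s P (P - 1) C Q * rayWeight η s P (P - 1) C' Q else 0) +
    (if P + 1 ≤ N then if Q = P + 1 + 2 ∨ P + 1 = Q + 2 ∨ P + 1 = Q ∧ P + 1 < N then
      rayWeight η s P (P + 1) C Q * rayWeight η s P (P + 1) C' Q else 0 else 0) =
    if C = C' then η P * η Q else 0 := by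
  have hcases : Q = P + 1 ∨ Q + 1 = P ∨ Q = P + 3 ∨ Q + 3 = P := by omega
  have sq : ∀ a b, √(η a * η b) * √(η a * η b) = η a * η b := fun a b =>
    Real.mul_self_sqrt (mul_nonneg (hη a) (hη b))
  obtain ⟨p, rfl⟩ : ∃ p, P = p + 2 := ⟨P - 2, by omega⟩
  rcases hcases with rfl | h | rfl | h
  · have h1 : C = p + 2 ∨ C = p + 4 := by omega
    have h1' : C' = p + 2 ∨ C' = p + 4 := by omega
    have e1 : rayWeight η s (p + 2) (p + 1) (p + 2) (p + 3) = s := rayWeight_left (by omega)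
    have e2 : rayWeight η s (p + 2) (p + 1) (p + 4) (p + 3) = √(η (p + 1) * η (p + 4)) :=
      rayWeight_none (by omega) (by omega) (by omega) (by omega)
    have e3 : rayWeight η s (p + 2) (p + 3) (p + 2) (p + 3) = -√(η (p + 1) * η (p + 4)) :=
      rayWeight_both (by omega) (by omega)
    have e4 : rayWeight η s (p + 2) (p + 3) (p + 4) (p + 3) = s := rayWeight_right (by omega)
    have hs' := hs (p + 1) (by omega)
    have hsq := sq (p + 1) (p + 4)
    by_cases hN : p + 4 ≤ N
    · have hN2 : p + 3 < N := by omega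
      rcases h1 with rfl | rfl <;> rcases h1' with rfl | rfl <;>
        simp [e1, e2, e3, e4, hQ, hN2] <;> linarith
    · obtain rfl : N = p + 3 := by omega
      obtain rfl : C = p + 2 := by omega
      obtain rfl : C' = p + 2 := by omega
      rw [show p + 1 + 3 = p + 3 + 1 by omega, hN1] at hs'
      simp [e1]
      linarith
  · obtain rfl : Q = p + 1 := by omega
    have h1 : C = p + 2 ∨ C = p := by omega
    have h1' : C' = p + 2 ∨ C' = p := by omega
    have e1 : rayWeight η s (p + 2) (p + 1) (p + 2) (p + 1) = -√(η p * η (p + 3)) :=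
      rayWeight_both (by omega) (by omega)
    have e2 : rayWeight η s (p + 2) (p + 1) p (p + 1) = s := rayWeight_right (by omega)
    have e3 : rayWeight η s (p + 2) (p + 3) (p + 2) (p + 1) = s := rayWeight_left (by omega)
    have e4 : rayWeight η s (p + 2) (p + 3) p (p + 1) = √(η p * η (p + 3)) :=
      rayWeight_none (by omega) (by omega) (by omega) (by omega)
    have hs' := hs p (by omega)
    have hsq := sq p (p + 3)
    have hN0 : p + 1 < N := by omega
    by_cases hN : p + 3 ≤ N
    · rcases h1 with rfl | rfl <;> rcases h1' with rfl | rfl <;>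
        simp [e1, e2, e3, e4, hN, hN0] <;> linarith
    · obtain rfl : N = p + 2 := by omega
      rw [show p + 3 = p + 2 + 1 by omega, hN1] at hs'
      obtain rfl : C = p := by omega
      obtain rfl : C' = C := by omega
      simp [e2]
      linarith
  · obtain rfl : C = p + 4 := by omega
    obtain rfl : C' = p + 4 := by omega
    have e1 : rayWeight η s (p + 2) (p + 3) (p + 4) (p + 5) = √(η (p + 2) * η (p + 5)) :=
      rayWeight_none (by omega) (by omega) (by omega) (by omega)
    have hN : p + 3 ≤ N := by omega
    simp [e1, hN, sq]
  · obtain ⟨q, rfl⟩ : ∃ q, p = q + 1 := ⟨p - 1, by omega⟩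
    obtain rfl : Q = q := by omega
    obtain rfl : C = Q + 1 := by omega
    obtain rfl : C' = Q + 1 := by omega
    have e1 : rayWeight η s (Q + 3) (Q + 2) (Q + 1) Q = √(η Q * η (Q + 3)) :=
      rayWeight_none (by omega) (by omega) (by omega) (by omega)
    simp [e1, sq, mul_comm (η (Q + 3))]
    omega

end RayWeight

section StarWeight

variable {n : Fin 3 → ℕ}

/-- The data of a connection on the 3-star near its centre: `e x y` is the cell with both corners
`i` and `k` at the centre, `X x y` and `Y x y` are those with only `i`, respectively only `k`, at
the centre; `x` and `y` are the rays of the corners `j` and `l`. The conditions say that the two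
columns `e _ y`, completed by the column `X _ y`, form a unitary matrix up to scale. (If the ray `y`
has length one, then the row `y` and the column `X _ y` do not occur in the connection.) -/
structure IsCorner (n : Fin 3 → ℕ) (ξ : Vertex n → ℝ) (lam : ℝ) (e : Fin 3 → Fin 3 → Fin 2 → ℂ)
    (X Y : Fin 3 → Fin 3 → ℂ) : Prop where
  column : ∀ y t t', ∑ z, e z y t * star (e z y t') = if t = t' then (rayVal ξ y 1 : ℂ) else 0
  column_X : ∀ y t, ∑ z, e z y t * star (X z y) = 0
  diag_X : ∀ y, X y y = (√(lam * rayVal ξ y (n y) ^ 2) : ℝ)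
  norm_X : ∀ y, ∑ z, X z y * star (X z y) = (rayVal ξ y 1 : ℂ)
  norm_Y : ∀ x y, x ≠ y → Y x y * star (Y x y) = ((rayVal ξ x 2 * rayVal ξ y 1 : ℝ) : ℂ)
  eq_zero : ∀ y, n y = 1 → e y y = 0

/-- The connection on the 3-star, before normalization. The three cases are: `i` and `k` both at the
centre; all corners on one ray; `j` and `l` on different rays, so that `i` or `k` is at the centre or
the cell does not occur. If `j` and `l` are next to the centre on one ray and just one of `i` and `k`
is at the centre, the ray rule applies. -/
noncomputable def starWeight (ξ : Vertex n → ℝ) (lam : ℝ) (e : Fin 3 → Fin 3 → Fin 2 → ℂ)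
    (X Y : Fin 3 → Fin 3 → ℂ) (i j k : Vertex n) (t : Fin 2) (l : Vertex n) : ℂ :=
  if i = none ∧ k = none then e (ray j) (ray l) t
  else if ray j = ray l then
    (rayWeight (rayVal ξ (ray j)) √(lam * rayVal ξ (ray j) (n (ray j)) ^ 2)
      (pos i) (pos j) (pos k) (pos l) : ℝ)
  else if i = none then X (ray j) (ray l) else if k = none then Y (ray j) (ray l) else 0

/-- `EdgeK i k t`: there is an edge with name `t` from `i` to `k` in the graph with adjacency matrix
`G * Gᵗ - 1`. Only the centre has two loops. -/
def EdgeK (i k : Vertex n) (t : Fin 2) : Prop := (i = none ∧ k = none) ∨ (TwoStep i k ∧ t = 0)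

variable {ξ : Vertex n → ℝ} {lam : ℝ} {e : Fin 3 → Fin 3 → Fin 2 → ℂ} {X Y : Fin 3 → Fin 3 → ℂ}

/-- The connection is invariant under the reflection of cells that exchanges `i` with `k` and `j`
with `l`. -/
lemma starWeight_symm (i j k : Vertex n) (t : Fin 2) (l : Vertex n) :
    starWeight ξ lam e X Y i j k t l =
      starWeight ξ lam (fun x y => e y x) (fun x y => Y y x) (fun x y => X y x) k l i t j := by
  unfold starWeight
  by_cases h : ray j = ray l
  · rw [rayWeight_symm]
    simp only [h, if_true]
    by_cases h1 : i = none <;> by_cases h2 : k = none <;> simp [h1, h2]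
  · by_cases h1 : i = none <;> by_cases h2 : k = none <;> simp [h1, h2, h, Ne.symm h]

lemma starWeight_centre (hn : ∀ i, 0 < n i) {y z : Fin 3} {t : Fin 2} :
    starWeight ξ lam e X Y none (vtx n z 1) none t (vtx n y 1) = e z y t := by
  simp [starWeight, ray_vtx one_pos (hn _)]

lemma starWeight_ray {x : Fin 3} {a b c d : ℕ} (ha : a ≤ n x) (hb : b ≤ n x) (hc : c ≤ n x)
    (hd : d ≤ n x) (hb0 : 0 < b) (hd0 : 0 < d) (h : a ≠ 0 ∨ c ≠ 0) (t : Fin 2) :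
    starWeight ξ lam e X Y (vtx n x a) (vtx n x b) (vtx n x c) t (vtx n x d) =
      (rayWeight (rayVal ξ x) √(lam * rayVal ξ x (n x) ^ 2) a b c d : ℝ) := by
  have : ¬ (a = 0 ∧ c = 0) := by omega
  simp [starWeight, ray_vtx hb0 hb, ray_vtx hd0 hd, pos_vtx ha, pos_vtx hb, pos_vtx hc, pos_vtx hd,
    vtx_eq_none ha, vtx_eq_none hc, this]

lemma starWeight_X (hn : ∀ i, 0 < n i) (hC : IsCorner n ξ lam e X Y) {y z : Fin 3} {t : Fin 2}
    (hy : 2 ≤ n y) :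
    starWeight ξ lam e X Y none (vtx n z 1) (vtx n y 2) t (vtx n y 1) = X z y := by
  by_cases hz : z = y
  · subst hz
    rw [hC.diag_X, ← vtx_zero (n := n) z,
      starWeight_ray (Nat.zero_le _) (hn z) hy (hn z) one_pos one_pos (by simp),
      rayWeight_right (by omega)]
  · simp [starWeight, ray_vtx one_pos (hn _), hz, vtx_eq_none hy]

lemma exists_of_adj {y : Fin 3} {q : ℕ} (hq : q + 1 ≤ n y) {k : Vertex n}
    (h : (threeStar n).Adj k (vtx n y (q + 1))) :
    ∃ c, c ≤ n y ∧ (c = q + 1 + 1 ∨ q + 1 = c + 1) ∧ k = vtx n y c := by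
  rcases (adj_vtx_succ_iff hq).1 h.symm with rfl | ⟨h1, rfl⟩
  · exact ⟨q, by omega, Or.inr rfl, rfl⟩
  · exact ⟨q + 2, h1, Or.inl rfl, rfl⟩

open Classical in
/-- Unitarity of the connection at a pair of vertices, one of them the centre. -/
lemma starWeight_unitary_centre (hn : ∀ i, 0 < n i) (hpos : ∀ v, 0 < ξ v) (hd : ξ none = 1)
    (hC : IsCorner n ξ lam e X Y) {y : Fin 3} {Q c c' : ℕ} {t t' : Fin 2} (hQ : Q ≤ n y)
    (hQ1 : Odd Q) (hc : c ≤ n y) (hc' : c' ≤ n y) (hQc : c = Q + 1 ∨ Q = c + 1)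
    (hQc' : c' = Q + 1 ∨ Q = c' + 1) (hk : EdgeK none (vtx n y c) t)
    (hk' : EdgeK none (vtx n y c') t') :
    (∑ z, if TwoStep (vtx n z 1) (vtx n y Q) then
      starWeight ξ lam e X Y none (vtx n z 1) (vtx n y c) t (vtx n y Q) *
        star (starWeight ξ lam e X Y none (vtx n z 1) (vtx n y c') t' (vtx n y Q)) else 0) =
      if c = c' ∧ t = t' then ((ξ none * ξ (vtx n y Q) : ℝ) : ℂ) else 0 := by
  rw [hd, one_mul, ← rayVal_of_le ξ hQ]
  have hcond : ∀ {c t}, c ≤ n y → EdgeK none (vtx n y c) t → c = 0 ∨ (c = 2 ∧ t = 0) := by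
    intro c t hc hk
    rcases hk with ⟨-, h⟩ | ⟨h, ht⟩
    · exact Or.inl ((vtx_eq_none hc).1 h)
    · rw [← vtx_zero (n := n) y, twoStep_vtx (Nat.zero_le _) hc] at h
      right
      refine ⟨by omega, ht⟩
  have h1 := hcond hc hk
  have h1' := hcond hc' hk'
  obtain ⟨r, rfl⟩ := hQ1
  have hr : r = 0 ∨ r = 1 := by omega
  -- `Q = 1` gives the completed matrix at the centre, and `Q = 3` a single path.
  rcases hr with rfl | rfl
  · simp only [mul_zero, zero_add]
    -- The condition on the path `z = y` can be dropped: it fails only if `e y y` vanishes.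
    have hT : ∀ z (F : ℂ), (n y = 1 → z = y → F = 0) →
        (if TwoStep (vtx n z 1) (vtx n y 1) then F else 0) = F := by
      intro z F hF
      split_ifs with h
      · rfl
      · rw [twoStep_vtx (hn z) (hn y)] at h
        have hz : z = y := by
          by_contra hz
          exact h (Or.inr (Or.inr (Or.inl ⟨rfl, rfl, hz⟩)))
        subst hz
        have hn1 : ¬ 1 < n z := fun h1 => h (Or.inr (Or.inr (Or.inr ⟨rfl, rfl, one_pos, h1⟩)))
        have := hn z
        exact (hF (by omega) rfl).symm
    rcases h1 with rfl | ⟨rfl, rfl⟩ <;> rcases h1' with rfl | ⟨rfl, rfl⟩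
    · simp only [vtx_zero, starWeight_centre hn, true_and]
      rw [← hC.column y t t']
      refine Finset.sum_congr rfl fun z _ => hT z _ ?_
      rintro h rfl
      simp [hC.eq_zero _ h]
    · simp only [vtx_zero, starWeight_centre hn, starWeight_X hn hC hc', OfNat.zero_ne_ofNat,
        false_and, if_false]
      refine Eq.trans ?_ (hC.column_X y t)
      exact Finset.sum_congr rfl fun z _ => hT z _ (by omega)
    · simp only [vtx_zero, starWeight_centre hn, starWeight_X hn hC hc, OfNat.ofNat_ne_zero,
        false_and, if_false]
      rw [← star_eq_zero, star_sum]
      refine Eq.trans ?_ (hC.column_X y t')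
      refine Finset.sum_congr rfl fun z _ => ?_
      rw [hT z _ (by omega), star_mul, star_star]
    · simp only [starWeight_X hn hC hc, and_self, if_true]
      rw [← hC.norm_X y]
      exact Finset.sum_congr rfl fun z _ => hT z _ (by omega)
  · obtain ⟨rfl, rfl⟩ : c = 2 ∧ t = 0 := by
      rcases h1 with h | h
      · omega
      · exact h
    obtain ⟨rfl, rfl⟩ : c' = 2 ∧ t' = 0 := by
      rcases h1' with h | h
      · omega
      · exact h
    simp only [twoStep_vtx (hn _) hQ]
    rw [Finset.sum_eq_single y]
    · have e1 := starWeight_ray (ξ := ξ) (lam := lam) (e := e) (X := X) (Y := Y)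
        (Nat.zero_le (n y)) (hn y) hc hQ one_pos (by norm_num) (Or.inr two_ne_zero) 0
      rw [vtx_zero] at e1
      rw [e1, rayWeight_none (m := 0) (M := 3) (by omega) (by omega) (by omega) (by omega)]
      have h0 : (0 : ℝ) ≤ rayVal ξ y 0 * rayVal ξ y 3 := by
        rw [rayVal_of_le ξ (Nat.zero_le _), rayVal_of_le ξ (show 3 ≤ n y from hQ)]
        exact (mul_pos (hpos _) (hpos _)).le
      have h3 := Real.mul_self_sqrt h0
      rw [rayVal_zero, hd, one_mul] at h3
      rw [rayVal_zero, hd, one_mul, Complex.star_def, Complex.conj_ofReal, ← Complex.ofReal_mul, h3]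
      simp
    · intro z _ hz
      simp [hz]
    · simp

open Classical in
/-- Unitarity of the connection at every pair of an even and an odd vertex. -/
lemma starWeight_unitary (hn : ∀ i, 0 < n i) (hξ : IsEigen lam ξ) (hpos : ∀ v, 0 < ξ v)
    (hd : ξ none = 1) (hC : IsCorner n ξ lam e X Y) {i l k k' : Vertex n} {t t' : Fin 2}
    (hi : Even (pos i)) (hl : Odd (pos l)) (hk : EdgeK i k t) (hkl : (threeStar n).Adj k l)
    (hk' : EdgeK i k' t') (hkl' : (threeStar n).Adj k' l) :
    (∑ v, if (threeStar n).Adj i v then if TwoStep v l then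
      starWeight ξ lam e X Y i v k t l * star (starWeight ξ lam e X Y i v k' t' l) else 0 else 0) =
      if k = k' ∧ t = t' then ((ξ i * ξ l : ℝ) : ℂ) else 0 := by
  obtain ⟨x, p, hp, rfl⟩ := exists_vtx i
  obtain ⟨y, q, hq, rfl⟩ := exists_vtx l
  rw [pos_vtx hp] at hi
  rw [pos_vtx hq] at hl
  obtain ⟨q, rfl⟩ : ∃ r, q = r + 1 := ⟨q - 1, by have := hl.pos; omega⟩
  obtain ⟨c, hc, hcq, rfl⟩ := exists_of_adj hq hkl
  obtain ⟨c', hc', hcq', rfl⟩ := exists_of_adj hq hkl'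
  have hcc : vtx n y c = vtx n y c' ↔ c = c' := by
    simp [vtx_eq_vtx hc hc']
  simp only [hcc]
  rcases p with _ | p
  · rw [vtx_zero, sum_adj_none hn]
    rw [vtx_zero] at hk hk'
    exact starWeight_unitary_centre hn hpos hd hC hq hl hc hc' hcq hcq' hk hk'
  have hT : TwoStep (vtx n x (p + 1)) (vtx n y c) ∧ t = 0 := by
    rcases hk with ⟨h, -⟩ | h
    · rw [vtx_eq_none hp] at h; omega
    · exact h
  have hT' : TwoStep (vtx n x (p + 1)) (vtx n y c') ∧ t' = 0 := by
    rcases hk' with ⟨h, -⟩ | h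
    · rw [vtx_eq_none hp] at h; omega
    · exact h
  obtain ⟨hT, rfl⟩ := hT
  obtain ⟨hT', rfl⟩ := hT'
  rw [twoStep_vtx hp hc] at hT
  rw [twoStep_vtx hp hc'] at hT'
  rw [sum_adj_vtx hp]
  obtain ⟨p', rfl⟩ : ∃ r, p = r + 1 := ⟨p - 1, by have := hi.two_dvd; omega⟩
  have hp1 : p' + 1 ≤ n x := by omega
  by_cases hxy : x = y
  · subst hxy
    have hη : ∀ a, 0 ≤ rayVal ξ x a := fun a => by
      unfold rayVal; split_ifs
      · exact (hpos _).le
      · exact le_rfl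
    have hlam := hξ.lam_pos hn hpos
    have key := rayWeight_unitary (η := rayVal ξ x) (s := √(lam * rayVal ξ x (n x) ^ 2)) hη
      (N := n x) (rayVal_of_lt ξ (by omega)) (fun a ha => by
        rw [Real.mul_self_sqrt (by positivity), ← hξ.mul_sub ha]; ring)
      (P := p' + 1 + 1) (Q := q + 1) (C := c) (C' := c') hp (by omega) hq hc hc' (by omega)
      hcq hcq' (by omega) (by omega)
    have key' := congrArg (fun r : ℝ => (r : ℂ)) key
    simp only [and_true]
    rw [← rayVal_of_le ξ hp, ← rayVal_of_le ξ hq]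
    have e0 : ∀ (P : Prop) [Decidable P] (a b : ℝ), ((if P then a else b : ℝ) : ℂ) =
        if P then (a : ℂ) else b := fun P _ a b => by split_ifs <;> rfl
    simp only [e0, Complex.ofReal_add, Complex.ofReal_zero] at key'
    rw [← key']
    congr 1
    · rw [starWeight_ray hp hp1 hc hq (by omega) (by omega) (by omega),
        starWeight_ray hp hp1 hc' hq (by omega) (by omega) (by omega)]
      refine if_congr ((twoStep_vtx hp1 hq).trans (by simp)) ?_ rfl
      simp [Complex.conj_ofReal]
    · by_cases hp3 : p' + 1 + 2 ≤ n x
      · rw [if_pos hp3, if_pos hp3]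
        rw [starWeight_ray hp hp3 hc hq (by omega) (by omega) (by omega),
          starWeight_ray hp hp3 hc' hq (by omega) (by omega) (by omega)]
        refine if_congr ((twoStep_vtx hp3 hq).trans (by simp)) ?_ rfl
        simp [Complex.conj_ofReal]
      · rw [if_neg hp3, if_neg hp3]
  -- On different rays, `i` is at distance two and `l` at distance one from the centre, and there is
  -- a single path.
  · obtain ⟨rfl, rfl⟩ : c = 0 ∧ p' = 0 := by omega
    obtain ⟨rfl, rfl⟩ : c' = 0 ∧ q = 0 := by omega
    have h1 : TwoStep (vtx n x 1) (vtx n y 1) := by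
      rw [twoStep_vtx hp1 hq]
      exact Or.inr (Or.inr (Or.inl ⟨rfl, rfl, hxy⟩))
    have h3 : (if 0 + 1 + 2 ≤ n x then if TwoStep (vtx n x (0 + 1 + 2)) (vtx n y (0 + 1)) then
        starWeight ξ lam e X Y (vtx n x (0 + 1 + 1)) (vtx n x (0 + 1 + 2)) (vtx n y 0) 0
          (vtx n y (0 + 1)) * star (starWeight ξ lam e X Y (vtx n x (0 + 1 + 1))
          (vtx n x (0 + 1 + 2)) (vtx n y 0) 0 (vtx n y (0 + 1))) else 0 else 0) = 0 := by
      split_ifs with h3 h4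
      · rw [twoStep_vtx h3 hq] at h4
        simp [hxy] at h4
      all_goals rfl
    have e1 : starWeight ξ lam e X Y (vtx n x (0 + 1 + 1)) (vtx n x (0 + 1)) (vtx n y 0) 0
        (vtx n y (0 + 1)) = Y x y := by
      simp [starWeight, ray_vtx one_pos (hn _), hxy, vtx_eq_none hp]
    rw [h3, if_pos h1, e1, add_zero, hC.norm_Y x y hxy, rayVal_of_le ξ hp, rayVal_of_le ξ hq]
    simp

end StarWeight

section StarConnection

variable {n : Fin 3 → ℕ} {ξ : Vertex n → ℝ} {lam : ℝ} {e : Fin 3 → Fin 3 → Fin 2 → ℂ}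
  {X Y : Fin 3 → Fin 3 → ℂ}

lemma edgeK_comm {i k : Vertex n} {t : Fin 2} : EdgeK i k t ↔ EdgeK k i t := by
  unfold EdgeK
  rw [twoStep_comm, and_comm (a := i = none)]

lemma exists_adj_odd (hn : ∀ i, 0 < n i) (i : EvenVertex n) :
    ∃ j : OddVertex n, (threeStar n).Adj i.1 j.1 := by
  have hi := even_pos i
  obtain ⟨i, hi'⟩ := i
  obtain ⟨x, p, hp, rfl⟩ := exists_vtx i
  simp only [pos_vtx hp] at hi
  rcases p with _ | p
  · exact ⟨oddVtx 0 1 (hn 0) odd_one, (vtx_adj_vtx (x := x) hp (hn 0)).2 (by simp)⟩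
  · refine ⟨oddVtx x p (by omega) (by grind), (vtx_adj_vtx hp (by omega)).2 (by simp)⟩

lemma exists_adj_even (j : OddVertex n) : ∃ i : EvenVertex n, (threeStar n).Adj i.1 j.1 := by
  have hj := odd_pos j
  obtain ⟨j, hj'⟩ := j
  obtain ⟨x, p, hp, rfl⟩ := exists_vtx j
  simp only [pos_vtx hp] at hj
  rcases p with _ | p
  · simp at hj
  · refine ⟨evenVtx x p (by omega) (by grind), (vtx_adj_vtx (by omega) hp).2 (by simp)⟩

lemma exists_edgeK (i : EvenVertex n) : ∃ (k : EvenVertex n) (t : Fin 2), EdgeK i.1 k.1 t := by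
  have hi := even_pos i
  obtain ⟨i, hi'⟩ := i
  obtain ⟨x, p, hp, rfl⟩ := exists_vtx i
  simp only [pos_vtx hp] at hi
  rcases p with _ | _ | p
  · exact ⟨centre, 0, Or.inl ⟨rfl, rfl⟩⟩
  · simp at hi
  · exact ⟨evenVtx x p (by omega) (by grind), 0,
      Or.inr ⟨(twoStep_vtx hp (by omega)).2 (by simp), rfl⟩⟩

lemma exists_twoStep (hn : ∀ i, 0 < n i) (j : OddVertex n) :
    ∃ l : OddVertex n, TwoStep j.1 l.1 := by
  have hj := odd_pos j
  obtain ⟨j, hj'⟩ := j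
  obtain ⟨x, p, hp, rfl⟩ := exists_vtx j
  simp only [pos_vtx hp] at hj
  rcases p with _ | _ | p
  · simp at hj
  · obtain ⟨y, hy⟩ := exists_ne x
    exact ⟨oddVtx y 1 (hn y) odd_one, (twoStep_vtx hp (hn y)).2 (by simp [hy.symm])⟩
  · exact ⟨oddVtx x p (by omega) (by grind), (twoStep_vtx hp (by omega)).2 (by simp)⟩

open Classical in
/-- The connection on the 3-star determined by its corner. The second unitarity condition is the
first one for the reflected connection. -/
noncomputable def starConnection (hn : ∀ i, 0 < n i) (hξ : IsEigen lam ξ) (hpos : ∀ v, 0 < ξ v)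
    (hd : ξ none = 1) (hC : IsCorner n ξ lam e X Y)
    (hC' : IsCorner n ξ lam (fun x y => e y x) (fun x y => Y y x) (fun x y => X y x)) :
    Connection (IA := EvenVertex n) (IB := OddVertex n) (IC := EvenVertex n) (ID := OddVertex n)
      (fun i j => (threeStar n).Adj i.1 j.1) (fun j l => TwoStep j.1 l.1)
      (fun i k t => EdgeK i.1 k.1 t) (fun k l => (threeStar n).Adj k.1 l.1) (fun l => ξ l.1) where
  u i j k t l := starWeight ξ lam e X Y i.1 j.1 k.1 t l.1 / ((√(ξ i.1) * √(ξ l.1) : ℝ) : ℂ)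
  ρ i j := ξ j.1 / (lam * ξ i.1)
  g k := lam * ξ k.1
  unitary i l k t k' t' hk hkl hk' hkl' := by
    have h := starWeight_unitary hn hξ hpos hd hC (even_pos i) (odd_pos l) hk hkl hk' hkl'
    rw [← sum_odd_adj i fun v => if TwoStep v l.1 then
      starWeight ξ lam e X Y i.1 v k.1 t l.1 * star (starWeight ξ lam e X Y i.1 v k'.1 t' l.1)
      else 0] at h
    have hne : ((ξ i.1 * ξ l.1 : ℝ) : ℂ) ≠ 0 := by
      exact_mod_cast (mul_pos (hpos _) (hpos _)).ne'
    have hsq : ((√(ξ i.1) * √(ξ l.1) : ℝ) : ℂ) * ((√(ξ i.1) * √(ξ l.1) : ℝ) : ℂ) =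
        ((ξ i.1 * ξ l.1 : ℝ) : ℂ) := by
      rw [← Complex.ofReal_mul, mul_mul_mul_comm, Real.mul_self_sqrt (hpos _).le,
        Real.mul_self_sqrt (hpos _).le]
    have h2 := congrArg (· / ((ξ i.1 * ξ l.1 : ℝ) : ℂ)) h
    simp only [Finset.sum_div] at h2
    refine Eq.trans (Finset.sum_congr rfl fun j _ => ?_) (h2.trans ?_)
    · rw [← hsq]
      by_cases h3 : (threeStar n).Adj i.1 j.1 <;> by_cases h4 : TwoStep j.1 l.1 <;> simp [h3, h4]
      ring
    · simp only [Subtype.ext_iff]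
      split_ifs
      · exact div_self hne
      · exact zero_div _
  biunitary j k i t i' t' hij hik hij' hik' := by
    have h := starWeight_unitary hn hξ hpos hd hC' (even_pos k) (odd_pos j) (edgeK_comm.1 hik) hij
      (edgeK_comm.1 hik') hij'
    simp only [← starWeight_symm] at h
    rw [← sum_odd_adj k fun v => if TwoStep v j.1 then
      starWeight ξ lam e X Y i.1 j.1 k.1 t v * star (starWeight ξ lam e X Y i'.1 j.1 k.1 t' v)
      else 0] at h
    have h2 := congrArg (· / ((√(ξ i.1) * √(ξ i'.1) : ℝ) : ℂ)) h
    simp only [Finset.sum_div] at h2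
    refine Eq.trans (Finset.sum_congr rfl fun l _ => ?_) (h2.trans ?_)
    · have hl : ((ξ l.1 : ℝ) : ℂ) = (√(ξ l.1) : ℂ) * (√(ξ l.1) : ℂ) := by
        rw [← Complex.ofReal_mul, Real.mul_self_sqrt (hpos _).le]
      have hl0 : (√(ξ l.1) : ℂ) ≠ 0 := by exact_mod_cast (Real.sqrt_pos.2 (hpos _)).ne'
      have hi0 : (√(ξ i.1) : ℂ) ≠ 0 := by exact_mod_cast (Real.sqrt_pos.2 (hpos _)).ne'
      have hi0' : (√(ξ i'.1) : ℂ) ≠ 0 := by exact_mod_cast (Real.sqrt_pos.2 (hpos _)).ne'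
      rw [twoStep_comm]
      by_cases h3 : (threeStar n).Adj k.1 l.1 <;> by_cases h4 : TwoStep l.1 j.1 <;>
        simp [h3, h4]
      rw [hl]
      field_simp
    · simp only [Subtype.ext_iff]
      have hlam := hξ.lam_pos hn hpos
      split_ifs with h5
      · have h6 : ξ i'.1 = ξ i.1 := by rw [h5.1]
        rw [h6, Real.mul_self_sqrt (hpos _).le, ← Complex.ofReal_div]
        congr 1
        have := (hpos i.1).ne'
        field_simp
      · exact zero_div _
  sum_ρ i := by
    have h := hξ i.1
    simp only [adjI_mul] at h
    rw [← sum_odd_adj i ξ] at h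
    have hne : lam * ξ i.1 ≠ 0 := (mul_pos (hξ.lam_pos hn hpos) (hpos _)).ne'
    rw [← div_self hne, ← h, Finset.sum_div]
    refine Finset.sum_congr rfl fun j _ => ?_
    split_ifs
    · rw [h]
    · simp

theorem admitsCommutingSquare_of_isCorner (hn : ∀ i, 0 < n i) (hξ : IsEigen lam ξ)
    (hpos : ∀ v, 0 < ξ v) (hd : ξ none = 1) (hC : IsCorner n ξ lam e X Y)
    (hC' : IsCorner n ξ lam (fun x y => e y x) (fun x y => Y y x) (fun x y => X y x)) :
    AdmitsCommutingSquare n := by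
  have : Nonempty (OddVertex n) := ⟨oddVtx 0 1 (hn 0) odd_one⟩
  refine (starConnection hn hξ hpos hd hC hC').nonempty_commutingSquare (fun l => hpos l.1)
    (fun i j => ?_) (fun i k => ?_) (fun j l => ?_) (fun k l => ?_) ?_ (exists_adj_odd hn)
    exists_adj_even exists_edgeK (fun k => ?_) (exists_twoStep hn) (fun l => ?_)
    (exists_adj_odd hn)
  · rw [biadjacency_apply, adjI]
  · rw [evenBlock_apply hn, twoStepCount, Fin.sum_univ_two]
    unfold EdgeK
    by_cases h1 : i.1 = none ∧ k.1 = none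
    · simp [h1]
    · by_cases h2 : TwoStep i.1 k.1 <;> simp [h1, h2]
  · rw [oddBlock_apply hn, twoStepCount, if_neg]
    rintro ⟨h, -⟩
    have := odd_pos j
    rw [pos_eq_zero.2 h] at this
    simp at this
  · rw [biadjacency_apply, adjI]
  · rw [Matrix.mul_sub, Matrix.sub_mul, Matrix.mul_one, Matrix.one_mul, Matrix.mul_assoc]
  · obtain ⟨i, t, h⟩ := exists_edgeK k
    exact ⟨i, t, edgeK_comm.1 h⟩
  · obtain ⟨j, h⟩ := exists_twoStep hn l
    exact ⟨j, twoStep_comm.1 h⟩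

end StarConnection

section Completion

/-- Two orthogonal vectors of equal length in `ℂ³` are completed to a multiple of a unitary matrix
by the conjugate of their cross product, and the phase may be chosen to make one coordinate
nonnegative. -/
lemma exists_completion (f : Fin 3 → Fin 2 → ℂ) {a : ℝ} (ha : 0 < a)
    (hf : ∀ t t', ∑ z, f z t * star (f z t') = if t = t' then (a : ℂ) else 0) (y : Fin 3) {s : ℝ}
    (hs : 0 ≤ s) (hs2 : ((s ^ 2 : ℝ) : ℂ) = a - ∑ t, f y t * star (f y t)) :
    ∃ X : Fin 3 → ℂ, X y = s ∧ (∀ t, ∑ z, f z t * star (X z) = 0) ∧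
      ∀ z, X z * star (X z) = a - ∑ t, f z t * star (f z t) := by
  let g : Fin 3 → ℂ := fun z => f (z + 1) 0 * f (z + 2) 1 - f (z + 2) 0 * f (z + 1) 1
  have hg : ∀ z, g z * star (g z) = a * (a - ∑ t, f z t * star (f z t)) := by
    intro z
    have h3 : ∀ F : Fin 3 → ℂ, ∑ x, F x = F z + F (z + 1) + F (z + 2) := by
      intro F
      rw [Fin.sum_univ_three]
      fin_cases z
      · rfl
      · exact add_rotate _ _ _
      · exact (add_rotate _ _ _).symm
    have h00 := hf 0 0
    have h01 := hf 0 1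
    have h10 := hf 1 0
    have h11 := hf 1 1
    simp only [h3, if_true, zero_ne_one, one_ne_zero, if_false] at h00 h01 h10 h11
    rw [Fin.sum_univ_two]
    simp only [g, star_sub, star_mul']
    -- the identity of Lagrange, for the vectors with the coordinate `z` left out
    linear_combination (f (z + 1) 1 * star (f (z + 1) 1) + f (z + 2) 1 * star (f (z + 2) 1)) * h00 +
      (a - f z 0 * star (f z 0)) * h11 -
      (f (z + 1) 1 * star (f (z + 1) 0) + f (z + 2) 1 * star (f (z + 2) 0)) * h01 +
      f z 0 * star (f z 1) * h10
  have hg0 : ∀ t, ∑ z, f z t * g z = 0 := by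
    intro t
    simp only [g, Fin.sum_univ_three]
    fin_cases t <;> simp <;> ring
  have ha' : (0 : ℝ) < √a := Real.sqrt_pos.2 ha
  have haa : (√a : ℂ) * (√a : ℂ) = a := by
    rw [← Complex.ofReal_mul, Real.mul_self_sqrt ha.le]
  have ha0 : (√a : ℂ) ≠ 0 := by exact_mod_cast ha'.ne'
  let φ : ℂ := Complex.exp ((g y).arg * Complex.I)
  have hφ : φ * star φ = 1 := by
    rw [Complex.star_def, Complex.mul_conj, Complex.normSq_eq_norm_sq,
      Complex.norm_exp_ofReal_mul_I]
    simp
  have hgy : g y = ‖g y‖ * φ := (Complex.norm_mul_exp_arg_mul_I (g y)).symm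
  refine ⟨fun z => φ * star (g z) / √a, ?_, ?_, ?_⟩
  · have h1 : ‖g y‖ ^ 2 = a * s ^ 2 := by
      have h := hg y
      rw [← hs2, Complex.star_def, Complex.mul_conj, Complex.normSq_eq_norm_sq] at h
      exact_mod_cast h
    have h2 : ‖g y‖ = √a * s := by
      rw [← Real.sqrt_sq (norm_nonneg (g y)), h1, Real.sqrt_mul ha.le, Real.sqrt_sq hs]
    have h3 : star (g y) = ‖g y‖ * star φ := by
      conv_lhs => rw [hgy]
      simp [Complex.conj_ofReal]
    show φ * star (g y) / √a = s
    rw [h3, show φ * (‖g y‖ * star φ) / √a = (φ * star φ) * ‖g y‖ / √a by ring, hφ, h2]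
    push_cast
    field_simp
  · intro t
    have : ∀ z, f z t * star (φ * star (g z) / √a) = star φ / √a * (f z t * g z) := by
      intro z
      simp [Complex.conj_ofReal]
      ring
    simp only [this, ← Finset.mul_sum, hg0, mul_zero]
  · intro z
    have h := hg z
    have h1 : φ * star (g z) / √a * star (φ * star (g z) / √a) =
        (φ * star φ) * (g z * star (g z)) / (√a * √a) := by
      simp [Complex.conj_ofReal]
      ring
    rw [h1, hφ, hg, haa, one_mul, mul_div_cancel_left₀]
    exact_mod_cast ha.ne'

end Completion

section Corner

variable {n : Fin 3 → ℕ} {ξ : Vertex n → ℝ} {lam : ℝ} {e : Fin 3 → Fin 3 → Fin 2 → ℂ}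

/-- The completion of the columns of `e`, with the diagonal entries prescribed by the ray rule of
the connection. -/
lemma exists_corner_completion (hn : ∀ i, 0 < n i) (hξ : IsEigen lam ξ) (hpos : ∀ v, 0 < ξ v)
    (hd : ξ none = 1)
    (hdiag : ∀ y, ∑ t, e y y t * star (e y y t) =
      (((lam - rayVal ξ y 1) * (lam * rayVal ξ y 1 - 1) : ℝ) : ℂ))
    (hcol : ∀ y t t', ∑ z, e z y t * star (e z y t') = if t = t' then (rayVal ξ y 1 : ℂ) else 0) :
    ∃ X : Fin 3 → Fin 3 → ℂ, (∀ y t, ∑ z, e z y t * star (X z y) = 0) ∧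
      (∀ y, X y y = (√(lam * rayVal ξ y (n y) ^ 2) : ℝ)) ∧
      ∀ z y, X z y * star (X z y) = rayVal ξ y 1 - ∑ t, e z y t * star (e z y t) := by
  have h : ∀ y, ∃ x : Fin 3 → ℂ, x y = (√(lam * rayVal ξ y (n y) ^ 2) : ℝ) ∧
      (∀ t, ∑ z, e z y t * star (x z) = 0) ∧
      ∀ z, x z * star (x z) = rayVal ξ y 1 - ∑ t, e z y t * star (e z y t) := by
    intro y
    have hlam := hξ.lam_pos hn hpos
    refine exists_completion (fun z => e z y) ?_ (hcol y) y (Real.sqrt_nonneg _) ?_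
    · rw [rayVal_of_le ξ (hn y)]
      exact hpos _
    · have h1 := hξ.sq_sub (hn y)
      have h2 := hξ.recursion (hn y)
      simp only [zero_add, rayVal_zero, hd] at h1 h2
      rw [Real.sq_sqrt (by positivity), hdiag, ← Complex.ofReal_sub]
      congr 1
      rw [← h1]
      linear_combination lam * h2
  choose x hx using h
  exact ⟨fun z y => x y z, fun y => (hx y).2.1, fun y => (hx y).1, fun z y => (hx y).2.2 z⟩

lemma exists_isCorner (hn : ∀ i, 0 < n i) (hξ : IsEigen lam ξ) (hpos : ∀ v, 0 < ξ v)
    (hd : ξ none = 1)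
    (hdiag : ∀ y, ∑ t, e y y t * star (e y y t) =
      (((lam - rayVal ξ y 1) * (lam * rayVal ξ y 1 - 1) : ℝ) : ℂ))
    (hoff : ∀ x y, x ≠ y → ∑ t, e x y t * star (e x y t) =
      ((rayVal ξ x 1 + rayVal ξ y 1 - lam * rayVal ξ x 1 * rayVal ξ y 1 : ℝ) : ℂ))
    (hcol : ∀ y t t', ∑ z, e z y t * star (e z y t') = if t = t' then (rayVal ξ y 1 : ℂ) else 0)
    (hrow : ∀ x t t', ∑ z, e x z t * star (e x z t') = if t = t' then (rayVal ξ x 1 : ℂ) else 0) :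
    ∃ X Y : Fin 3 → Fin 3 → ℂ, IsCorner n ξ lam e X Y ∧
      IsCorner n ξ lam (fun x y => e y x) (fun x y => Y y x) (fun x y => X y x) := by
  obtain ⟨X, hX1, hX2, hX3⟩ := exists_corner_completion hn hξ hpos hd hdiag hcol
  obtain ⟨Y, hY1, hY2, hY3⟩ := exists_corner_completion (e := fun x y => e y x) hn hξ hpos hd
    hdiag hrow
  have hr : ∀ x, rayVal ξ x 2 = lam * rayVal ξ x 1 - 1 := by
    intro x
    have h2 := hξ.recursion (hn x)
    simp only [zero_add, rayVal_zero, hd] at h2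
    linarith
  have hzero : ∀ y, n y = 1 → e y y = 0 := by
    intro y hy
    have h1 := hdiag y
    rw [← hr, rayVal_of_lt ξ (by omega : n y < 2), mul_zero, Complex.ofReal_zero,
      Fin.sum_univ_two] at h1
    simp only [Complex.star_def, Complex.mul_conj] at h1
    have h2 : Complex.normSq (e y y 0) + Complex.normSq (e y y 1) = 0 := by exact_mod_cast h1
    have h3 := Complex.normSq_nonneg (e y y 0)
    have h4 := Complex.normSq_nonneg (e y y 1)
    ext t
    fin_cases t
    · exact Complex.normSq_eq_zero.1 (show Complex.normSq (e y y 0) = 0 by linarith)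
    · exact Complex.normSq_eq_zero.1 (show Complex.normSq (e y y 1) = 0 by linarith)
  -- the trace of the identity `∑ z, e z ⊗ conj (e z) = a • 1` in dimension two
  have hsum : ∀ (x : Fin 3 → ℂ) (g : Fin 3 → Fin 2 → ℂ) (a : ℂ),
      (∀ z, x z = a - ∑ t, g z t * star (g z t)) →
      (∀ t t', ∑ z, g z t * star (g z t') = if t = t' then a else 0) → ∑ z, x z = a := by
    intro x g a h1 h2
    simp only [h1, Finset.sum_sub_distrib]
    rw [Finset.sum_comm]
    simp only [h2, if_true, Finset.sum_const, Finset.card_univ, Fintype.card_fin, nsmul_eq_mul]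
    push_cast
    ring
  refine ⟨X, fun x y => Y y x, ⟨hcol, hX1, hX2, fun y => ?_, fun x y hxy => ?_, hzero⟩,
    ⟨hrow, hY1, hY2, fun y => ?_, fun x y hxy => ?_, hzero⟩⟩
  · exact hsum _ _ _ (fun z => hX3 z y) (hcol y)
  · rw [hY3 y x, hoff x y hxy, hr, ← Complex.ofReal_sub]
    congr 1; ring
  · exact hsum _ _ _ (fun z => hY3 z y) (hrow y)
  · rw [hX3 y x, hoff y x hxy.symm, hr, ← Complex.ofReal_sub]
    congr 1; ring

end Corner

end StarSquare

/-! ### Commuting squares and nine vectors -/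

theorem mainTheorem4 (n : Fin 3 → ℕ) (hn : ∀ i, 0 < n i)
    (ξ : StarSquare.Vertex n → ℝ) (lam : ℝ)
    (hξ : StarSquare.IsPerronFrobenius (StarSquare.adjacency n ℝ) lam ξ)
    (hd : ξ none = 1)
    (α : Fin 3 → ℝ) (hα : ∀ i, α i = ξ (some ⟨i, ⟨0, hn i⟩⟩)) :
    lam = α 0 + α 1 + α 2 ∧
    (StarSquare.AdmitsCommutingSquare n ↔
      ∃ e : Fin 3 → Fin 3 → EuclideanSpace ℂ (Fin 2),
        (∀ i, ‖e i i‖ ^ 2 = (lam - α i) * (lam * α i - 1)) ∧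
        (∀ i j, i ≠ j → ‖e i j‖ ^ 2 = α i + α j - lam * α i * α j) ∧
        (∀ i, ∑ j, InnerProductSpace.rankOne ℂ (e i j) (e i j) =
          (α i : ℂ) • ContinuousLinearMap.id ℂ (EuclideanSpace ℂ (Fin 2))) ∧
        (∀ j, ∑ i, InnerProductSpace.rankOne ℂ (e i j) (e i j) =
          (α j : ℂ) • ContinuousLinearMap.id ℂ (EuclideanSpace ℂ (Fin 2)))) := by
  obtain ⟨hpos, hev⟩ := hξ
  have hE := StarSquare.isEigen_of_mulVec hev
  have hα' : ∀ i, StarSquare.rayVal ξ i 1 = α i := fun i => by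
    rw [StarSquare.rayVal_of_le ξ (hn i), StarSquare.vtx_succ (hn i), hα]
  have hα'' : ∀ i, ξ (StarSquare.firstVtx hn i).1 = α i := fun i => by
    rw [← hα', StarSquare.rayVal_of_le ξ (hn i)]
    rfl
  have hlam : lam = α 0 + α 1 + α 2 := by
    have h := hE.at_centre hn
    rw [hd, mul_one, Fin.sum_univ_three, hα', hα', hα'] at h
    exact h
  have hnorm : ∀ v : EuclideanSpace ℂ (Fin 2), ((‖v‖ ^ 2 : ℝ) : ℂ) = ∑ t, v t * star (v t) := by
    intro v
    rw [EuclideanSpace.norm_sq_eq]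
    push_cast
    exact Finset.sum_congr rfl fun t _ => (Complex.mul_conj' (v t)).symm
  refine ⟨hlam, ?_, ?_⟩
  · rintro ⟨S⟩
    obtain ⟨e, h1, h2, h3⟩ := StarSquare.exists_vectors hn hE hpos hd S
    simp only [hα''] at h1 h2 h3
    have hoff : ∀ i j, i ≠ j → ∑ t, ‖e i j t‖ ^ 2 = α i + α j - lam * α i * α j := by
      intro i j hij
      rw [h1 i j hij]
      ring
    refine ⟨fun i j => WithLp.toLp 2 (e i j), fun i => ?_, fun i j hij => ?_,
      fun i => (StarSquare.sum_rankOne_eq_iff _ _).2 (h3 i),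
      fun j => (StarSquare.sum_rankOne_eq_iff _ _).2 (h2 j)⟩
    · rw [EuclideanSpace.norm_sq_eq]
      -- The trace of the identity for the column `i` determines the remaining norm.
      have h4 : ∑ z, ∑ t, ‖e z i t‖ ^ 2 = 2 * α i := by
        rw [Finset.sum_comm]
        have h5 : ∀ t, ∑ z, ‖e z i t‖ ^ 2 = α i := by
          intro t
          have h6 := h2 i t t
          rw [if_pos rfl] at h6
          have h7 : ((∑ z, ‖e z i t‖ ^ 2 : ℝ) : ℂ) = (α i : ℂ) := by
            rw [← h6]
            push_cast
            exact Finset.sum_congr rfl fun z _ => (Complex.mul_conj' _).symm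
          exact_mod_cast h7
        simp [h5]
      rw [← Finset.add_sum_erase _ _ (Finset.mem_univ i),
        Finset.sum_congr rfl fun z hz => hoff z i (Finset.ne_of_mem_erase hz)] at h4
      have h8 : ∑ z ∈ Finset.univ.erase i, (α z + α i - lam * α z * α i) =
          ∑ z, (α z + α i - lam * α z * α i) - (α i + α i - lam * α i * α i) := by
        rw [← Finset.add_sum_erase _ _ (Finset.mem_univ i)]
        ring
      rw [h8, Fin.sum_univ_three] at h4
      show ∑ t, ‖e i i t‖ ^ 2 = _
      linear_combination h4 - (lam * α i - 1) * hlam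
    · rw [EuclideanSpace.norm_sq_eq]
      exact hoff i j hij
  · rintro ⟨e, hdiag, hoff, hrow, hcol⟩
    obtain ⟨X, Y, hC, hC'⟩ := StarSquare.exists_isCorner (e := fun x y t => e x y t) hn hE hpos hd
      (fun y => by rw [← hnorm, hdiag, hα']) (fun x y hxy => by rw [← hnorm, hoff x y hxy, hα', hα'])
      (fun y => by rw [hα']; exact (StarSquare.sum_rankOne_eq_iff _ _).1 (hcol y))
      (fun x => by rw [hα']; exact (StarSquare.sum_rankOne_eq_iff _ _).1 (hrow x))
    exact StarSquare.admitsCommutingSquare_of_isCorner hn hE hpos hd hC hC'
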